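/- Let $n\ge 1$, $M\ge1$ and $\nu_1,\dots,\nu_M\ge 0$ be integers, $\nu_0=0$, let $\Sigma_t\in\mathbb C^{n\times n}$ be Hermitian positive definite with positive definite square root $\sqrt{\Sigma_t}$, put $\sigma_k=(\Sigma_t^{-1})_{kk}$, and let $\delta>0$. For a random matrix $H$ of size $(n+\nu_M)\times n$ the zero-forcing SINR of stream $k$ and the ergodic sum rate are $$\gamma_k=\frac{\delta}{[(H^\dagger H)^{-1}]_{kk}},\qquad R=\sum_{k=1}^{n}\mathbb E[\ln(1+\gamma_k)].$$ For $x>0$ and real parameters with $\max_j (a_j-1)<\min_j c_j$, write $$G^{m,r}_{r+p,m+q}\!\left(\left.\begin{matrix}a_1,\dots,a_r;\,b_1,\dots,b_p\\ c_1,\dots,c_m;\,d_1,\dots,d_q\end{matrix}\right|x\right)=\frac1{2\pi i}\int_{\tau-i\infty}^{\tau+i\infty}\frac{\prod_{j=1}^m\Gamma(c_j-s)\prod_{j=1}^r\Gamma(1-a_j+s)}{\prod_{j=1}^p\Gamma(b_j-s)\prod_{j=1}^q\Gamma(1-d_j+s)}\,x^s\,ds,$$ where $\tau$ is any real number with $a_j-1<\tau<c_j$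 for all $j$ and the integral is the limit of the integrals from $\tau-iT$ to $\tau+iT$ as $T\to\infty$. A dash stands for an empty list of parameters. All the Meijer G-functions below converge, for every admissible $\tau$ and independently of it, to real values. **(Gaussian case.)** Let $H=P_M\cdots P_1\sqrt{\Sigma_t}$, where $P_1,\dots,P_M$ are independent and $P_j$ is an $(n+\nu_j)\times(n+\nu_{j-1})$ complex Ginibre matrix (its entries are independent, with real and imaginary parts independent centred normal of variance $1/2$). Then, for every $k$, $\gamma_k$ has the density, on $(0,\infty)$, $$\rho_M(\gamma)=\frac{\sigma_k}{\left(\prod_{j=1}^M\nu_j!\right)\delta}\,G^{M,0}_{0,M}\!\left(\left.\begin{matrix}-;\,-\\ \nu_1,\dots,\nu_M;\,-\end{matrix}\right|\frac{\sigma_k\gamma}{\delta}\right),$$ where the G-function is nonnegative; each $\ln(1+\gamma_k)$ is integrable, and $$R_M=\frac1{\prod_{j=1}^M\nu_j!}\sum_{k=1}^{n}G^{1,M+2}_{M+2,2}\!\left(\left.\begin{matrix}-\nu_1,\dots,-\nu_M,1,1;\,-\\ 1;\,0\end{matrix}\right|\frac{\delta}{\sigma_k}\right).$$ If $M=1$,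 the density on $(0,\infty)$, with $\nu=\nu_1$, is that of a Gamma law, $$\rho_{M=1}(\gamma)=\frac{\sigma_k}{\nu!\,\delta}\left(\frac{\sigma_k\gamma}{\delta}\right)^{\nu}\exp\!\left[-\frac{\sigma_k\gamma}{\delta}\right].$$ **(Jacobi case.)** Let $\mu_1,\dots,\mu_M$ be integers with $\mu_j\ge\nu_j$ and $\mu_j\ge\nu_{j-1}$, let $U_1,\dots,U_M$ be independent, with $U_j$ a Haar distributed unitary matrix of size $(n+\mu_j)\times(n+\mu_j)$, and let $H=P_M\cdots P_1\sqrt{\Sigma_t}$, where $P_j$ is the upper left $(n+\nu_j)\times(n+\nu_{j-1})$ block of $U_j$. If $\mu_j>\nu_j$ for at least one $j$, then, for every $k$, $\gamma_k$ has the density, on $(0,\infty)$, $$\rho_{\rm Jacobi}(\gamma)=\frac{\sigma_k}{\delta}\left(\prod_{j=1}^M\frac{\mu_j!}{\nu_j!}\right)G^{M,0}_{M,M}\!\left(\left.\begin{matrix}-;\,\mu_1,\dots,\mu_M\\ \nu_1,\dots,\nu_M;\,-\end{matrix}\right|\frac{\sigma_k\gamma}{\delta}\right),$$ where the G-function is nonnegative.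 In all cases (also if $\mu_j=\nu_j$ for all $j$), each $\ln(1+\gamma_k)$ is integrable, and $$R_{\rm Jacobi}=\left(\prod_{j=1}^M\frac{\mu_j!}{\nu_j!}\right)\sum_{k=1}^{n}G^{1,M+2}_{M+2,M+2}\!\left(\left.\begin{matrix}-\nu_1,\dots,-\nu_M,1,1;\,-\\ 1;\,-\mu_1,\dots,-\mu_M,0\end{matrix}\right|\frac{\delta}{\sigma_k}\right).$$ -/

import Mathlib

open MeasureTheory ProbabilityTheory Filter Topology
open scoped Matrix MatrixOrder ComplexOrder

noncomputable section

/-! ## Meijer G-functions -/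

/-- The integrand
`∏ Γ(c_j - s) ∏ Γ(1 - a_j + s) / (∏ Γ(b_j - s) ∏ Γ(1 - d_j + s)) * x ^ s`
of the Mellin-Barnes integral of the Meijer G-function with upper parameters `a; b` and lower
parameters `c; d`. In the index notation `G^{m,n}_{n+p,m+q}` the orders `n, p, m, q` are the lengths
of the lists `a, b, c, d`. -/
def meijerIntegrand (a b c d : List ℝ) (x : ℝ) (s : ℂ) : ℂ :=
  ((c.map fun u => Complex.Gamma ((u : ℂ) - s)).prod *
      (a.map fun u => Complex.Gamma (1 - (u : ℂ) + s)).prod) /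
    ((b.map fun u => Complex.Gamma ((u : ℂ) - s)).prod *
      (d.map fun u => Complex.Gamma (1 - (u : ℂ) + s)).prod) * (x : ℂ) ^ s

/-- The upward vertical line `Re s = τ` has all the poles of the `Γ(c_j - s)`, that is the points
`c_j, c_j + 1, …`, on its right and all the poles of the `Γ(1 - a_j + s)`, that is the points
`a_j - 1, a_j - 2, …`, on its left. -/
def IsMeijerLine (a c : List ℝ) (τ : ℝ) : Prop :=
  (∀ u ∈ c, τ < u) ∧ (∀ u ∈ a, u - 1 < τ)

/-- The Meijer G-function with parameters `a; b` over `c; d` has the value `g` at `x > 0`: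
there is a separating vertical line, and along every such line the contour integral
`∫ ds / (2πi)` of the integrand, from `τ - i∞` to `τ + i∞`, converges to `g`. (The integral is
the limit of the integrals from `τ - iT` to `τ + iT`; it need not converge absolutely.) -/
def HasMeijerG (a b c d : List ℝ) (x : ℝ) (g : ℂ) : Prop :=
  (∃ τ : ℝ, IsMeijerLine a c τ) ∧
    ∀ τ : ℝ, IsMeijerLine a c τ →
      Tendsto
        (fun T : ℝ => (1 / (2 * (Real.pi : ℂ))) *
          ∫ t in (-T)..T, meijerIntegrand a b c d x ((τ : ℂ) + (t : ℂ) * Complex.I))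
        atTop (𝓝 g)

/-! ## Random matrices -/

/-- The product `σ`-algebra (equal to the Borel `σ`-algebra) on complex matrices. -/
instance complexMatrixMeasurableSpace {m n : Type*} : MeasurableSpace (Matrix m n ℂ) :=
  inferInstanceAs (MeasurableSpace (m → n → ℂ))

instance complexMatrixBorelSpace {m n : Type*} [Countable m] [Countable n] :
    BorelSpace (Matrix m n ℂ) :=
  inferInstanceAs (BorelSpace (m → n → ℂ))

/-- The standard circularly symmetric complex normal law: real and imaginary part are independent
centred normal variables of variance `1/2`. -/
def stdComplexGaussian : Measure ℂ :=
  ((gaussianReal 0 (1 / 2)).prod (gaussianReal 0 (1 / 2))).map fun p => (⟨p.1, p.2⟩ : ℂ)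

/-- The law of a complex Ginibre matrix: all entries are independent standard complex normal. -/
def ginibreMeasure (m n : ℕ) : Measure (Matrix (Fin m) (Fin n) ℂ) :=
  Measure.pi fun _ : Fin m => Measure.pi fun _ : Fin n => stdComplexGaussian

/-- The upper left `m × k` block of an `N × N` matrix. -/
def topLeftBlock {m k N : ℕ} (hm : m ≤ N) (hk : k ≤ N) (U : Matrix (Fin N) (Fin N) ℂ) :
    Matrix (Fin m) (Fin k) ℂ :=
  U.submatrix (Fin.castLE hm) (Fin.castLE hk)

/-- The dimensions `n + ν₀, n + ν₁, …, n + ν_M` with `ν₀ = 0`; the argument `ν` lists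
`ν₁, …, ν_M`. -/
def chainDim (n : ℕ) {M : ℕ} (ν : Fin M → ℕ) : Fin (M + 1) → ℕ :=
  Fin.cons n fun j => n + ν j

/-- The product `P_M ⋯ P_1` of matrices `P_j` of size `d_j × d_{j-1}`, `j = 1, …, M`. -/
def chainProd : (M : ℕ) → (d : Fin (M + 1) → ℕ) →
    ((j : Fin M) → Matrix (Fin (d j.succ)) (Fin (d j.castSucc)) ℂ) →
    Matrix (Fin (d (Fin.last M))) (Fin (d 0)) ℂ
  | 0, d, _ => (1 : Matrix (Fin (d 0)) (Fin (d 0)) ℂ)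
  | M + 1, d, P =>
      P (Fin.last M) * chainProd M (fun i => d i.castSucc) (fun j => P j.castSucc)

/-- The channel matrix `H = P_M ⋯ P_1 √Σ`, of size `(n + ν_M) × n`, where `P_j` has size
`(n + ν_j) × (n + ν_{j-1})` and `√Σ` is the positive semidefinite square root. -/
def channelMatrix {n M : ℕ} (ν : Fin M → ℕ)
    (P : (j : Fin M) → Matrix (Fin (chainDim n ν j.succ)) (Fin (chainDim n ν j.castSucc)) ℂ)
    (S : Matrix (Fin n) (Fin n) ℂ) :
    Matrix (Fin (chainDim n ν (Fin.last M))) (Fin n) ℂ :=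
  (show Matrix (Fin (chainDim n ν (Fin.last M))) (Fin n) ℂ from chainProd M (chainDim n ν) P) *
    CFC.sqrt S

/-! ## Zero-forcing receiver -/

/-- The zero-forcing SINR of the `k`-th stream, `δ / [(H† H)⁻¹]_{kk}`. -/
def zfSINR {r n : ℕ} (δ : ℝ) (H : Matrix (Fin r) (Fin n) ℂ) (k : Fin n) : ℝ :=
  δ / ((Hᴴ * H)⁻¹ k k).re

/-- The number `σ_k = (Σ⁻¹)_{kk}`. -/
def invDiag {n : ℕ} (S : Matrix (Fin n) (Fin n) ℂ) (k : Fin n) : ℝ :=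
  (S⁻¹ k k).re

/-- The ergodic sum rate `∑_k 𝔼[ln (1 + γ_k)]` of the zero-forcing receiver for the random channel
`H`. -/
def zfSumRate {Ω : Type*} [MeasurableSpace Ω] (Pr : Measure Ω) {r n : ℕ} (δ : ℝ)
    (H : Ω → Matrix (Fin r) (Fin n) ℂ) : ℝ :=
  ∑ k : Fin n, ∫ ω, Real.log (1 + zfSINR δ (H ω) k) ∂Pr

/-- The real random variable `X` has law with density `f` on `(0, ∞)` and `0` elsewhere. -/
def HasPosDensity {Ω : Type*} [MeasurableSpace Ω] (Pr : Measure Ω) (X : Ω → ℝ) (f : ℝ → ℝ) : Prop :=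
  HasLaw X ((volume.restrict (Set.Ioi 0)).withDensity fun y => ENNReal.ofReal (f y)) Pr

/-- The parameter list `ν₁, …, ν_M`. -/
def paramList {M : ℕ} (ν : Fin M → ℕ) : List ℝ := List.ofFn fun j => (ν j : ℝ)

/-- The parameter list `-ν₁, …, -ν_M`. -/
def negParamList {M : ℕ} (ν : Fin M → ℕ) : List ℝ := List.ofFn fun j => -(ν j : ℝ)

end

/-! Up to the factor `δ`, the SINR is the gain `zfGain A k = 1 / [(A†A)⁻¹]_{kk}`, and the whole
proof rests on the fact that this gain behaves multiplicatively. If `Z` has full column rank, then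
`Z = Y T` with `Y` an isometry and `T` chosen so that the `k`-th gain of `P Z` is the gain of `Z`
times the gain of `P Y`, for every `P` (`exists_unitary_zfGain_mul`). Completing `Y` to a unitary
`Q` turns `P Y` into a block of columns of `P Q`. If the law of `P` is invariant under right
multiplication by unitaries, the gain of `P Z` is therefore distributed as the gain of `Z` times an
independent gain of a column block of `P` (`map_prod_zfGain_mul`). Along the chain the complex
moments `𝔼[X ^ s]` thus multiply (`hasMoments_zfGain_chainProd`), and `√Σ` contributes only the
constant gain `1 / σ_k`.

For a single Ginibre factor the gain is the squared distance of a Gaussian column from the span of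
the other columns, hence Gamma distributed with shape `ν_j + 1` (`map_zfGain_ginibreMeasure`). For a
truncated Haar factor no matrix density is needed: let `R` consist of the top rows of `U`, and let
`A` be an independent Ginibre matrix. Left invariance of `A` makes `R A` Ginibre, so its gain is
Gamma with parameter `ν_j`; right invariance of `R` factors the same gain as a Gamma variable with
parameter `μ_j` times the gain of the block. Dividing moments gives the law of the block
(`hasMoments_zfGain_topLeftBlock`).

It remains to pass between moments and Meijer G-functions. A law on `(0, ∞)` is determined by its
moments on the imaginary axis, which are the characteristic function of the logarithm
(`HasMoments.unique`). Candidate densities are iterated Mellin convolutions of `u ^ a * exp (-u)`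
or, since `Γ(ν + s) / Γ(μ + s)` is a finite product of factors `1 / (i + s)`, of truncated powers;
Mellin inversion identifies them with the G-functions. Inversion is absolutely convergent except
when exactly one factor `1 / (i + s)` is present, a case settled by integration by parts
(`tendsto_intervalIntegral_powerKernel`). With no such factor the normalised gain is constant and
has no density. The sum rate needs no density: insert the Mellin inversion formula of `log (1 + x)`
into the expectation and apply Fubini (`HasMoments.tendsto_log`). -/

/-! ## Mellin convolution -/

/-- The multiplicative convolution `x ↦ ∫₀^∞ h (x / y) f y dy / y`. -/
noncomputable def mellinConv (h f : ℝ → ℝ) (x : ℝ) : ℝ :=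
  ∫ y in Set.Ioi (0 : ℝ), h (x / y) * f y / y

theorem mellinConv_nonneg {h f : ℝ → ℝ} (hh : ∀ x, 0 < x → 0 ≤ h x) (hf : ∀ x, 0 < x → 0 ≤ f x)
    {x : ℝ} (hx : 0 < x) : 0 ≤ mellinConv h f x := by
  refine setIntegral_nonneg measurableSet_Ioi fun y (hy : 0 < y) => ?_
  have := hh (x / y) (by positivity)
  have := hf y hy
  positivity

theorem measurable_mellinConv {h f : ℝ → ℝ} (hh : Measurable h) (hf : Measurable f) :
    Measurable (mellinConv h f) := by
  have : StronglyMeasurable fun p : ℝ × ℝ => h (p.1 / p.2) * f p.2 / p.2 := by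
    apply Measurable.stronglyMeasurable; fun_prop
  exact (this.integral_prod_right (ν := volume.restrict (Set.Ioi (0 : ℝ)))).measurable

/-- Fubini for `x ^ (s - 1) * h (x / y) * f y / y` on the quadrant. For fixed `y`, scaling `x` by
`y` separates the variables, and the same scaling applied to norms gives absolute integrability. -/
theorem hasMellin_mellinConv {h f : ℝ → ℝ} (hh : Measurable h) (hf : Measurable f) {s a b : ℂ}
    (ha : HasMellin (fun x => (h x : ℂ)) s a) (hb : HasMellin (fun x => (f x : ℂ)) s b) :
    HasMellin (fun x => (mellinConv h f x : ℂ)) s (a * b) := by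
  set μ := (volume : Measure ℝ).restrict (Set.Ioi (0 : ℝ)) with hμ
  let F : ℝ × ℝ → ℂ := fun p =>
    (p.1 : ℂ) ^ (s - 1) * ((h (p.1 / p.2) : ℂ) * ((f p.2 : ℂ) / p.2))
  have hF : AEStronglyMeasurable F (μ.prod μ) := by
    apply Measurable.aestronglyMeasurable; fun_prop
  have hsc : ∀ y : ℝ, 0 < y → ∀ x : ℝ, F (x, y) =
      ((x : ℂ) ^ (s - 1) • ((h (y⁻¹ * x) : ℝ) : ℂ)) * ((f y : ℂ) / y) := by
    intro y hy x
    simp only [F, smul_eq_mul]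
    rw [div_eq_inv_mul x y]; ring
  have hyint : ∀ y : ℝ, 0 < y → Integrable (fun x => F (x, y)) μ := by
    intro y hy
    simp_rw [hsc y hy]
    exact (((MellinConvergent.comp_mul_left (f := fun x => (h x : ℂ)) (s := s)
      (inv_pos.2 hy)).2 ha.1)).mul_const _
  have hyval : ∀ y : ℝ, 0 < y → ∫ x, F (x, y) ∂μ = ((y : ℂ) ^ (s - 1) • (f y : ℂ)) * a := by
    intro y hy
    simp_rw [hsc y hy]
    rw [integral_mul_const]
    have := mellin_comp_mul_left (fun x => (h x : ℂ)) s (inv_pos.2 hy)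
    rw [mellin, ha.2] at this
    rw [hμ, this, smul_eq_mul, smul_eq_mul]
    have hy' : (y : ℂ) ≠ 0 := by exact_mod_cast hy.ne'
    rw [Complex.cpow_sub _ _ hy', Complex.cpow_one, Complex.ofReal_inv, Complex.inv_cpow,
      Complex.cpow_neg, inv_inv]
    · ring
    · rw [Complex.arg_ofReal_of_nonneg hy.le]; exact Real.pi_pos.ne
  have hynorm : ∀ y : ℝ, 0 < y → ∫ x, ‖F (x, y)‖ ∂μ =
      ‖(y : ℂ) ^ (s - 1) • (f y : ℂ)‖ * ∫ x, ‖(x : ℂ) ^ (s - 1) • (h x : ℂ)‖ ∂μ := by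
    intro y hy
    simp_rw [hsc y hy, norm_mul]
    rw [integral_mul_const]
    have e : ∀ x ∈ Set.Ioi (0 : ℝ), ‖(x : ℂ) ^ (s - 1) • ((h (y⁻¹ * x) : ℝ) : ℂ)‖ =
        ‖((y : ℂ)) ^ (s - 1)‖ *
          (fun z : ℝ => ‖(z : ℂ) ^ (s - 1) • (h z : ℂ)‖) (y⁻¹ * x) := by
      intro x (hx : 0 < x)
      have h1 : 0 < y⁻¹ * x := by positivity
      simp only [norm_smul]
      rw [Complex.norm_cpow_eq_rpow_re_of_pos hx, Complex.norm_cpow_eq_rpow_re_of_pos hy,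
        Complex.norm_cpow_eq_rpow_re_of_pos h1, ← mul_assoc, ← Real.mul_rpow hy.le h1.le,
        mul_inv_cancel_left₀ hy.ne']
    rw [hμ, setIntegral_congr_fun measurableSet_Ioi e, integral_const_mul,
      integral_comp_mul_left_Ioi (fun z : ℝ => ‖(z : ℂ) ^ (s - 1) • (h z : ℂ)‖) 0 (inv_pos.2 hy)]
    simp only [mul_zero, inv_inv, smul_eq_mul, norm_div]
    have : ‖(y : ℂ)‖ = y := by simp [abs_of_pos hy]
    rw [this]; field_simp
    simp only [norm_mul]; ring
  have hint : Integrable F (μ.prod μ) := by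
    rw [integrable_prod_iff' hF]
    constructor
    · filter_upwards [ae_restrict_mem measurableSet_Ioi] with y hy using hyint y hy
    · refine (hb.1.norm.mul_const (∫ x, ‖(x : ℂ) ^ (s - 1) • (h x : ℂ)‖ ∂μ)).congr ?_
      filter_upwards [ae_restrict_mem measurableSet_Ioi] with y hy using (hynorm y hy).symm
  have hxval : ∀ x : ℝ, ∫ y, F (x, y) ∂μ = (x : ℂ) ^ (s - 1) • (mellinConv h f x : ℂ) := by
    intro x
    simp only [F, smul_eq_mul]
    rw [integral_const_mul, mellinConv, ← integral_complex_ofReal]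
    congr 2; ext y; push_cast; ring
  refine ⟨?_, ?_⟩
  · refine (hint.integral_prod_left).congr ?_
    filter_upwards with x using hxval x
  · rw [mellin]
    simp_rw [← hxval]
    rw [integral_integral_swap (f := fun x y => F (x, y)) hint,
      setIntegral_congr_fun measurableSet_Ioi fun y hy => hyval y hy, integral_mul_const, ← hb.2,
      mellin, mul_comm]

/-- Dominated convergence, after writing the integrand as `(z / y * h (z / y)) * (f y / z)`, which
is at most `2 * C / x * |f y|` once `z > x / 2`. A jump of `h` at `1` is felt only at `y = x`, a
null set; so convolution smooths the discontinuity of `powerKernel`. -/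
theorem continuousAt_mellinConv {h f : ℝ → ℝ} (hh : Measurable h) (hf : Measurable f) {C : ℝ}
    (hC : ∀ u, 0 < u → |u * h u| ≤ C) (hcont : ∀ u, 0 < u → u ≠ 1 → ContinuousAt h u)
    (hfi : IntegrableOn f (Set.Ioi 0)) {x : ℝ} (hx : 0 < x) :
    ContinuousAt (mellinConv h f) x := by
  refine continuousAt_of_dominated (bound := fun y => 2 * C / x * |f y|) ?_ ?_ ?_ ?_
  · filter_upwards with z
    apply Measurable.aestronglyMeasurable; fun_prop
  · filter_upwards [lt_mem_nhds (half_lt_self hx)] with z hz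
    filter_upwards [ae_restrict_mem measurableSet_Ioi] with y (hy : 0 < y)
    have hz0 : 0 < z := by linarith
    have h1 := hC (z / y) (by positivity)
    rw [Real.norm_eq_abs, show h (z / y) * f y / y = (z / y * h (z / y)) * (f y / z) by
      field_simp, abs_mul, abs_div, abs_of_pos hz0]
    have h2 : |f y| / z ≤ |f y| / (x / 2) := by gcongr
    have hC0 : 0 ≤ C := (abs_nonneg _).trans h1
    calc |z / y * h (z / y)| * (|f y| / z) ≤ C * (|f y| / (x / 2)) := by gcongr
      _ = _ := by field_simp
  · exact hfi.abs.const_mul _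
  · have h0 : ∀ᵐ y ∂(volume : Measure ℝ), y ≠ x := by
      simp [ae_iff]
    filter_upwards [ae_restrict_mem measurableSet_Ioi, ae_restrict_of_ae h0] with y (hy : 0 < y) hyx
    have : ContinuousAt h (x / y) := hcont _ (by positivity) (by
      rw [ne_eq, div_eq_one_iff_eq hy.ne']; exact fun h => hyx h.symm)
    have h3 : ContinuousAt (fun z => h (z / y)) x :=
      ContinuousAt.comp (f := fun z : ℝ => z / y) this (by fun_prop)
    exact (h3.mul continuousAt_const).div_const _

theorem integrableOn_of_hasMellin_one {f : ℝ → ℝ} {a : ℂ}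
    (h : HasMellin (fun x => (f x : ℂ)) 1 a) : IntegrableOn f (Set.Ioi 0) := by
  have := h.1
  simp only [MellinConvergent, sub_self, Complex.cpow_zero, one_smul] at this
  simpa [IntegrableOn] using this.re

/-! ## Probability measures with prescribed complex moments -/

/-- `β` is a probability measure on `(0, ∞)` with moments `∫ x ^ s dβ = φ s` for `0 ≤ Re s`. -/
structure HasMoments (β : Measure ℝ) (φ : ℂ → ℂ) : Prop where
  prob : IsProbabilityMeasure β
  pos : ∀ᵐ x ∂β, 0 < x
  integrable : ∀ s : ℂ, 0 ≤ s.re → Integrable (fun x : ℝ => (x : ℂ) ^ s) β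
  integral : ∀ s : ℂ, 0 ≤ s.re → ∫ x : ℝ, (x : ℂ) ^ s ∂β = φ s

/-- On the imaginary axis, `φ (t * I)` is the characteristic function of the image under `log`, and
`exp` undoes `log` on the positive half-line. -/
theorem HasMoments.unique {β β' : Measure ℝ} {φ : ℂ → ℂ} (h : HasMoments β φ)
    (h' : HasMoments β' φ) : β = β' := by
  have := h.prob
  have := h'.prob
  have key : ∀ {γ : Measure ℝ}, HasMoments γ φ →
      charFun (γ.map Real.log) = fun t : ℝ => φ (t * Complex.I) := by
    intro γ hγ
    ext t
    rw [charFun_apply_real, integral_map Real.measurable_log.aemeasurable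
      (by apply Measurable.aestronglyMeasurable; fun_prop),
      ← hγ.integral _ (by simp)]
    refine integral_congr_ae ?_
    filter_upwards [hγ.pos] with x hx
    rw [Complex.cpow_def_of_ne_zero (by exact_mod_cast hx.ne'), ← Complex.ofReal_log hx.le]
    ring_nf
  have hback : ∀ {γ : Measure ℝ}, HasMoments γ φ → (γ.map Real.log).map Real.exp = γ := by
    intro γ hγ
    rw [Measure.map_map Real.measurable_exp Real.measurable_log]
    conv_rhs => rw [← Measure.map_id (μ := γ)]
    refine Measure.map_congr ?_
    filter_upwards [hγ.pos] with x hx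
    simp [Real.exp_log hx]
  have := Measure.isProbabilityMeasure_map (μ := β) Real.measurable_log.aemeasurable
  have := Measure.isProbabilityMeasure_map (μ := β') Real.measurable_log.aemeasurable
  rw [← hback h, ← hback h', Measure.ext_of_charFun ((key h).trans (key h').symm)]

theorem HasMoments.mconv {β β' : Measure ℝ} {φ ψ : ℂ → ℂ} (h : HasMoments β φ)
    (h' : HasMoments β' ψ) : HasMoments (β.mconv β') (fun s => φ s * ψ s) := by
  have := h.prob
  have := h'.prob
  have hpos : ∀ᵐ p ∂(β.prod β'), 0 < p.1 ∧ 0 < p.2 :=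
    (Measure.quasiMeasurePreserving_fst.ae h.pos).and (Measure.quasiMeasurePreserving_snd.ae h'.pos)
  have hmeas : ∀ s : ℂ, Measurable fun x : ℝ => (x : ℂ) ^ s := fun s => by fun_prop
  have heq : ∀ s : ℂ, (fun p : ℝ × ℝ => ((p.1 * p.2 : ℝ) : ℂ) ^ s) =ᵐ[β.prod β']
      fun p => (p.1 : ℂ) ^ s * (p.2 : ℂ) ^ s := by
    intro s
    filter_upwards [hpos] with p hp
    push_cast
    rw [Complex.mul_cpow_ofReal_nonneg hp.1.le hp.2.le]
  refine ⟨inferInstance, ?_, fun s hs => ?_, fun s hs => ?_⟩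
  · rw [Measure.mconv, ae_map_iff (by fun_prop) measurableSet_Ioi]
    filter_upwards [hpos] with p hp using mul_pos hp.1 hp.2
  · rw [Measure.mconv, integrable_map_measure (hmeas s).aestronglyMeasurable (by fun_prop)]
    exact ((h.integrable s hs).mul_prod (h'.integrable s hs)).congr (heq s).symm
  · rw [Measure.mconv, integral_map (by fun_prop) (hmeas s).aestronglyMeasurable,
      integral_congr_ae (heq s), integral_prod_mul (fun x : ℝ => (x : ℂ) ^ s)
        (fun x : ℝ => (x : ℂ) ^ s), h.integral s hs, h'.integral s hs]

/-- The moments of the second factor of a multiplicative convolution are determined by those of the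
convolution and of the first factor. -/
theorem HasMoments.of_mconv {β β' : Measure ℝ} [IsProbabilityMeasure β'] {φ ψ : ℂ → ℂ}
    (h : HasMoments β φ) (h0 : ∀ᵐ x ∂β', 0 ≤ x) (hc : HasMoments (β.mconv β') ψ)
    (hφ : ∀ s : ℂ, 0 ≤ s.re → φ s ≠ 0) : HasMoments β' (fun s => ψ s / φ s) := by
  have := h.prob
  have hmeas : ∀ s : ℂ, Measurable fun x : ℝ => (x : ℂ) ^ s := fun s => by fun_prop
  have hpos : ∀ᵐ p ∂(β.prod β'), 0 < p.1 ∧ 0 ≤ p.2 :=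
    (Measure.quasiMeasurePreserving_fst.ae h.pos).and (Measure.quasiMeasurePreserving_snd.ae h0)
  -- The product is almost surely positive, so a nonnegative second factor cannot vanish on a set of
  -- positive measure: fix one good value of the first factor.
  have hpos' : ∀ᵐ x ∂β', 0 < x := by
    have h1 := hc.pos
    rw [Measure.mconv, ae_map_iff (by fun_prop) measurableSet_Ioi] at h1
    have h2 := Measure.ae_ae_of_ae_prod (h1.and hpos)
    obtain ⟨x, hx⟩ := h2.exists
    filter_upwards [hx] with y hy
    exact lt_of_mul_lt_mul_left (by simpa using hy.1) hy.2.1.le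
  have heq : ∀ s : ℂ, (fun p : ℝ × ℝ => ((p.1 * p.2 : ℝ) : ℂ) ^ s) =ᵐ[β.prod β']
      fun p => (p.1 : ℂ) ^ s * (p.2 : ℂ) ^ s := by
    intro s
    filter_upwards [hpos] with p hp
    push_cast
    rw [Complex.mul_cpow_ofReal_nonneg hp.1.le hp.2]
  have hint : ∀ s : ℂ, 0 ≤ s.re →
      Integrable (fun p : ℝ × ℝ => (p.1 : ℂ) ^ s * (p.2 : ℂ) ^ s) (β.prod β') := by
    intro s hs
    have := hc.integrable s hs
    rw [Measure.mconv, integrable_map_measure (hmeas s).aestronglyMeasurable (by fun_prop)] at this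
    exact this.congr (heq s)
  refine ⟨inferInstance, hpos', fun s hs => ?_, fun s hs => ?_⟩
  -- Almost every slice `y ↦ x ^ s * y ^ s` is integrable; dividing one such slice by the nonzero
  -- constant `x ^ s` gives integrability for `β'`.
  · have h1 := ((integrable_prod_iff (hint s hs).aestronglyMeasurable).1 (hint s hs)).1
    obtain ⟨x, hx1, hx0⟩ := (h1.and h.pos).exists
    refine (hx1.const_mul ((x : ℂ) ^ s)⁻¹).congr ?_
    filter_upwards with y
    rw [inv_mul_cancel_left₀]
    rw [Complex.cpow_def_of_ne_zero (by exact_mod_cast hx0.ne')]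
    exact Complex.exp_ne_zero _
  · rw [eq_div_iff (hφ s hs), ← hc.integral s hs, ← h.integral s hs, Measure.mconv,
      integral_map (by fun_prop) (hmeas s).aestronglyMeasurable,
      integral_congr_ae (heq s), integral_prod_mul (fun x : ℝ => (x : ℂ) ^ s)
        (fun x : ℝ => (x : ℂ) ^ s), mul_comm]

/-- A density with a known Mellin transform gives a probability measure with known moments. -/
theorem hasMoments_withDensity {f : ℝ → ℝ} (hf : Measurable f) (h0 : ∀ x, 0 < x → 0 ≤ f x)
    {Φ : ℂ → ℂ} (hM : ∀ s : ℂ, 1 ≤ s.re → HasMellin (fun x => (f x : ℂ)) s (Φ s)) {κ : ℝ}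
    (hκ0 : 0 ≤ κ) (hκ : κ * Φ 1 = 1) :
    HasMoments ((volume.restrict (Set.Ioi 0)).withDensity fun x => ENNReal.ofReal (κ * f x))
      (fun s => κ * Φ (s + 1)) := by
  have hfi := integrableOn_of_hasMellin_one (hM 1 (by simp))
  have hnn : ∀ᵐ x ∂(volume.restrict (Set.Ioi (0 : ℝ))), 0 ≤ κ * f x := by
    filter_upwards [ae_restrict_mem measurableSet_Ioi] with x hx
    exact mul_nonneg hκ0 (h0 x hx)
  have hcongr : ∀ s : ℂ, (fun x : ℝ => (κ : ℂ) * ((x : ℂ) ^ (s + 1 - 1) • (f x : ℂ)))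
      =ᵐ[volume.restrict (Set.Ioi (0 : ℝ))]
      fun x => (ENNReal.ofReal (κ * f x)).toReal • ((x : ℂ) ^ s) := by
    intro s
    filter_upwards [hnn] with x hx
    rw [ENNReal.toReal_ofReal hx, add_sub_cancel_right, smul_eq_mul, Complex.real_smul]
    push_cast; ring
  refine ⟨⟨?_⟩, ?_, fun s hs => ?_, fun s hs => ?_⟩
  · rw [withDensity_apply _ MeasurableSet.univ, setLIntegral_univ,
      ← ofReal_integral_eq_lintegral_ofReal (hfi.const_mul κ) hnn, ENNReal.ofReal_eq_one,
      integral_const_mul]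
    have h1 := (hM 1 (by simp)).2
    simp only [mellin, sub_self, Complex.cpow_zero, one_smul] at h1
    rw [integral_complex_ofReal] at h1
    rw [← h1] at hκ
    exact_mod_cast hκ
  · refine (withDensity_absolutelyContinuous _ _).ae_le ?_
    exact ae_restrict_mem measurableSet_Ioi
  · rw [integrable_withDensity_iff_integrable_smul' (by fun_prop) (by simp)]
    exact ((hM (s + 1) (by simpa using hs)).1.const_mul (κ : ℂ)).congr (hcongr s)
  · rw [integral_withDensity_eq_integral_toReal_smul (by fun_prop) (by simp),
      ← integral_congr_ae (hcongr s), integral_const_mul, ← (hM (s + 1) (by simpa using hs)).2,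
      mellin]

/-! ## Decay of the Gamma function on vertical lines -/

/-- The factor `max 1 s.re⁻¹` is at least `1` and its product with `s.re` is at least `1`, so
multiplying `‖s‖` by it dominates `√(1 + s.im ^ 2)`. One such factor decays like `1 / |t|`; two of
them are integrable on a vertical line. -/
theorem norm_one_div_le {s : ℂ} (hs : 0 < s.re) :
    ‖1 / s‖ ≤ max 1 s.re⁻¹ * (√(1 + s.im ^ 2))⁻¹ := by
  have h1 : 0 < √(1 + s.im ^ 2) := by positivity
  have h0 : 0 < ‖s‖ := norm_pos_iff.2 fun h => by simp [h] at hs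
  rw [norm_div, norm_one, ← div_eq_mul_inv, div_le_div_iff₀ h0 h1, one_mul]
  apply Real.sqrt_le_iff.2 ⟨by positivity, ?_⟩
  have h2 : ‖s‖ ^ 2 = s.re ^ 2 + s.im ^ 2 := by
    rw [Complex.sq_norm, Complex.normSq_apply]; ring
  have h3 : 1 ≤ max 1 s.re⁻¹ := le_max_left _ _
  have h4 : 1 ≤ max 1 s.re⁻¹ * s.re := by
    rw [← inv_mul_cancel₀ hs.ne']
    exact mul_le_mul_of_nonneg_right (le_max_right _ _) hs.le
  rw [mul_pow, h2]
  nlinarith [mul_le_mul h4 h4 zero_le_one (by positivity), mul_le_mul h3 h3 zero_le_one (by positivity),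
    sq_nonneg s.im]

theorem norm_one_div_le_max {s : ℂ} (hs : 0 < s.re) : ‖1 / s‖ ≤ max 1 s.re⁻¹ := by
  refine (norm_one_div_le hs).trans (mul_le_of_le_one_right (by positivity) ?_)
  apply inv_le_one_of_one_le₀
  rw [Real.one_le_sqrt]
  nlinarith [sq_nonneg s.im]

theorem norm_Gamma_le {s : ℂ} (hs : 0 < s.re) : ‖Complex.Gamma s‖ ≤ Real.Gamma s.re := by
  rw [Complex.Gamma_eq_integral hs, Real.Gamma_eq_integral hs, Complex.GammaIntegral]
  refine (norm_integral_le_integral_norm _).trans (le_of_eq ?_)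
  refine setIntegral_congr_fun measurableSet_Ioi fun x (hx : 0 < x) => ?_
  simp only [norm_mul]
  rw [Complex.norm_cpow_eq_rpow_re_of_pos hx]
  simp [Complex.norm_exp]

/-- Two uses of the functional equation write `Γ(s) = Γ(s + 2) / (s (s + 1))`, with `Γ(s + 2)`
bounded on the line. This crude quadratic decay is enough for absolute convergence; Stirling's
formula is not needed. -/
theorem norm_Gamma_le_inv_one_add_sq {σ : ℝ} (hσ : 0 < σ) :
    ∃ C, 0 ≤ C ∧ ∀ s : ℂ, s.re = σ → ‖Complex.Gamma s‖ ≤ C * (1 + s.im ^ 2)⁻¹ := by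
  refine ⟨Real.Gamma (σ + 2) * (max 1 (σ + 1)⁻¹ * max 1 σ⁻¹), by
    have := Real.Gamma_pos_of_pos (show 0 < σ + 2 by linarith); positivity, fun s hs => ?_⟩
  have h0 : s ≠ 0 := fun h => by simp [h] at hs; exact hσ.ne hs
  have h1 : s + 1 ≠ 0 := fun h => by
    have := congrArg Complex.re h
    simp [hs] at this; linarith
  have hG : Complex.Gamma s = Complex.Gamma (s + 2) * (1 / (s + 1) * (1 / s)) := by
    rw [show s + 2 = s + 1 + 1 by ring, Complex.Gamma_add_one _ h1, Complex.Gamma_add_one _ h0]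
    field_simp
  have e : (1 + s.im ^ 2)⁻¹ = (√(1 + s.im ^ 2))⁻¹ * (√(1 + s.im ^ 2))⁻¹ := by
    rw [← mul_inv, Real.mul_self_sqrt (by positivity)]
  have b1 := norm_one_div_le (s := s) (by rw [hs]; exact hσ)
  have b2 := norm_one_div_le (s := s + 1) (by simp [hs]; linarith)
  have b3 := norm_Gamma_le (s := s + 2) (by simp [hs]; linarith)
  simp only [Complex.add_re, Complex.add_im, Complex.one_re, Complex.one_im, add_zero,
    Complex.re_ofNat, hs] at b1 b2 b3
  rw [hG, norm_mul, norm_mul, e]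
  calc _ ≤ Real.Gamma (σ + 2) * ((max 1 (σ + 1)⁻¹ * (√(1 + s.im ^ 2))⁻¹) *
        (max 1 σ⁻¹ * (√(1 + s.im ^ 2))⁻¹)) := by gcongr
    _ = _ := by ring

theorem continuousOn_Gamma_re_pos : ContinuousOn Complex.Gamma {s | 0 < s.re} := by
  intro s hs
  refine (Complex.continuousAt_Gamma s fun m h => ?_).continuousWithinAt
  rw [h] at hs
  simp only [Set.mem_ofPred_eq, Complex.neg_re, Complex.natCast_re, Left.neg_pos_iff] at hs
  exact absurd hs (not_lt.2 (Nat.cast_nonneg m))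

/-! ## Mellin transforms of the Gamma and power densities -/

/-- The unnormalised Gamma density `u ^ a * exp (-u)`. -/
noncomputable def gammaKernel (a : ℕ) (u : ℝ) : ℝ := u ^ a * Real.exp (-u)

theorem continuous_gammaKernel (a : ℕ) : Continuous (gammaKernel a) := by
  unfold gammaKernel; fun_prop

theorem gammaKernel_nonneg (a : ℕ) {u : ℝ} (hu : 0 < u) : 0 ≤ gammaKernel a u := by
  unfold gammaKernel; positivity

theorem abs_mul_gammaKernel_le (a : ℕ) {u : ℝ} (hu : 0 < u) :
    |u * gammaKernel a u| ≤ ((a + 1).factorial : ℝ) := by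
  have h := Real.pow_div_factorial_le_exp u hu.le (a + 1)
  rw [div_le_iff₀ (by positivity)] at h
  rw [abs_of_nonneg (mul_nonneg hu.le (gammaKernel_nonneg a hu)), gammaKernel, Real.exp_neg]
  rw [← mul_assoc, ← pow_succ', ← div_eq_mul_inv, div_le_iff₀ (Real.exp_pos _)]
  linarith

theorem hasMellin_gammaKernel (a : ℕ) {s : ℂ} (hs : -(a : ℝ) < s.re) :
    HasMellin (fun x => (gammaKernel a x : ℂ)) s (Complex.Gamma (a + s)) := by
  have hre : 0 < ((a : ℂ) + s).re := by simp; linarith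
  have heq : Set.EqOn (fun x : ℝ => ((-x).exp : ℂ) * (x : ℂ) ^ ((a : ℂ) + s - 1))
      (fun x : ℝ => (x : ℂ) ^ (s - 1) • (gammaKernel a x : ℂ)) (Set.Ioi 0) := by
    intro x (hx : 0 < x)
    have hx' : (x : ℂ) ≠ 0 := by exact_mod_cast hx.ne'
    simp only [gammaKernel, smul_eq_mul]
    rw [show (a : ℂ) + s - 1 = (s - 1) + a by ring, Complex.cpow_add _ _ hx', Complex.cpow_natCast]
    push_cast; ring
  refine ⟨(Complex.GammaIntegral_convergent hre).congr_fun heq measurableSet_Ioi, ?_⟩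
  rw [mellin, Complex.Gamma_eq_integral hre, Complex.GammaIntegral]
  exact (setIntegral_congr_fun measurableSet_Ioi heq).symm

/-- The function `u ^ i` on `(0, 1)`, extended by `1 / 2` at `1` and by `0` beyond. -/
noncomputable def powerKernel (i : ℕ) (u : ℝ) : ℝ :=
  -- The value at the jump is the mean of the one-sided limits, to which the symmetrically truncated
  -- inversion integral converges; the G-function is claimed at every `x > 0`, including `x = 1`.
  if u < 1 then u ^ i else if u = 1 then 1 / 2 else 0

theorem measurable_powerKernel (i : ℕ) : Measurable (powerKernel i) := by
  unfold powerKernel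
  exact Measurable.ite measurableSet_Iio (by fun_prop)
    (Measurable.ite (measurableSet_singleton 1) (by fun_prop) (by fun_prop))

theorem powerKernel_nonneg (i : ℕ) {u : ℝ} (hu : 0 < u) : 0 ≤ powerKernel i u := by
  unfold powerKernel; split_ifs <;> positivity

theorem abs_mul_powerKernel_le (i : ℕ) {u : ℝ} (hu : 0 < u) : |u * powerKernel i u| ≤ 1 := by
  rw [abs_of_nonneg (mul_nonneg hu.le (powerKernel_nonneg i hu)), powerKernel]
  split_ifs with h1 h2
  · exact mul_le_one₀ h1.le (by positivity) (pow_le_one₀ hu.le h1.le)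
  · rw [h2]; norm_num
  · simp

theorem continuousAt_powerKernel (i : ℕ) {u : ℝ} (hu : u ≠ 1) : ContinuousAt (powerKernel i) u := by
  rcases lt_or_gt_of_ne hu with h | h
  · refine (continuous_pow i).continuousAt.congr ?_
    filter_upwards [Iio_mem_nhds h] with v (hv : v < 1)
    simp [powerKernel, hv]
  · refine (continuousAt_const (y := (0 : ℝ))).congr ?_
    filter_upwards [Ioi_mem_nhds h] with v (hv : 1 < v)
    simp [powerKernel, hv.ne', not_lt.2 hv.le]

theorem hasMellin_powerKernel (i : ℕ) {s : ℂ} (hs : -(i : ℝ) < s.re) :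
    HasMellin (fun x => (powerKernel i x : ℂ)) s (1 / (i + s)) := by
  have h := hasMellin_cpow_Ioc (i : ℂ) (s := s) (by simp; linarith)
  have h1 : ∀ᵐ y ∂(volume : Measure ℝ), y ≠ 1 := by simp [ae_iff]
  have heq : (fun x : ℝ => (x : ℂ) ^ (s - 1) •
      Set.indicator (Set.Ioc 0 1) (fun t : ℝ => (t : ℂ) ^ (i : ℂ)) x)
      =ᵐ[volume.restrict (Set.Ioi 0)] fun x => (x : ℂ) ^ (s - 1) • (powerKernel i x : ℂ) := by
    filter_upwards [ae_restrict_mem measurableSet_Ioi, ae_restrict_of_ae h1] with x hx hx1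
    congr 1
    rcases lt_or_gt_of_ne hx1 with h2 | h2
    · rw [Set.indicator_of_mem (Set.mem_Ioc.2 ⟨hx, h2.le⟩)]; simp [powerKernel, h2]
    · rw [Set.indicator_of_notMem (fun h3 => absurd h3.2 (not_le.2 h2))]
      simp [powerKernel, h2.ne', not_lt.2 h2.le]
  refine ⟨h.1.congr heq, ?_⟩
  rw [mellin, ← integral_congr_ae heq, add_comm, ← h.2, mellin]

/-- The density of a product of Gamma variables. -/
theorem exists_hasMellin_prod_Gamma {M : ℕ} (hM : 0 < M) (ν : Fin M → ℕ) :
    ∃ f : ℝ → ℝ, Measurable f ∧ (∀ x, 0 < x → 0 ≤ f x) ∧ (∀ x, 0 < x → ContinuousAt f x) ∧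
      ∀ s : ℂ, (∀ j, -(ν j : ℝ) < s.re) →
        HasMellin (fun x => (f x : ℂ)) s (∏ j, Complex.Gamma (ν j + s)) := by
  induction M, hM using Nat.le_induction with
  | base =>
    refine ⟨gammaKernel (ν 0), (continuous_gammaKernel _).measurable,
      fun x hx => gammaKernel_nonneg _ hx, fun x _ => (continuous_gammaKernel _).continuousAt,
      fun s hs => ?_⟩
    simpa using hasMellin_gammaKernel (ν 0) (hs 0)
  | succ M hM ih =>
    obtain ⟨f, hf, hf0, hfc, hfm⟩ := ih fun j => ν j.succ
    refine ⟨mellinConv (gammaKernel (ν 0)) f,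
      measurable_mellinConv (continuous_gammaKernel _).measurable hf,
      fun x hx => mellinConv_nonneg (fun u hu => gammaKernel_nonneg _ hu) hf0 hx,
      fun x hx => continuousAt_mellinConv (continuous_gammaKernel _).measurable hf
        (fun u hu => abs_mul_gammaKernel_le _ hu)
        (fun u _ _ => (continuous_gammaKernel _).continuousAt) ?_ hx, fun s hs => ?_⟩
    · refine integrableOn_of_hasMellin_one (hfm 1 fun j => ?_)
      have : (0 : ℝ) ≤ ν j.succ := Nat.cast_nonneg _
      simp only [Complex.one_re]; linarith
    · rw [Fin.prod_univ_succ]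
      exact hasMellin_mellinConv (continuous_gammaKernel _).measurable hf
        (hasMellin_gammaKernel _ (hs 0)) (hfm s fun j => hs j.succ)

/-- The density of a product of power-law variables. -/
theorem exists_hasMellin_prod_inv (L : List ℕ) (hL : L ≠ []) :
    ∃ f : ℝ → ℝ, Measurable f ∧ (∀ x, 0 < x → 0 ≤ f x) ∧
      (2 ≤ L.length → ∀ x, 0 < x → ContinuousAt f x) ∧
      ∀ s : ℂ, (∀ i ∈ L, -(i : ℝ) < s.re) →
        HasMellin (fun x => (f x : ℂ)) s (L.map fun i : ℕ => 1 / ((i : ℂ) + s)).prod := by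
  induction L with
  | nil => exact absurd rfl hL
  | cons i L ih =>
    rcases eq_or_ne L [] with rfl | hL'
    · refine ⟨powerKernel i, measurable_powerKernel i, fun x hx => powerKernel_nonneg i hx,
        fun h => absurd h (by simp), fun s hs => ?_⟩
      simpa using hasMellin_powerKernel i (hs i (by simp))
    -- Continuity of the previous density is not needed: a further convolution produces a continuous
    -- function from an integrable one.
    · obtain ⟨f, hf, hf0, -, hfm⟩ := ih hL'
      refine ⟨mellinConv (powerKernel i) f, measurable_mellinConv (measurable_powerKernel i) hf,
        fun x hx => mellinConv_nonneg (fun u hu => powerKernel_nonneg _ hu) hf0 hx,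
        fun _ x hx => continuousAt_mellinConv (measurable_powerKernel i) hf
          (fun u hu => abs_mul_powerKernel_le _ hu)
          (fun u _ hu => continuousAt_powerKernel i hu) ?_ hx, fun s hs => ?_⟩
      · refine integrableOn_of_hasMellin_one (hfm 1 fun j _ => ?_)
        have : (0 : ℝ) ≤ j := Nat.cast_nonneg _
        simp only [Complex.one_re]; linarith
      · rw [List.map_cons, List.prod_cons]
        exact hasMellin_mellinConv (measurable_powerKernel i) hf
          (hasMellin_powerKernel i (hs i (by simp))) (hfm s fun j hj => hs j (by simp [hj]))

/-! ## Meijer G-functions as inverse Mellin transforms -/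

/-- In `meijerIntegrand` the coercion to `ℂ` is elaborated as a monadic lift of each whole parameter
list; here it is moved inside the mapped function. -/
theorem meijerIntegrand_eq (a b c d : List ℝ) (x : ℝ) (s : ℂ) :
    meijerIntegrand a b c d x s =
      ((c.map fun u : ℝ => Complex.Gamma ((u : ℂ) - s)).prod *
        (a.map fun u : ℝ => Complex.Gamma (1 - (u : ℂ) + s)).prod) /
      ((b.map fun u : ℝ => Complex.Gamma ((u : ℂ) - s)).prod *
        (d.map fun u : ℝ => Complex.Gamma (1 - (u : ℂ) + s)).prod) * (x : ℂ) ^ s := by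
  have h : ∀ l : List ℝ, (do let u ← l; pure (u : ℂ)) = l.map fun u : ℝ => (u : ℂ) := fun l => by
    simp [List.map_eq_flatMap]
  simp only [meijerIntegrand, h, List.map_map, Function.comp_def]

theorem exists_isMeijerLine_nil (c : List ℝ) : ∃ τ : ℝ, IsMeijerLine [] c τ := by
  induction c with
  | nil => exact ⟨0, by simp [IsMeijerLine]⟩
  | cons u c ih =>
    obtain ⟨τ, h⟩ := ih
    refine ⟨min τ (u - 1), fun v hv => ?_, by simp⟩
    rcases List.mem_cons.1 hv with rfl | hv
    · exact (min_le_right _ _).trans_lt (by linarith)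
    · exact (min_le_left _ _).trans_lt (h.1 v hv)

/-- A convergent vertical integral of `x ^ s * F s`, in terms of the inverse Mellin transform. -/
theorem tendsto_intervalIntegral_mellinInv {F : ℂ → ℂ} {Φ : ℂ → ℂ} {τ x : ℝ} (hx : 0 < x)
    (hF : ∀ t : ℝ, F (τ + t * Complex.I) =
      Φ (-(τ + t * Complex.I)) * (x : ℂ) ^ ((τ : ℂ) + t * Complex.I))
    (hΦ : Complex.VerticalIntegrable Φ (-τ)) :
    Tendsto (fun T : ℝ => (1 / (2 * (Real.pi : ℂ))) * ∫ t in (-T)..T, F ((τ : ℂ) + t * Complex.I))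
      atTop (𝓝 (mellinInv (-τ) Φ x)) := by
  have hx' : (x : ℂ) ≠ 0 := by exact_mod_cast hx.ne'
  let g : ℝ → ℂ := fun y => (x : ℂ) ^ (-((-τ : ℝ) + y * Complex.I : ℂ)) • Φ ((-τ : ℝ) + y * Complex.I)
  have hg : Integrable g := by
    refine (hΦ.bdd_mul (c := x ^ τ) ?_ ?_ )
    · apply Measurable.aestronglyMeasurable; fun_prop
    · filter_upwards with y
      rw [Complex.norm_cpow_eq_rpow_re_of_pos hx]; simp
  -- The G-function carries `x ^ s`, the inverse Mellin transform `x ^ (-s)`; the reflection `t ↦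
  -- -t` preserves the symmetric interval and moves the line from `τ` to `-τ`.
  have h1 : ∀ T : ℝ, ∫ t in (-T)..T, F ((τ : ℂ) + t * Complex.I) = ∫ t in (-T)..T, g t := by
    intro T
    have := intervalIntegral.integral_comp_neg (a := -T) (b := T) (f := g)
    rw [neg_neg] at this
    rw [← this]
    congr 1; ext t
    rw [hF, mul_comm]
    simp only [g, smul_eq_mul]
    congr 2 <;> (push_cast; ring)
  simp_rw [h1]
  have h2 := (intervalIntegral_tendsto_integral hg tendsto_neg_atTop_atBot
    tendsto_id).const_mul (1 / (2 * (Real.pi : ℂ)))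
  simpa [mellinInv, g, Complex.real_smul] using h2

theorem verticalIntegrable_of_norm_le {Φ : ℂ → ℂ} {σ C : ℝ}
    (hc : Continuous fun t : ℝ => Φ (σ + t * Complex.I))
    (h : ∀ t : ℝ, ‖Φ (σ + t * Complex.I)‖ ≤ C * (1 + t ^ 2)⁻¹) :
    Complex.VerticalIntegrable Φ σ :=
  (integrable_inv_one_add_sq.const_mul C).mono' hc.aestronglyMeasurable (ae_of_all _ h)

theorem continuous_Gamma_vertical {a σ : ℝ} (h : 0 < a + σ) :
    Continuous fun t : ℝ => Complex.Gamma (a + (σ + t * Complex.I)) :=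
  continuousOn_Gamma_re_pos.comp_continuous (by fun_prop) fun t => by simpa using h

/-- One factor supplies the quadratic decay; the others are bounded by their values at the real
part. -/
theorem verticalIntegrable_prod_Gamma {M : ℕ} (hM : 0 < M) (ν : Fin M → ℕ) {σ : ℝ}
    (hσ : ∀ j, -(ν j : ℝ) < σ) :
    Complex.VerticalIntegrable (fun s => ∏ j, Complex.Gamma (ν j + s)) σ := by
  obtain ⟨M, rfl⟩ := Nat.exists_eq_succ_of_ne_zero hM.ne'
  obtain ⟨C, hC0, hC⟩ := norm_Gamma_le_inv_one_add_sq (σ := ν 0 + σ) (by linarith [hσ 0])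
  refine verticalIntegrable_of_norm_le (C := C * ∏ j : Fin M, Real.Gamma (ν j.succ + σ)) ?_
    fun t => ?_
  · refine continuous_finsetProd _ fun j _ => ?_
    have := continuous_Gamma_vertical (a := ν j) (σ := σ) (by linarith [hσ j])
    exact_mod_cast this
  · rw [Fin.prod_univ_succ, norm_mul, norm_prod, mul_right_comm]
    have h1 := hC (ν 0 + (σ + t * Complex.I)) (by simp)
    simp only [Complex.add_im, Complex.natCast_im, Complex.ofReal_im, Complex.mul_im,
      Complex.ofReal_re, Complex.I_im, Complex.I_re, mul_one, mul_zero, add_zero, zero_add] at h1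
    refine mul_le_mul h1 (Finset.prod_le_prod (fun _ _ => norm_nonneg _) fun j _ => ?_)
      (Finset.prod_nonneg fun _ _ => norm_nonneg _) (by positivity)
    refine (norm_Gamma_le ?_).trans (le_of_eq ?_)
    · simp; linarith [hσ j.succ]
    · simp

/-- Two factors supply the decay `(1 + t ^ 2)⁻¹` and the rest are bounded. A single factor is not
absolutely integrable, hence the condition on the length. -/
theorem verticalIntegrable_prod_inv (L : List ℕ) (hL : 2 ≤ L.length) {σ : ℝ}
    (hσ : ∀ i ∈ L, -(i : ℝ) < σ) :
    Complex.VerticalIntegrable (fun s => (L.map fun i : ℕ => 1 / ((i : ℂ) + s)).prod) σ := by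
  obtain ⟨i, j, L, rfl⟩ : ∃ i j L', L = i :: j :: L' := by
    match L, hL with
    | i :: j :: L', _ => exact ⟨i, j, L', rfl⟩
  have hcont : ∀ L : List ℕ, (∀ i ∈ L, -(i : ℝ) < σ) →
      Continuous fun t : ℝ => (L.map fun i : ℕ => 1 / ((i : ℂ) + (σ + t * Complex.I))).prod := by
    intro L hL
    refine continuous_list_prod _ fun i hi => ?_
    refine continuous_const.div (by fun_prop) fun t h => ?_
    have := congrArg Complex.re h
    simp at this; linarith [hL i hi]
  have hbd : ∀ L : List ℕ, (∀ i ∈ L, -(i : ℝ) < σ) → ∃ C, 0 ≤ C ∧ ∀ t : ℝ,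
      ‖(L.map fun i : ℕ => 1 / ((i : ℂ) + (σ + t * Complex.I))).prod‖ ≤ C := by
    intro L hL
    induction L with
    | nil => exact ⟨1, zero_le_one, fun t => by simp⟩
    | cons i L ih =>
      obtain ⟨C, hC0, hC⟩ := ih fun k hk => hL k (by simp [hk])
      refine ⟨max 1 (i + σ)⁻¹ * C, by positivity, fun t => ?_⟩
      rw [List.map_cons, List.prod_cons, norm_mul]
      have := norm_one_div_le_max (s := i + (σ + t * Complex.I))
        (by simp; linarith [hL i (by simp)])
      exact mul_le_mul (this.trans_eq (by simp)) (hC t) (norm_nonneg _) (by positivity)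
  obtain ⟨C, hC0, hC⟩ := hbd L fun k hk => hσ k (by simp [hk])
  refine verticalIntegrable_of_norm_le (C := max 1 (i + σ)⁻¹ * (max 1 (j + σ)⁻¹ * C))
    (hcont _ hσ) fun t => ?_
  have h1 := norm_one_div_le (s := i + (σ + t * Complex.I)) (by simp; linarith [hσ i (by simp)])
  have h2 := norm_one_div_le (s := j + (σ + t * Complex.I)) (by simp; linarith [hσ j (by simp)])
  simp only [Complex.add_im, Complex.natCast_im, Complex.ofReal_im, Complex.mul_im,
    Complex.ofReal_re, Complex.I_im, Complex.I_re, mul_one, mul_zero, add_zero, zero_add,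
    Complex.add_re, Complex.natCast_re, Complex.mul_re, sub_self] at h1 h2
  have e : (1 + t ^ 2)⁻¹ = (√(1 + t ^ 2))⁻¹ * (√(1 + t ^ 2))⁻¹ := by
    rw [← mul_inv, Real.mul_self_sqrt (by positivity)]
  simp only [List.map_cons, List.prod_cons, norm_mul]
  calc _ ≤ (max 1 (i + σ)⁻¹ * (√(1 + t ^ 2))⁻¹) * ((max 1 (j + σ)⁻¹ * (√(1 + t ^ 2))⁻¹) * C) := by
        gcongr; exact hC t
    _ = _ := by rw [e]; ring

/-- Mellin inversion on all separating lines. -/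
theorem hasMeijerG_of_hasMellin {b c : List ℝ} {f : ℝ → ℝ} {Φ : ℂ → ℂ}
    (hM : ∀ s : ℂ, (∀ u ∈ c, -u < s.re) → HasMellin (fun x => (f x : ℂ)) s (Φ s))
    (hV : ∀ σ : ℝ, (∀ u ∈ c, -u < σ) → Complex.VerticalIntegrable Φ σ)
    (hΦ : ∀ s : ℂ, (∀ u ∈ c, s.re < u) → (c.map fun u : ℝ => Complex.Gamma ((u : ℂ) - s)).prod /
      (b.map fun u : ℝ => Complex.Gamma ((u : ℂ) - s)).prod = Φ (-s))
    {x : ℝ} (hx : 0 < x) (hf : ContinuousAt f x) : HasMeijerG [] b c [] x (f x : ℂ) := by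
  refine ⟨exists_isMeijerLine_nil c, fun τ hτ => ?_⟩
  have hτ' : ∀ u ∈ c, -u < -τ := fun u hu => neg_lt_neg (hτ.1 u hu)
  have h1 := tendsto_intervalIntegral_mellinInv (F := meijerIntegrand [] b c [] x) (Φ := Φ)
    (τ := τ) hx (fun t => ?_) (hV _ hτ')
  · convert h1 using 2
    have h2 : ∀ t : ℝ, mellin (fun x => (f x : ℂ)) ((-τ : ℝ) + t * Complex.I) =
        Φ ((-τ : ℝ) + t * Complex.I) := fun t => (hM _ fun u hu => by simpa using hτ' u hu).2
    have h3 : Complex.VerticalIntegrable (mellin fun x => (f x : ℂ)) (-τ) :=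
      (hV _ hτ').congr (ae_of_all _ fun t => (h2 t).symm)
    rw [← mellinInv_mellin_eq (-τ) (fun x => (f x : ℂ)) hx
      (hM _ fun u hu => by simpa using hτ' u hu).1 h3
      (Complex.continuous_ofReal.continuousAt.comp hf)]
    simp only [mellinInv, h2]
  · rw [meijerIntegrand_eq, ← hΦ _ fun u hu => by simpa using hτ.1 u hu]
    simp

/-! ## The conditionally convergent inverse Mellin transform of a power law -/

/-- For `x < 1` both truncations are active exactly for `x < y < 1`, where the integrand is `x ^ i /
y`; for `x > 1` they are incompatible. The logarithm produced here cancels the one that integration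
by parts puts in the denominator. -/
theorem mellinConv_powerKernel_self (i : ℕ) {x : ℝ} (hx : 0 < x) (hx1 : x ≠ 1) :
    mellinConv (powerKernel i) (powerKernel i) x = -Real.log x * powerKernel i x := by
  have h1 : ∀ᵐ y ∂(volume : Measure ℝ), y ≠ 1 := by simp [ae_iff]
  have h2 : ∀ᵐ y ∂(volume : Measure ℝ), y ≠ x := by simp [ae_iff]
  rcases lt_or_gt_of_ne hx1 with h | h
  · have e : (fun y => powerKernel i (x / y) * powerKernel i y / y)
        =ᵐ[volume.restrict (Set.Ioi 0)]
        Set.indicator (Set.Ioc x 1) (fun y => x ^ i * y⁻¹) := by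
      filter_upwards [ae_restrict_mem measurableSet_Ioi, ae_restrict_of_ae h1,
        ae_restrict_of_ae h2] with y (hy : 0 < y) hy1 hyx
      rcases lt_or_gt_of_ne hyx with h3 | h3
      · rw [Set.indicator_of_notMem (fun h4 => absurd (Set.mem_Ioc.1 h4).1 (not_lt.2 h3.le))]
        have : 1 < x / y := (one_lt_div hy).2 h3
        simp [powerKernel, this.ne', not_lt.2 this.le]
      · have h4 : x / y < 1 := (div_lt_one hy).2 h3
        rcases lt_or_gt_of_ne hy1 with h5 | h5
        · rw [Set.indicator_of_mem (Set.mem_Ioc.2 ⟨h3, h5.le⟩)]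
          simp only [powerKernel, h4, h5, if_true]
          rw [div_pow]; field_simp
        · rw [Set.indicator_of_notMem (fun h4 => absurd (Set.mem_Ioc.1 h4).2 (not_le.2 h5))]
          simp [powerKernel, h5.ne', not_lt.2 h5.le]
    rw [mellinConv, integral_congr_ae e, integral_indicator measurableSet_Ioc,
      Measure.restrict_restrict_of_subset (Set.Ioc_subset_Ioi_self.trans (Set.Ioi_subset_Ioi hx.le)),
      ← intervalIntegral.integral_of_le h.le, intervalIntegral.integral_const_mul,
      integral_inv_of_pos hx one_pos]
    simp [powerKernel, h, mul_comm]
  · rw [mellinConv, show powerKernel i x = 0 by simp [powerKernel, h.ne', not_lt.2 h.le], mul_zero]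
    refine setIntegral_eq_zero_of_forall_eq_zero fun y (hy : 0 < y) => ?_
    rcases lt_or_ge 1 y with h3 | h3
    · simp [powerKernel, h3.ne', not_lt.2 h3.le]
    · have : 1 < x / y := (one_lt_div hy).2 (h3.trans_lt h)
      simp [powerKernel, this.ne', not_lt.2 this.le]

/-- Averaging with the reflected integral removes the odd imaginary part and leaves an arctangent.
The limit exists only because the truncation is symmetric. -/
theorem tendsto_integral_inv_vertical {a : ℝ} (ha : 0 < a) :
    Tendsto (fun T : ℝ => ∫ t in (-T)..T, 1 / ((a : ℂ) - t * Complex.I)) atTop (𝓝 Real.pi) := by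
  have hne : ∀ t : ℝ, (a : ℂ) - t * Complex.I ≠ 0 := fun t h => by
    have := congrArg Complex.re h
    simp at this; linarith
  have hne' : ∀ t : ℝ, (a : ℂ) + t * Complex.I ≠ 0 := fun t h => by
    have := congrArg Complex.re h
    simp at this; linarith
  have hc : Continuous fun t : ℝ => 1 / ((a : ℂ) - t * Complex.I) :=
    continuous_const.div (by fun_prop) hne
  have hc' : Continuous fun t : ℝ => 1 / ((a : ℂ) + t * Complex.I) :=
    continuous_const.div (by fun_prop) hne'
  have hreal : ∀ T : ℝ, ∫ t in (-T)..T, 1 / (1 + (t / a) ^ 2) = a * (2 * Real.arctan (T / a)) := by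
    intro T
    rw [intervalIntegral.integral_comp_div (fun t => 1 / (1 + t ^ 2)) ha.ne',
      integral_one_div_one_add_sq, neg_div, Real.arctan_neg, smul_eq_mul]
    ring
  have key : ∀ T : ℝ, ∫ t in (-T)..T, 1 / ((a : ℂ) - t * Complex.I) =
      ((2 * Real.arctan (T / a) : ℝ) : ℂ) := by
    intro T
    have h1 := intervalIntegral.integral_comp_neg (a := -T) (b := T)
      (f := fun t : ℝ => 1 / ((a : ℂ) - t * Complex.I))
    rw [neg_neg] at h1
    have h2 : (∫ t in (-T)..T, 1 / ((a : ℂ) - t * Complex.I)) +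
        ∫ t in (-T)..T, 1 / ((a : ℂ) - t * Complex.I) =
        ∫ t in (-T)..T, ((2 / a * (1 / (1 + (t / a) ^ 2)) : ℝ) : ℂ) := by
      nth_rewrite 2 [← h1]
      simp only [Complex.ofReal_neg, neg_mul, sub_neg_eq_add]
      rw [← intervalIntegral.integral_add (hc.intervalIntegrable _ _) (hc'.intervalIntegrable _ _)]
      congr 1; ext t
      have h3 : (a : ℂ) ^ 2 + t ^ 2 ≠ 0 := by
        norm_cast; positivity
      have h4 : (a : ℂ) ≠ 0 := by exact_mod_cast ha.ne'
      have h5 : (1 : ℂ) + (t / a) ^ 2 ≠ 0 := by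
        norm_cast; positivity
      push_cast
      rw [div_add_div _ _ (hne t) (hne' t)]
      have e : ((a : ℂ) - t * Complex.I) * (a + t * Complex.I) = a ^ 2 + t ^ 2 := by
        ring_nf; rw [Complex.I_sq]; ring
      rw [e]; field_simp; ring
    rw [intervalIntegral.integral_ofReal, intervalIntegral.integral_const_mul, hreal] at h2
    have h3 : (2 : ℂ) * ∫ t in (-T)..T, 1 / ((a : ℂ) - t * Complex.I) =
        2 * ((2 * Real.arctan (T / a) : ℝ) : ℂ) := by
      rw [two_mul, h2, ← mul_assoc, div_mul_cancel₀ _ ha.ne']; push_cast; ring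
    exact mul_left_cancel₀ two_ne_zero h3
  simp_rw [key]
  have h1 : Tendsto (fun T : ℝ => Real.arctan (T / a)) atTop (𝓝 (Real.pi / 2)) :=
    (Real.tendsto_arctan_atTop.mono_right nhdsWithin_le_nhds).comp (tendsto_id.atTop_div_const ha)
  have h2 := (Complex.continuous_ofReal.tendsto _).comp (h1.const_mul 2)
  rw [mul_div_cancel₀ _ two_ne_zero] at h2
  exact h2

/-- The integrand decays only like `1 / |t|`. At `x = 1` there is no oscillation and the arctangent
limit gives `1 / 2`. For `x ≠ 1`, integrating by parts against `x ^ (t * I)` gives boundary terms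
tending to `0` and an absolutely convergent integral with `(i - s)⁻²`. The latter is the inverse
Mellin transform of the self-convolution `-log x * powerKernel i x`, and the factor `-1 / log x`
recovers the kernel. -/
theorem tendsto_intervalIntegral_powerKernel (i : ℕ) {τ x : ℝ} (hτ : τ < i) (hx : 0 < x) :
    Tendsto (fun T : ℝ => (1 / (2 * (Real.pi : ℂ))) * ∫ t in (-T)..T,
        1 / ((i : ℂ) - (τ + t * Complex.I)) * (x : ℂ) ^ ((τ : ℂ) + t * Complex.I))
      atTop (𝓝 (powerKernel i x : ℂ)) := by
  have hpi : (Real.pi : ℂ) ≠ 0 := by exact_mod_cast Real.pi_ne_zero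
  have hx' : (x : ℂ) ≠ 0 := by exact_mod_cast hx.ne'
  set a : ℝ := i - τ with ha
  have ha0 : 0 < a := by rw [ha]; linarith
  have hsub : ∀ t : ℝ, (i : ℂ) - (τ + t * Complex.I) = a - t * Complex.I := by
    intro t; rw [ha]; push_cast; ring
  have hne : ∀ t : ℝ, (i : ℂ) - (τ + t * Complex.I) ≠ 0 := fun t h => by
    have := congrArg Complex.re h
    simp at this; linarith
  rcases eq_or_ne x 1 with rfl | hx1
  · have h := (tendsto_integral_inv_vertical ha0).const_mul (1 / (2 * (Real.pi : ℂ)))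
    convert h using 2
    · simp [hsub]
    · simp [powerKernel]; field_simp
  set l : ℝ := Real.log x with hl
  have hl0 : l ≠ 0 := Real.log_ne_zero_of_pos_of_ne_one hx hx1
  have hl0' : (l : ℂ) ≠ 0 := by exact_mod_cast hl0
  -- integration by parts
  let G : ℝ → ℂ := fun t => 1 / ((i : ℂ) - (τ + t * Complex.I)) * (x : ℂ) ^ ((τ : ℂ) + t * Complex.I)
  let F : ℝ → ℂ := fun t => (1 / ((i : ℂ) - (τ + t * Complex.I))) ^ 2 *
    (x : ℂ) ^ ((τ : ℂ) + t * Complex.I)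
  have hpow : Continuous fun t : ℝ => (x : ℂ) ^ ((τ : ℂ) + t * Complex.I) :=
    Continuous.const_cpow (by fun_prop) (Or.inl hx')
  have hinv : Continuous fun t : ℝ => 1 / ((i : ℂ) - (τ + t * Complex.I)) :=
    continuous_const.div (by fun_prop) hne
  have hGc : Continuous G := hinv.mul hpow
  have hFc : Continuous F := (hinv.pow 2).mul hpow
  have hder : ∀ t : ℝ, HasDerivAt G (Complex.I * F t + Complex.I * l * G t) t := by
    intro t
    have h1 : HasDerivAt (fun t : ℝ => (τ : ℂ) + t * Complex.I) Complex.I t := by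
      simpa using ((Complex.ofRealCLM.hasDerivAt (x := t)).mul_const Complex.I).const_add (τ : ℂ)
    have h2 := ((h1.const_sub (i : ℂ)).inv (hne t)).mul
      ((Complex.hasStrictDerivAt_const_cpow (Or.inl hx')).hasDerivAt.comp t h1)
    refine (h2.congr_of_eventuallyEq (f₁ := G) (.of_forall fun t => by simp [G])).congr_deriv ?_
    simp only [F, G, Pi.inv_apply, Function.comp_apply]
    rw [← Complex.ofReal_log hx.le, ← hl]
    have := hne t
    field_simp
  have hIBP : ∀ T : ℝ, ∫ t in (-T)..T, G t =
      1 / (Complex.I * l) * (G T - G (-T)) - 1 / l * ∫ t in (-T)..T, F t := by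
    intro T
    have h1 := intervalIntegral.integral_eq_sub_of_hasDerivAt (a := -T) (b := T)
      (fun t _ => hder t) (by apply Continuous.intervalIntegrable; fun_prop)
    rw [intervalIntegral.integral_add (by apply Continuous.intervalIntegrable; fun_prop)
      (by apply Continuous.intervalIntegrable; fun_prop), intervalIntegral.integral_const_mul,
      intervalIntegral.integral_const_mul] at h1
    rw [← h1]; field_simp; ring
  have hGlim : ∀ c : ℝ → ℝ, Tendsto (fun T => |c T|) atTop atTop →
      Tendsto (fun T => G (c T)) atTop (𝓝 0) := by
    intro c hc
    rw [tendsto_zero_iff_norm_tendsto_zero]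
    have h1 : Tendsto (fun T => |c T|⁻¹ * x ^ τ) atTop (𝓝 (0 * x ^ τ)) :=
      (tendsto_inv_atTop_zero.comp hc).mul_const _
    rw [zero_mul] at h1
    refine squeeze_zero' (Eventually.of_forall fun _ => norm_nonneg _) ?_ h1
    filter_upwards [hc.eventually_gt_atTop 0] with T hT
    simp only [G]
    rw [norm_mul, Complex.norm_cpow_eq_rpow_re_of_pos hx, norm_div, norm_one, one_div]
    simp only [Complex.add_re, Complex.ofReal_re, Complex.mul_re, Complex.I_re, mul_zero,
      Complex.ofReal_im, Complex.I_im, mul_one, sub_self, add_zero]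
    gcongr
    refine le_trans (le_of_eq ?_) (Complex.abs_im_le_norm _)
    simp
  -- With doubled parameters the Gamma quotient is `(Γ(i - s) / Γ(i + 1 - s)) ^ 2 = (i - s)⁻²`, so
  -- the absolutely convergent inversion theorem applies.
  have h2 : HasMeijerG [] [(i : ℝ) + 1, i + 1] [(i : ℝ), i] [] x
      (mellinConv (powerKernel i) (powerKernel i) x : ℂ) := by
    refine hasMeijerG_of_hasMellin (Φ := fun s => ([i, i].map fun i : ℕ => 1 / ((i : ℂ) + s)).prod)
      (fun s hs => ?_) (fun σ hσ => verticalIntegrable_prod_inv [i, i] le_rfl (by simpa using hσ))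
      (fun s hs => ?_) hx ?_
    · have := hasMellin_powerKernel i (s := s) (hs i (by simp))
      simpa using hasMellin_mellinConv (measurable_powerKernel i) (measurable_powerKernel i) this this
    · have h3 : (i : ℂ) - s ≠ 0 := fun h => by
        have := congrArg Complex.re h
        have h4 := hs i (by simp)
        simp at this; linarith
      have h4 : Complex.Gamma ((i : ℂ) - s) ≠ 0 :=
        Complex.Gamma_ne_zero_of_re_pos (by simpa using hs i (by simp))
      simp only [List.map_cons, List.map_nil, List.prod_cons, List.prod_nil, mul_one]
      push_cast
      rw [show (i : ℂ) + 1 - s = (i - s) + 1 by ring, Complex.Gamma_add_one _ h3, ← sub_eq_add_neg]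
      field_simp
    · refine continuousAt_mellinConv (measurable_powerKernel i) (measurable_powerKernel i)
        (fun u hu => abs_mul_powerKernel_le i hu) (fun u _ hu => continuousAt_powerKernel i hu)
        (integrableOn_of_hasMellin_one (hasMellin_powerKernel i (s := 1) ?_)) hx
      simp only [Complex.one_re]
      linarith [(Nat.cast_nonneg i : (0 : ℝ) ≤ i)]
  have h3 := h2.2 τ ⟨by simpa using hτ, by simp⟩
  have h4 : ∀ t : ℝ, meijerIntegrand [] [(i : ℝ) + 1, i + 1] [(i : ℝ), i] [] x (τ + t * Complex.I) =
      F t := by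
    intro t
    have h5 : Complex.Gamma ((i : ℂ) - (τ + t * Complex.I)) ≠ 0 :=
      Complex.Gamma_ne_zero_of_re_pos (by simpa using hτ)
    simp only [meijerIntegrand_eq, F, List.map_cons, List.map_nil, List.prod_cons, List.prod_nil,
      mul_one]
    push_cast
    rw [show (i : ℂ) + 1 - (τ + t * Complex.I) = (i - (τ + t * Complex.I)) + 1 by ring,
      Complex.Gamma_add_one _ (hne t)]
    have := hne t
    field_simp
  simp_rw [h4] at h3
  have h6 : Tendsto (fun T : ℝ => 1 / (2 * (Real.pi : ℂ)) * (1 / (Complex.I * l) * (G T - G (-T))) -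
      1 / l * (1 / (2 * (Real.pi : ℂ)) * ∫ t in (-T)..T, F t)) atTop
      (𝓝 (1 / (2 * (Real.pi : ℂ)) * (1 / (Complex.I * l) * (0 - 0)) -
        1 / l * (mellinConv (powerKernel i) (powerKernel i) x : ℂ))) :=
    ((((hGlim (fun T => T) tendsto_abs_atTop_atTop).sub (hGlim (fun T => -T) (by
      simpa using tendsto_abs_atTop_atTop))).const_mul _).const_mul _).sub (h3.const_mul _)
  have h7 : (1 / (2 * (Real.pi : ℂ)) * (1 / (Complex.I * l) * (0 - 0)) -
        1 / l * (mellinConv (powerKernel i) (powerKernel i) x : ℂ)) = powerKernel i x := by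
    rw [mellinConv_powerKernel_self i hx hx1, ← hl]; push_cast; field_simp; ring
  rw [h7] at h6
  refine h6.congr fun T => ?_
  change _ = _ * ∫ t in (-T)..T, G t
  rw [hIBP]; ring

/-! ## The Mellin transform of the logarithm -/

theorem HasMellin.congr_Ioi {f g : ℝ → ℂ} {s a : ℂ} (h : HasMellin f s a)
    (hfg : ∀ x, 0 < x → f x = g x) : HasMellin g s a := by
  have e : Set.EqOn (fun x : ℝ => (x : ℂ) ^ (s - 1) • f x) (fun x : ℝ => (x : ℂ) ^ (s - 1) • g x)
      (Set.Ioi 0) := fun x hx => by simp only [hfg x hx]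
  exact ⟨h.1.congr_fun e measurableSet_Ioi, by
    rw [← h.2]; exact (setIntegral_congr_fun measurableSet_Ioi e).symm⟩

theorem HasMellin.comp_inv {f : ℝ → ℂ} {s a : ℂ} (h : HasMellin f (-s) a) :
    HasMellin (fun x => f x⁻¹) s a := by
  refine ⟨?_, by rw [mellin_comp_inv, h.2]⟩
  have := (MellinConvergent.comp_rpow (f := f) (s := s) (a := -1) (by norm_num)).2 (by
    simpa [div_neg] using h.1)
  simpa [Real.rpow_neg_one] using this

/-- The factors `y` and `1 / y` cancel, leaving `∫₀^∞ exp (-(1 + 1 / x) y) dy`. -/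
theorem mellinConv_gammaKernel_inv {x : ℝ} (hx : 0 < x) :
    mellinConv (fun u => gammaKernel 0 u⁻¹) (gammaKernel 1) x = x / (1 + x) := by
  have e : Set.EqOn (fun y => gammaKernel 0 (x / y)⁻¹ * gammaKernel 1 y / y)
      (fun y => Real.exp (-(1 + x⁻¹) * y)) (Set.Ioi 0) := by
    intro y (hy : 0 < y)
    simp only [gammaKernel, pow_zero, one_mul, pow_one, inv_div]
    rw [mul_div_assoc, mul_div_cancel_left₀ _ hy.ne', ← Real.exp_add]
    congr 1; field_simp; ring
  rw [mellinConv, setIntegral_congr_fun measurableSet_Ioi e, integral_exp_mul_Ioi (by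
    have : 0 < x⁻¹ := by positivity
    linarith)]
  have h1 : -(1 + x⁻¹) ≠ 0 := by
    have : 0 < x⁻¹ := by positivity
    linarith
  simp only [mul_zero, Real.exp_zero]
  rw [div_eq_div_iff h1 (by positivity)]
  field_simp; ring

theorem mellinConv_powerKernel_inv {x : ℝ} (hx : 0 < x) :
    mellinConv (fun u => powerKernel 0 u⁻¹) (fun y => y / (1 + y)) x = Real.log (1 + x) := by
  have h2 : ∀ᵐ y ∂(volume : Measure ℝ), y ≠ x := by simp [ae_iff]
  have e : (fun y => powerKernel 0 (x / y)⁻¹ * (y / (1 + y)) / y)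
      =ᵐ[volume.restrict (Set.Ioi 0)]
      Set.indicator (Set.Ioc 0 x) (fun y => 1 / (1 + y)) := by
    filter_upwards [ae_restrict_mem measurableSet_Ioi, ae_restrict_of_ae h2] with y (hy : 0 < y) hyx
    rw [inv_div]
    rcases lt_or_gt_of_ne hyx with h3 | h3
    · rw [Set.indicator_of_mem (Set.mem_Ioc.2 ⟨hy, h3.le⟩)]
      have : y / x < 1 := (div_lt_one hx).2 h3
      simp only [powerKernel, this, if_true, pow_zero]
      field_simp
    · rw [Set.indicator_of_notMem (fun h4 => absurd (Set.mem_Ioc.1 h4).2 (not_le.2 h3))]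
      have : 1 < y / x := (one_lt_div hx).2 h3
      simp [powerKernel, this.ne', not_lt.2 this.le]
  rw [mellinConv, integral_congr_ae e, integral_indicator measurableSet_Ioc,
    Measure.restrict_restrict_of_subset Set.Ioc_subset_Ioi_self,
    ← intervalIntegral.integral_of_le hx.le,
    intervalIntegral.integral_comp_add_left (fun y => 1 / y) 1, add_zero,
    integral_one_div_of_pos one_pos (by linarith), div_one]

/-- Two convolutions build the logarithm: `exp (-1 / x)` with `x * exp (-x)` gives `x / (1 + x)`,
with transform `Γ(-s) Γ(1 + s)`; convolving with the indicator of `x > 1` (up to its value at `1`)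
integrates `1 / (1 + y)` over `(0, x)` and contributes `1 / (-s)`. -/
theorem hasMellin_log_one_add {s : ℂ} (h1 : -1 < s.re) (h0 : s.re < 0) :
    HasMellin (fun x : ℝ => (Real.log (1 + x) : ℂ)) s
      (1 / (-s) * (Complex.Gamma (-s) * Complex.Gamma (1 + s))) := by
  have hm : ∀ a, Measurable fun u => gammaKernel a u⁻¹ := fun a =>
    (continuous_gammaKernel a).measurable.comp measurable_inv
  have hp : Measurable fun u => powerKernel 0 u⁻¹ := (measurable_powerKernel 0).comp measurable_inv
  have a1 := HasMellin.comp_inv (hasMellin_gammaKernel 0 (s := -s) (by simp; linarith))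
  have a2 := hasMellin_gammaKernel 1 (s := s) (by simpa using h1)
  have a3 := HasMellin.congr_Ioi
    (hasMellin_mellinConv (hm 0) (continuous_gammaKernel 1).measurable a1 a2)
    (g := fun x => ((x / (1 + x) : ℝ) : ℂ))
    fun x hx => by rw [mellinConv_gammaKernel_inv hx]
  have b1 := HasMellin.comp_inv (hasMellin_powerKernel 0 (s := -s) (by simp; linarith))
  have := HasMellin.congr_Ioi (hasMellin_mellinConv hp (by fun_prop) b1 a3)
    (g := fun x => (Real.log (1 + x) : ℂ)) fun x hx => by rw [mellinConv_powerKernel_inv hx]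
  simpa using this

theorem verticalIntegrable_mellin_log {τ : ℝ} (h0 : 0 < τ) (h1 : τ < 1) :
    Complex.VerticalIntegrable
      (fun s => 1 / (-s) * (Complex.Gamma (-s) * Complex.Gamma (1 + s))) (-τ) := by
  obtain ⟨C, hC0, hC⟩ := norm_Gamma_le_inv_one_add_sq (σ := τ) h0
  refine verticalIntegrable_of_norm_le (C := max 1 τ⁻¹ * (C * Real.Gamma (1 - τ))) ?_ fun t => ?_
  · refine (continuous_const.div (by fun_prop) fun t h => ?_).mul (.mul ?_ ?_)
    · have := congrArg Complex.re h
      simp at this; linarith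
    · exact continuousOn_Gamma_re_pos.comp_continuous (by fun_prop) fun t => by simpa using h0
    · exact continuousOn_Gamma_re_pos.comp_continuous (by fun_prop) fun t => by
        simp; linarith
  · rw [norm_mul, norm_mul]
    have e1 := norm_one_div_le_max (s := -((-τ : ℝ) + t * Complex.I)) (by simpa using h0)
    have e2 := hC (-((-τ : ℝ) + t * Complex.I)) (by simp)
    have e3 := norm_Gamma_le (s := 1 + ((-τ : ℝ) + t * Complex.I)) (by simp; linarith)
    rw [show (-((-τ : ℝ) + t * Complex.I) : ℂ).re = τ by simp] at e1
    rw [show (-((-τ : ℝ) + t * Complex.I) : ℂ).im = -t by simp, neg_sq] at e2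
    rw [show (1 + ((-τ : ℝ) + t * Complex.I) : ℂ).re = 1 - τ by simp; ring] at e3
    rw [mul_assoc, mul_right_comm C]
    gcongr

/-- The expectation of `log (1 + x X)` as a Mellin-Barnes integral over the moments of `X`. -/
theorem HasMoments.tendsto_log {β : Measure ℝ} {φ : ℂ → ℂ} (hβ : HasMoments β φ) {x τ : ℝ}
    (hx : 0 < x) (h0 : 0 < τ) (h1 : τ < 1) {F : ℂ → ℂ}
    (hF : ∀ t : ℝ, F (τ + t * Complex.I) =
      1 / (τ + t * Complex.I) * (Complex.Gamma (τ + t * Complex.I) *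
        Complex.Gamma (1 - (τ + t * Complex.I))) * φ (τ + t * Complex.I) *
        (x : ℂ) ^ ((τ : ℂ) + t * Complex.I)) :
    Tendsto (fun T : ℝ => (1 / (2 * (Real.pi : ℂ))) * ∫ t in (-T)..T, F ((τ : ℂ) + t * Complex.I))
      atTop (𝓝 ((∫ y, Real.log (1 + x * y) ∂β : ℝ) : ℂ)) := by
  have := hβ.prob
  let Ψ : ℂ → ℂ := fun s => 1 / (-s) * (Complex.Gamma (-s) * Complex.Gamma (1 + s))
  have hΨ : Complex.VerticalIntegrable Ψ (-τ) := verticalIntegrable_mellin_log h0 h1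
  let K : ℝ × ℝ → ℂ := fun p =>
    (p.2 : ℂ) ^ (-((-τ : ℝ) + p.1 * Complex.I)) * Ψ ((-τ : ℝ) + p.1 * Complex.I)
  have hKm : AEStronglyMeasurable K (volume.prod β) := by
    refine AEStronglyMeasurable.mul (Measurable.aestronglyMeasurable (by fun_prop)) ?_
    exact hΨ.1.comp_fst
  have hτ : Integrable (fun y : ℝ => ‖(y : ℂ) ^ (τ : ℂ)‖) β :=
    (hβ.integrable τ (by simpa using h0.le)).norm
  have hpos : ∀ᵐ p ∂((volume : Measure ℝ).prod β), 0 < p.2 :=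
    Measure.quasiMeasurePreserving_snd.ae hβ.pos
  -- The modulus of the power of `y` is `y ^ τ` for every `t`, so the kernel is dominated by a
  -- product of an integrable function of `t` and one of `y`.
  have hK : Integrable K (volume.prod β) := by
    refine (hΨ.norm.mul_prod hτ).mono' hKm ?_
    filter_upwards [hpos] with p hp
    rw [norm_mul, Complex.norm_cpow_eq_rpow_re_of_pos hp, Complex.norm_cpow_eq_rpow_re_of_pos hp]
    simp [mul_comm]
  have hKt : ∀ t : ℝ, ∫ y, K (t, y) ∂β =
      Ψ ((-τ : ℝ) + t * Complex.I) * φ (-((-τ : ℝ) + t * Complex.I)) := by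
    intro t
    simp only [K]
    rw [integral_mul_const, hβ.integral _ (by simpa using h0.le), mul_comm]
  -- No decay of `φ` is assumed: integrability on the line is the marginal part of Fubini.
  have hV : Complex.VerticalIntegrable (fun s => Ψ s * φ (-s)) (-τ) :=
    hK.integral_prod_left.congr (ae_of_all _ hKt)
  have key := tendsto_intervalIntegral_mellinInv (F := F) (Φ := fun s => Ψ s * φ (-s)) (τ := τ) hx
    (fun t => by rw [hF]; simp only [Ψ, neg_neg, ← sub_eq_add_neg]) hV
  convert key using 2
  have hinv : ∀ y : ℝ, 0 < y → mellinInv (-τ) Ψ y = Real.log (1 + y) := by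
    intro y hy
    have h2 : ∀ t : ℝ, mellin (fun x : ℝ => (Real.log (1 + x) : ℂ)) ((-τ : ℝ) + t * Complex.I) =
        Ψ ((-τ : ℝ) + t * Complex.I) := fun t =>
      (hasMellin_log_one_add (by simpa using h1) (by simpa using h0)).2
    have h3 : Complex.VerticalIntegrable (mellin fun x : ℝ => (Real.log (1 + x) : ℂ)) (-τ) :=
      hΨ.congr (ae_of_all _ fun t => (h2 t).symm)
    have h4 : ContinuousAt (fun x : ℝ => (Real.log (1 + x) : ℂ)) y :=
      Complex.continuous_ofReal.continuousAt.comp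
        (ContinuousAt.log (by fun_prop) (by positivity))
    rw [← mellinInv_mellin_eq (-τ) (fun x : ℝ => (Real.log (1 + x) : ℂ)) hy
      (hasMellin_log_one_add (by simpa using h1) (by simpa using h0)).1 h3 h4]
    simp only [mellinInv, h2]
  have hlog : ∀ᵐ y ∂β, (Real.log (1 + x * y) : ℂ) =
      (1 / (2 * Real.pi) : ℝ) • ∫ t : ℝ, (x : ℂ) ^ (-((-τ : ℝ) + t * Complex.I)) * K (t, y) := by
    filter_upwards [hβ.pos] with y hy
    rw [← hinv (x * y) (by positivity), mellinInv]
    congr 2; ext t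
    simp only [K, smul_eq_mul]
    rw [Complex.ofReal_mul, Complex.mul_cpow_ofReal_nonneg hx.le hy.le, mul_assoc]
  have hK2 : Integrable (fun p : ℝ × ℝ =>
      (x : ℂ) ^ (-((-τ : ℝ) + p.1 * Complex.I)) * K p) (volume.prod β) := by
    refine hK.bdd_mul (c := x ^ τ) (Measurable.aestronglyMeasurable (by fun_prop)) ?_
    filter_upwards with p
    rw [Complex.norm_cpow_eq_rpow_re_of_pos hx]; simp
  rw [← integral_complex_ofReal, integral_congr_ae hlog, integral_smul, mellinInv,
    ← integral_integral_swap
      (f := fun (t : ℝ) y => (x : ℂ) ^ (-((-τ : ℝ) + t * Complex.I)) * K (t, y)) hK2]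
  congr 2; ext t
  rw [integral_const_mul, hKt, smul_eq_mul]

/-- The bound `0 ≤ log (1 + x y) ≤ x y` reduces this to the first moment. -/
theorem HasMoments.integrable_log {β : Measure ℝ} {φ : ℂ → ℂ} (hβ : HasMoments β φ) {x : ℝ}
    (hx : 0 < x) : Integrable (fun y => Real.log (1 + x * y)) β := by
  have h1 := ((hβ.integrable 1 (by simp)).norm).const_mul x
  refine h1.mono' (Measurable.aestronglyMeasurable (by fun_prop)) ?_
  filter_upwards [hβ.pos] with y hy
  have h2 : 0 < x * y := by positivity
  rw [Real.norm_of_nonneg (Real.log_nonneg (by linarith))]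
  have := Real.log_le_sub_one_of_pos (show 0 < 1 + x * y by linarith)
  simp only [Complex.cpow_one, Complex.norm_real, Real.norm_of_nonneg hy.le]
  linarith

/-- The extra parameters contribute `Γ(1 - s) Γ(s) ^ 2 / Γ(1 + s) = Γ(s) Γ(1 - s) / s`, the Mellin
transform of `log (1 + x)` at `-s`. Since the entries of `A` are nonpositive, the separating lines
are exactly those with `0 < τ < 1`. -/
theorem HasMoments.hasMeijerG_log {β : Measure ℝ} {κ : ℝ} (hκ : κ ≠ 0) {A D : List ℝ}
    (hA : ∀ u ∈ A, u ≤ 0)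
    (hβ : HasMoments β fun s => κ * ((A.map fun u : ℝ => Complex.Gamma (1 - (u : ℂ) + s)).prod /
      (D.map fun u : ℝ => Complex.Gamma (1 - (u : ℂ) + s)).prod)) {x : ℝ} (hx : 0 < x) :
    HasMeijerG (A ++ [1, 1]) [] [1] (D ++ [0]) x
      ((κ⁻¹ * ∫ y, Real.log (1 + x * y) ∂β : ℝ) : ℂ) := by
  refine ⟨⟨1 / 2, by norm_num, fun u hu => ?_⟩, fun τ hτ => ?_⟩
  · rcases List.mem_append.1 hu with h | h
    · linarith [hA u h]
    · have : u = 1 := by simpa using h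
      rw [this]; norm_num
  have h1 : τ < 1 := hτ.1 1 (by simp)
  have h0 : 0 < τ := by simpa using hτ.2 1 (by simp)
  have hκ' : (κ : ℂ) ≠ 0 := by exact_mod_cast hκ
  have key := (hβ.tendsto_log hx h0 h1 (F := fun s => κ * meijerIntegrand (A ++ [1, 1]) [] [1]
    (D ++ [0]) x s) fun t => ?_).const_mul (κ : ℂ)⁻¹
  · push_cast
    refine key.congr fun T => ?_
    rw [intervalIntegral.integral_const_mul]
    rw [mul_left_comm, inv_mul_cancel_left₀ hκ']
  · have hs : (τ : ℂ) + t * Complex.I ≠ 0 := fun h => by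
      have := congrArg Complex.re h
      simp at this; linarith
    have hG : Complex.Gamma ((τ : ℂ) + t * Complex.I) ≠ 0 :=
      Complex.Gamma_ne_zero_of_re_pos (by simpa using h0)
    simp only [meijerIntegrand_eq, List.map_append, List.map_cons, List.map_nil, List.prod_append,
      List.prod_cons, List.prod_nil, mul_one, one_mul, Complex.ofReal_one, Complex.ofReal_zero,
      sub_self, sub_zero, zero_add]
    rw [add_comm (1 : ℂ) (τ + t * Complex.I), Complex.Gamma_add_one _ hs]
    field_simp

/-! ## The Meijer G-functions of the SINR densities -/

theorem mem_paramList {M : ℕ} {ν : Fin M → ℕ} {u : ℝ} :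
    u ∈ paramList ν ↔ ∃ j, (ν j : ℝ) = u := by
  simp [paramList, List.mem_ofFn]

theorem prod_map_paramList {M : ℕ} (ν : Fin M → ℕ) (g : ℝ → ℂ) :
    ((paramList ν).map g).prod = ∏ j, g (ν j) := by
  simp [paramList, List.map_ofFn, List.prod_ofFn]

theorem prod_map_negParamList {M : ℕ} (ν : Fin M → ℕ) (g : ℝ → ℂ) :
    ((negParamList ν).map g).prod = ∏ j, g (-(ν j : ℝ)) := by
  simp [negParamList, List.map_ofFn, List.prod_ofFn]

theorem exists_meijer_prod_Gamma {M : ℕ} (hM : 0 < M) (ν : Fin M → ℕ) :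
    ∃ G : ℝ → ℝ, (∀ x, 0 < x → 0 ≤ G x ∧ HasMeijerG [] [] (paramList ν) [] x (G x : ℂ)) ∧
      Measurable G ∧ ∀ s : ℂ, 1 ≤ s.re →
        HasMellin (fun x => (G x : ℂ)) s (∏ j, Complex.Gamma (ν j + s)) := by
  obtain ⟨f, hf, hf0, hfc, hfm⟩ := exists_hasMellin_prod_Gamma hM ν
  refine ⟨f, fun x hx => ⟨hf0 x hx, ?_⟩, hf, fun s hs => hfm s fun j => ?_⟩
  · refine hasMeijerG_of_hasMellin (Φ := fun s => ∏ j, Complex.Gamma (ν j + s))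
      (fun s hs => hfm s fun j => hs _ (mem_paramList.2 ⟨j, rfl⟩))
      (fun σ hσ => verticalIntegrable_prod_Gamma hM ν fun j => hσ _ (mem_paramList.2 ⟨j, rfl⟩))
      (fun s _ => ?_) hx (hfc x hx)
    rw [prod_map_paramList]
    simp [sub_eq_add_neg]
  · have : (0 : ℝ) ≤ ν j := Nat.cast_nonneg _
    linarith

/-- The functional equation of Gamma telescopes; this turns the Jacobi moments into rational
functions. -/
theorem prod_range'_inv (a k : ℕ) {s : ℂ} (hs : -(a : ℝ) < s.re) :
    ((List.range' a k).map fun i : ℕ => 1 / ((i : ℂ) + s)).prod =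
      Complex.Gamma (a + s) / Complex.Gamma ((a + k : ℕ) + s) := by
  have hG : ∀ b : ℕ, a ≤ b → Complex.Gamma (b + s) ≠ 0 := fun b hb => by
    refine Complex.Gamma_ne_zero_of_re_pos ?_
    have : (a : ℝ) ≤ b := by exact_mod_cast hb
    simp; linarith
  induction k with
  | zero => simp [hG a le_rfl]
  | succ k ih =>
    rw [List.range'_concat, List.map_append, List.prod_append, ih]
    have h0 : ((a + k : ℕ) : ℂ) + s ≠ 0 := fun h => by
      have := congrArg Complex.re h
      simp at this
      linarith [(Nat.cast_nonneg k : (0 : ℝ) ≤ k)]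
    have h1 := hG (a + k) (by omega)
    simp only [mul_one, one_mul, List.map_cons, List.map_nil, List.prod_cons, List.prod_nil]
    rw [show ((a + (k + 1) : ℕ) : ℂ) + s = ((a + k : ℕ) + s) + 1 by push_cast; ring,
      Complex.Gamma_add_one _ h0]
    field_simp

/-- Collect in `L` all integers `i` with `ν j ≤ i < μ j`, with multiplicity over `j`; the Gamma
quotient is `∏ 1 / (i + s)` over `L`, and `hlt` makes `L` nonempty. Two or more entries give a
continuous density and absolute convergence; a single entry gives the truncated power, with
conditional convergence. -/
theorem exists_meijer_prod_Gamma_div {M : ℕ} (ν μ : Fin M → ℕ) (h : ∀ j, ν j ≤ μ j)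
    (hlt : ∃ j, ν j < μ j) :
    ∃ G : ℝ → ℝ,
      (∀ x, 0 < x → 0 ≤ G x ∧ HasMeijerG [] (paramList μ) (paramList ν) [] x (G x : ℂ)) ∧
      Measurable G ∧ ∀ s : ℂ, 1 ≤ s.re → HasMellin (fun x => (G x : ℂ)) s
        (∏ j, Complex.Gamma (ν j + s) / Complex.Gamma (μ j + s)) := by
  set L : List ℕ := (List.finRange M).flatMap fun j => List.range' (ν j) (μ j - ν j) with hL
  have hmem : ∀ i ∈ L, ∃ j, ν j ≤ i := fun i hi => by
    obtain ⟨j, -, hj⟩ := List.mem_flatMap.1 hi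
    exact ⟨j, (List.mem_range'_1.1 hj).1⟩
  have hprod : ∀ s : ℂ, (∀ j, -(ν j : ℝ) < s.re) →
      (L.map fun i : ℕ => 1 / ((i : ℂ) + s)).prod =
        ∏ j, Complex.Gamma (ν j + s) / Complex.Gamma (μ j + s) := by
    intro s hs
    rw [hL, List.map_flatMap, List.flatMap_def, List.prod_flatten, List.map_map,
      ← List.ofFn_eq_map, List.prod_ofFn]
    refine Finset.prod_congr rfl fun j _ => ?_
    rw [Function.comp_apply, prod_range'_inv _ _ (hs j), Nat.add_sub_cancel' (h j)]
  have hLσ : ∀ σ : ℝ, (∀ j, -(ν j : ℝ) < σ) → ∀ i ∈ L, -(i : ℝ) < σ := fun σ hσ i hi => by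
    obtain ⟨j, hj⟩ := hmem i hi
    have : (ν j : ℝ) ≤ i := by exact_mod_cast hj
    linarith [hσ j]
  have hratio : ∀ s : ℂ, (∀ u ∈ paramList ν, s.re < u) →
      ((paramList ν).map fun u : ℝ => Complex.Gamma ((u : ℂ) - s)).prod /
      ((paramList μ).map fun u : ℝ => Complex.Gamma ((u : ℂ) - s)).prod =
        (L.map fun i : ℕ => 1 / ((i : ℂ) + -s)).prod := by
    intro s hs
    rw [hprod _ fun j => by simpa using hs _ (mem_paramList.2 ⟨j, rfl⟩), prod_map_paramList,
      prod_map_paramList, ← Finset.prod_div_distrib]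
    simp [sub_eq_add_neg]
  have h1 : ∀ s : ℂ, 1 ≤ s.re → ∀ j, -(ν j : ℝ) < s.re := fun s hs j => by
    linarith [(Nat.cast_nonneg _ : (0 : ℝ) ≤ ν j)]
  have hne : L ≠ [] := by
    obtain ⟨j, hj⟩ := hlt
    refine List.ne_nil_of_mem (a := ν j) (List.mem_flatMap.2 ⟨j, List.mem_finRange j, ?_⟩)
    exact List.mem_range'_1.2 ⟨le_rfl, by omega⟩
  rcases le_or_gt 2 L.length with hlen | hlen
  · obtain ⟨f, hf, hf0, hfc, hfm⟩ := exists_hasMellin_prod_inv L hne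
    refine ⟨f, fun x hx => ⟨hf0 x hx, ?_⟩, hf, fun s hs => ?_⟩
    · exact hasMeijerG_of_hasMellin
        (fun s hs => hfm s (hLσ _ fun j => hs _ (mem_paramList.2 ⟨j, rfl⟩)))
        (fun σ hσ => verticalIntegrable_prod_inv L hlen
          (hLσ _ fun j => hσ _ (mem_paramList.2 ⟨j, rfl⟩))) hratio hx (hfc hlen x hx)
    · rw [← hprod s (h1 s hs)]
      exact hfm s (hLσ _ (h1 s hs))
  · obtain ⟨i, hi⟩ : ∃ i, L = [i] := List.length_eq_one_iff.1
      (le_antisymm (by omega) (List.length_pos_iff.2 hne))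
    refine ⟨powerKernel i, fun x hx => ⟨powerKernel_nonneg i hx, exists_isMeijerLine_nil _,
      fun τ hτ => ?_⟩, measurable_powerKernel i, fun s hs => ?_⟩
    · have hτi : τ < i := by
        have := hLσ (-τ) (fun j => neg_lt_neg (hτ.1 _ (mem_paramList.2 ⟨j, rfl⟩))) i (by simp [hi])
        linarith
      refine (tendsto_intervalIntegral_powerKernel i hτi hx).congr fun T => ?_
      congr 2; ext t
      have := hratio (τ + t * Complex.I) fun u hu => by simpa using hτ.1 u hu
      simp only [meijerIntegrand_eq, List.map_nil, List.prod_nil, mul_one]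
      rw [this, hi]
      simp [sub_eq_add_neg]
    · rw [← hprod s (h1 s hs), hi]
      simpa using hasMellin_powerKernel i (hLσ _ (h1 s hs) i (by simp [hi]))

/-! ## Densities from moments -/

theorem hasMoments_dirac {c : ℝ} (hc : 0 < c) :
    HasMoments (Measure.dirac c) fun s => (c : ℂ) ^ s := by
  refine ⟨inferInstance, ?_, fun s _ => ?_, fun s _ => ?_⟩
  · rw [ae_dirac_iff measurableSet_Ioi]; exact hc
  · exact integrable_dirac (by simp)
  · exact integral_dirac _ _

theorem HasMoments.hasPosDensity {Ω : Type*} [MeasurableSpace Ω] {Pr : Measure Ω} {X : Ω → ℝ}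
    (hX : AEMeasurable X Pr) {κ : ℝ} {Φ : ℂ → ℂ}
    (h : HasMoments (Pr.map X) fun s => κ * Φ (s + 1)) {f : ℝ → ℝ} (hf : Measurable f)
    (h0 : ∀ x, 0 < x → 0 ≤ f x)
    (hM : ∀ s : ℂ, 1 ≤ s.re → HasMellin (fun x => (f x : ℂ)) s (Φ s))
    (hκ0 : 0 ≤ κ) {a : ℝ} (ha : 0 < a) :
    HasPosDensity Pr (fun ω => a⁻¹ * X ω) fun y => a * κ * f (a * y) := by
  have := h.prob
  have hκ : κ * Φ 1 = 1 := by
    have := h.integral 0 le_rfl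
    simpa using this.symm
  have ha' : (a : ℂ) ≠ 0 := by exact_mod_cast ha.ne'
  have harg : (a : ℂ).arg ≠ Real.pi := by
    rw [Complex.arg_ofReal_of_nonneg ha.le]; exact Real.pi_pos.ne
  have hM' : ∀ s : ℂ, 1 ≤ s.re →
      HasMellin (fun x => (f (a * x) : ℂ)) s ((a : ℂ) ^ (-s) * Φ s) := fun s hs => by
    refine ⟨(MellinConvergent.comp_mul_left (f := fun x => (f x : ℂ)) ha).2 (hM s hs).1, ?_⟩
    rw [mellin_comp_mul_left (fun x => (f x : ℂ)) s ha, (hM s hs).2, smul_eq_mul]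
  have h1 := hasMoments_withDensity (f := fun x => f (a * x)) (by fun_prop)
    (fun x hx => h0 _ (by positivity)) hM' (κ := a * κ) (by positivity) (by
      rw [Complex.cpow_neg_one]; push_cast
      rw [mul_mul_mul_comm, mul_inv_cancel₀ ha', one_mul, hκ])
  have h2 := (hasMoments_dirac (inv_pos.2 ha)).mconv h
  rw [Measure.dirac_mconv, AEMeasurable.map_map_of_aemeasurable (by fun_prop) hX] at h2
  refine ⟨by fun_prop, ?_⟩
  refine HasMoments.unique (φ := fun s => ((a⁻¹ : ℝ) : ℂ) ^ s * (κ * Φ (s + 1))) h2 ?_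
  convert h1 using 2 with s
  push_cast
  rw [Complex.inv_cpow _ _ harg, neg_add, Complex.cpow_add _ _ ha', Complex.cpow_neg,
    Complex.cpow_neg_one]
  field_simp

/-- The moments of a Gamma distribution with integral parameter. -/
theorem hasMoments_gammaKernel (a : ℕ) :
    HasMoments ((volume.restrict (Set.Ioi 0)).withDensity fun x =>
        ENNReal.ofReal ((a.factorial : ℝ)⁻¹ * gammaKernel a x))
      fun s => ((a.factorial : ℝ)⁻¹ : ℝ) * Complex.Gamma (a + (s + 1)) := by
  refine hasMoments_withDensity (Φ := fun s => Complex.Gamma (a + s))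
    (continuous_gammaKernel a).measurable
    (fun x hx => gammaKernel_nonneg a hx) (fun s hs => hasMellin_gammaKernel a ?_) (by positivity) ?_
  · linarith [(Nat.cast_nonneg a : (0 : ℝ) ≤ a)]
  · have : (a.factorial : ℂ) ≠ 0 := by exact_mod_cast a.factorial_ne_zero
    rw [Complex.Gamma_nat_eq_factorial]
    push_cast
    exact inv_mul_cancel₀ this

/-! ## The zero-forcing gain -/

/-- The zero-forcing gain `1 / [(A† A)⁻¹]_{kk}`, the squared distance of the `k`-th column of `A`
from the span of the other columns if `A` has full column rank. -/
noncomputable def zfGain {m n : Type*} [Fintype m] [Fintype n] [DecidableEq n] (A : Matrix m n ℂ)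
    (k : n) : ℝ := ((Aᴴ * A)⁻¹ k k).re⁻¹

theorem zfSINR_eq_mul_zfGain {r n : ℕ} (δ : ℝ) (H : Matrix (Fin r) (Fin n) ℂ) (k : Fin n) :
    zfSINR δ H k = δ * zfGain H k := div_eq_mul_inv _ _

theorem measurable_matrix_iff {α m n : Type*} [MeasurableSpace α] {f : α → Matrix m n ℂ} :
    Measurable f ↔ ∀ i j, Measurable fun x => f x i j := by
  constructor
  · intro h i j
    exact (measurable_pi_apply j).comp ((measurable_pi_apply i).comp h)
  · intro h
    exact measurable_pi_lambda _ fun i => measurable_pi_lambda _ fun j => h i j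

theorem measurable_matrix_apply {m n : Type*} (i : m) (j : n) :
    Measurable fun A : Matrix m n ℂ => A i j :=
  measurable_matrix_iff.1 measurable_id i j

theorem Measurable.matrix_mul {α l m n : Type*} [MeasurableSpace α] [Fintype m]
    {f : α → Matrix l m ℂ} {g : α → Matrix m n ℂ} (hf : Measurable f) (hg : Measurable g) :
    Measurable fun x => f x * g x := by
  rw [measurable_matrix_iff] at *
  intro i j
  simp only [Matrix.mul_apply]
  exact Finset.measurable_sum _ fun k _ => (hf i k).mul (hg k j)

theorem measurable_matrix_submatrix {m n m' n' : Type*} (f : m' → m) (g : n' → n) :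
    Measurable fun A : Matrix m n ℂ => A.submatrix f g :=
  measurable_matrix_iff.2 fun i j => measurable_matrix_apply (f i) (g j)

theorem measurable_matrix_transpose {m n : Type*} : Measurable fun A : Matrix m n ℂ => Aᵀ :=
  measurable_matrix_iff.2 fun i j => measurable_matrix_apply j i

theorem measurable_gram_det {m n : Type*} [Fintype m] [Fintype n] [DecidableEq n] :
    Measurable fun A : Matrix m n ℂ => (Aᴴ * A).det :=
  Continuous.measurable (by fun_prop)

theorem measurable_zfGain {m n : Type*} [Fintype m] [Fintype n] [DecidableEq n] (k : n) :
    Measurable fun A : Matrix m n ℂ => zfGain A k := by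
  simp only [zfGain, Matrix.inv_def, Ring.inverse_eq_inv', Matrix.smul_apply, smul_eq_mul]
  have h : Measurable fun A : Matrix m n ℂ => (Aᴴ * A).adjugate k k :=
    Continuous.measurable (by fun_prop)
  exact (Complex.measurable_re.comp (measurable_gram_det.inv.mul h)).inv

/-- A singular matrix has inverse `0` by convention, and so does the scalar `0`. Consequently a
positive gain certifies full column rank. -/
theorem zfGain_eq_zero {m n : Type*} [Fintype m] [Fintype n] [DecidableEq n]
    {A : Matrix m n ℂ} (h : (Aᴴ * A).det = 0) (k : n) : zfGain A k = 0 := by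
  simp [zfGain, Matrix.inv_def, h]

/-- The columns of `Y` are orthonormal; put them at the positions given by `e` and complete to an
orthonormal basis. -/
theorem exists_unitary_extend {m n : Type*} [Fintype m] [Fintype n] [DecidableEq m] [DecidableEq n]
    (e : n ↪ m) (Y : Matrix m n ℂ) (hY : Yᴴ * Y = 1) :
    ∃ Q ∈ Matrix.unitaryGroup m ℂ, Q.submatrix id e = Y := by
  let w : n → EuclideanSpace ℂ m := fun i => WithLp.toLp 2 fun a => Y a i
  have hw : ∀ i j, inner ℂ (w i) (w j) = if i = j then 1 else 0 := by
    intro i j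
    have := congrFun (congrFun hY i) j
    rw [Matrix.mul_apply, Matrix.one_apply] at this
    rw [← this, PiLp.inner_apply]
    simp [w, mul_comm]
  have hv : Orthonormal ℂ ((Set.range e).domRestrict (Function.extend e w 0)) := by
    rw [orthonormal_iff_ite]
    rintro ⟨_, i, rfl⟩ ⟨_, j, rfl⟩
    simp [Set.domRestrict_apply, e.injective.extend_apply, hw, Subtype.ext_iff]
  obtain ⟨b, hb⟩ := hv.exists_orthonormalBasis_extension_of_card_eq (by simp)
  refine ⟨Matrix.of fun i j => b j i, ?_, ?_⟩
  · rw [Matrix.mem_unitaryGroup_iff']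
    ext i j
    have := orthonormal_iff_ite.1 b.orthonormal i j
    rw [Matrix.one_apply, ← this, PiLp.inner_apply, Matrix.mul_apply]
    simp [Matrix.star_apply, mul_comm]
  · ext i j
    simp [hb (e j) ⟨j, rfl⟩, e.injective.extend_apply, w]

/-- The inverse is `T⁻¹ (Y†Y)⁻¹ (T†)⁻¹`, and the basis vector at `k` is an eigenvector of `(T†)⁻¹`,
so only one entry of the middle factor survives. The product rule for the inverse holds for singular
matrices as well, so `Y` need not have full rank. -/
theorem inv_gram_mul_apply {m n : Type*} [Fintype m] [Fintype n] [DecidableEq n] (Y : Matrix m n ℂ)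
    (T : Matrix n n ℂ) (k : n) {r : ℂ}
    (hT : ∀ j, Tᴴ⁻¹ j k = if j = k then r else 0) :
    ((Y * T)ᴴ * (Y * T))⁻¹ k k = Complex.normSq r * (Yᴴ * Y)⁻¹ k k := by
  have h1 : ((Y * T)ᴴ * (Y * T)) = Tᴴ * ((Yᴴ * Y) * T) := by
    simp only [Matrix.conjTranspose_mul, Matrix.mul_assoc]
  have hT' : ∀ j, T⁻¹ k j = if j = k then star r else 0 := by
    intro j
    have : T⁻¹ k j = star (Tᴴ⁻¹ j k) := by
      rw [← Matrix.conjTranspose_nonsing_inv, Matrix.conjTranspose_apply, star_star]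
    rw [this, hT]; split_ifs <;> simp
  rw [h1, Matrix.mul_inv_rev, Matrix.mul_inv_rev, Matrix.mul_apply]
  simp only [hT, Matrix.mul_apply, hT', mul_ite, mul_zero, ite_mul, zero_mul, Finset.sum_ite_eq',
    Finset.mem_univ, if_true]
  rw [Complex.normSq_eq_conj_mul_self]
  simp only [RCLike.star_def]; ring

/-- A matrix of full column rank is, up to a unitary factor and a scaling of the gain, an
isometric embedding. -/
theorem exists_unitary_zfGain_mul {l m n : Type*} [Fintype l] [Fintype m] [Fintype n]
    [DecidableEq m] [DecidableEq n] (e : n ↪ m) {Z : Matrix m n ℂ} (hZ : (Zᴴ * Z).det ≠ 0) (k : n) :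
    0 < zfGain Z k ∧ ∃ Q ∈ Matrix.unitaryGroup m ℂ, ∀ P : Matrix l m ℂ,
      zfGain (P * Z) k = zfGain Z k * zfGain ((P * Q).submatrix id e) k := by
  -- With `Z†Z = B†B` and `B` invertible, `Z B⁻¹` is an isometry.
  obtain ⟨B, hB⟩ := CStarAlgebra.nonneg_iff_eq_star_mul_self.1
    (Matrix.posSemidef_conjTranspose_mul_self Z).nonneg
  rw [Matrix.star_eq_conjTranspose] at hB
  have hBdet : B.det ≠ 0 := by
    rw [hB, Matrix.det_mul] at hZ
    exact right_ne_zero_of_mul hZ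
  have hBu : IsUnit B.det := isUnit_iff_ne_zero.2 hBdet
  have hBu' : IsUnit Bᴴ.det := by rw [Matrix.det_conjTranspose]; exact hBu.star
  -- the `k`-th dual vector
  let v : EuclideanSpace ℂ n := WithLp.toLp 2 fun i => Bᴴ⁻¹ i k
  have hv : v ≠ 0 := by
    intro h
    have h1 : ∀ i, Bᴴ⁻¹ i k = 0 := fun i => by
      have := congrArg (fun x : EuclideanSpace ℂ n => x i) h
      simpa [v] using this
    have h2 := congrFun (congrFun (Matrix.mul_nonsing_inv Bᴴ hBu') k) k
    rw [Matrix.mul_apply, Matrix.one_apply_eq] at h2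
    simp [h1] at h2
  have hvn : (‖v‖ : ℂ) ≠ 0 := by exact_mod_cast norm_ne_zero_iff.2 hv
  have hnorm : ∑ i, star (v i) * v i = (‖v‖ : ℂ) ^ 2 := by
    rw [← Complex.ofReal_pow, EuclideanSpace.norm_sq_eq, Complex.ofReal_sum]
    refine Finset.sum_congr rfl fun i _ => ?_
    rw [RCLike.star_def, ← Complex.normSq_eq_conj_mul_self, Complex.normSq_eq_norm_sq]
  -- A unitary whose `k`-th column is `v / ‖v‖`. Then `T = Q'† B` satisfies `(T†)⁻¹ e_k = Q'† v =
  -- ‖v‖ e_k`, the hypothesis of `inv_gram_mul_apply`.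
  obtain ⟨Q', hQ', hQ'k⟩ := exists_unitary_extend (n := Unit) ⟨fun _ => k, fun _ _ _ => rfl⟩
    (Matrix.of fun i _ => (‖v‖ : ℂ)⁻¹ * v i) (by
      ext i j
      simp only [Matrix.mul_apply, Matrix.conjTranspose_apply, Matrix.of_apply, star_mul',
        Matrix.one_apply_eq]
      have : ∀ x, star ((‖v‖ : ℂ)⁻¹) * star (v x) * ((‖v‖ : ℂ)⁻¹ * v x) =
          ((‖v‖ : ℂ)⁻¹) ^ 2 * (star (v x) * v x) := fun x => by
        simp only [RCLike.star_def, map_inv₀, Complex.conj_ofReal]; ring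
      simp_rw [this]
      rw [← Finset.mul_sum, hnorm, ← mul_pow, inv_mul_cancel₀ hvn, one_pow])
  have hQk : ∀ i, Q' i k = (‖v‖ : ℂ)⁻¹ * v i := fun i => by
    exact congrFun (congrFun hQ'k i) ()
  have hQ1 : Q'ᴴ * Q' = 1 := Matrix.mem_unitaryGroup_iff'.1 hQ'
  have hQ2 : Q' * Q'ᴴ = 1 := Matrix.mem_unitaryGroup_iff.1 hQ'
  set T : Matrix n n ℂ := Q'ᴴ * B with hT
  set Y : Matrix m n ℂ := Z * B⁻¹ * Q' with hYdef
  have hZYT : Z = Y * T := by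
    rw [hYdef, hT, Matrix.mul_assoc, ← Matrix.mul_assoc Q', hQ2, Matrix.one_mul, Matrix.mul_assoc,
      Matrix.nonsing_inv_mul _ hBu, Matrix.mul_one]
  have hY : Yᴴ * Y = 1 := by
    rw [hYdef, Matrix.conjTranspose_mul, Matrix.conjTranspose_mul, Matrix.mul_assoc Q'ᴴ,
      Matrix.mul_assoc B⁻¹ᴴ, Matrix.mul_assoc Z, ← Matrix.mul_assoc Zᴴ, hB, Matrix.mul_assoc Bᴴ,
      ← Matrix.mul_assoc B, Matrix.mul_nonsing_inv _ hBu, Matrix.one_mul, ← Matrix.mul_assoc B⁻¹ᴴ,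
      Matrix.conjTranspose_nonsing_inv, Matrix.nonsing_inv_mul _ hBu', Matrix.one_mul, hQ1]
  have hTk : ∀ j, Tᴴ⁻¹ j k = if j = k then (‖v‖ : ℂ) else 0 := by
    intro j
    have hQinv : Q'⁻¹ = Q'ᴴ := Matrix.inv_eq_left_inv hQ1
    have h1 : Tᴴ⁻¹ = Q'ᴴ * Bᴴ⁻¹ := by
      rw [hT, Matrix.conjTranspose_mul, Matrix.conjTranspose_conjTranspose, Matrix.mul_inv_rev,
        hQinv]
    have h2 : ∀ i, Bᴴ⁻¹ i k = ‖v‖ * Q' i k := fun i => by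
      rw [hQk, mul_inv_cancel_left₀ hvn]
    rw [h1, Matrix.mul_apply]
    simp_rw [h2, mul_left_comm _ (‖v‖ : ℂ)]
    rw [← Finset.mul_sum, ← Matrix.mul_apply, hQ1, Matrix.one_apply]
    simp
  have hgZ : zfGain Z k = (Complex.normSq (‖v‖ : ℂ))⁻¹ := by
    conv_lhs => rw [hZYT]
    rw [zfGain, inv_gram_mul_apply Y T k hTk, hY]
    simp
  refine ⟨?_, ?_⟩
  · rw [hgZ]; exact inv_pos.2 (Complex.normSq_pos.2 hvn)
  obtain ⟨Q, hQ, hQY⟩ := exists_unitary_extend e Y hY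
  refine ⟨Q, hQ, fun P => ?_⟩
  have hP : (P * Q).submatrix id e = P * Y := by
    rw [← hQY]; rfl
  conv_lhs => rw [hZYT]
  rw [hgZ, hP, ← Matrix.mul_assoc, zfGain, inv_gram_mul_apply (P * Y) T k hTk, Complex.re_ofReal_mul,
    mul_inv, zfGain]

/-! ## The zero-forcing gain as a squared distance -/

/-- The dual vector `x = ∑ j, w j • c j`, with `w` the `k`-th column of the inverse Gram matrix,
satisfies `⟪c j, x⟫ = δ_{jk}`. Hence `x` is orthogonal to `V`, `‖x‖ ^ 2 = w k`, and `x - w k • c k`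
lies in `V`. So the projection of `c k` to `Vᗮ` is `x / w k`, of squared norm `1 / w k`. -/
theorem zfGain_eq_sum_inner {m n ι : Type*} [Fintype m] [Fintype n] [DecidableEq n] [Fintype ι]
    {A : Matrix m n ℂ} (hA : (Aᴴ * A).det ≠ 0) (k : n) (V : Submodule ℂ (EuclideanSpace ℂ m))
    (hV : V = Submodule.span ℂ ((fun j => WithLp.toLp 2 (A.col j)) '' {j | j ≠ k}))
    (u : OrthonormalBasis ι ℂ Vᗮ) :
    zfGain A k = ∑ i, ‖inner ℂ (u i : EuclideanSpace ℂ m) (WithLp.toLp 2 (A.col k))‖ ^ 2 := by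
  set c : n → EuclideanSpace ℂ m := fun j => WithLp.toLp 2 (A.col j) with hc
  set w : n → ℂ := fun j => (Aᴴ * A)⁻¹ j k with hw
  have hu : IsUnit (Aᴴ * A).det := isUnit_iff_ne_zero.2 hA
  have hGw : ∀ j, ∑ i, (Aᴴ * A) j i * w i = if j = k then 1 else 0 := fun j => by
    have := congrFun (congrFun (Matrix.mul_nonsing_inv _ hu) j) k
    rwa [Matrix.mul_apply, Matrix.one_apply] at this
  have hinner : ∀ i j, inner ℂ (c i) (c j) = (Aᴴ * A) i j := fun i j => by
    rw [PiLp.inner_apply, Matrix.mul_apply]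
    simp [hc, Matrix.col, mul_comm]
  set x : EuclideanSpace ℂ m := ∑ j, w j • c j with hx
  have hcx : ∀ j, inner ℂ (c j) x = if j = k then 1 else 0 := fun j => by
    rw [hx, inner_sum, ← hGw j]
    exact Finset.sum_congr rfl fun i _ => by rw [inner_smul_right, hinner, mul_comm]
  have hxx : inner ℂ x x = star (w k) := by
    have : inner ℂ (∑ j, w j • c j) x = star (w k) := by
      rw [sum_inner]
      simp [inner_smul_left, hcx]
    rwa [← hx] at this
  have hnorm : (‖x‖ ^ 2 : ℝ) = (star (w k)) := by
    rw [← hxx, inner_self_eq_norm_sq_to_K]; push_cast; rfl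
  have hwk : w k = ((‖x‖ ^ 2 : ℝ) : ℂ) := by
    rw [← star_star (w k), ← hnorm]; simp
  have hx0 : x ≠ 0 := by
    intro h
    have := hcx k
    simp [h] at this
  have hn0 : (‖x‖ : ℂ) ≠ 0 := by exact_mod_cast norm_ne_zero_iff.2 hx0
  have hwk0 : w k ≠ 0 := by rw [hwk]; push_cast; exact pow_ne_zero 2 hn0
  have hxV : x ∈ Vᗮ := by
    rw [Submodule.mem_orthogonal, hV]
    intro v hv
    induction hv using Submodule.span_induction with
    | mem v hv =>
      obtain ⟨j, hj, rfl⟩ := hv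
      rw [hcx, if_neg hj]
    | zero => simp
    | add a b _ _ ha hb => rw [inner_add_left, ha, hb, add_zero]
    | smul a b _ hb => rw [inner_smul_left, hb, mul_zero]
  have hdiff : x - w k • c k ∈ V := by
    rw [hx, ← Finset.add_sum_erase _ _ (Finset.mem_univ k), add_sub_cancel_left, hV]
    refine Submodule.sum_mem _ fun j hj => Submodule.smul_mem _ _ (Submodule.subset_span ?_)
    exact ⟨j, Finset.ne_of_mem_erase hj, rfl⟩
  have hui : ∀ i, inner ℂ (u i : EuclideanSpace ℂ m) (c k) =
      (w k)⁻¹ * inner ℂ (u i) (⟨x, hxV⟩ : Vᗮ) := fun i => by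
    have h1 := (Submodule.mem_orthogonal' V _).1 (u i).2 _ hdiff
    rw [inner_sub_right, inner_smul_right, sub_eq_zero] at h1
    rw [Submodule.coe_inner, h1, inv_mul_cancel_left₀ hwk0]
  change _ = ∑ i, ‖inner ℂ (u i : EuclideanSpace ℂ m) (c k)‖ ^ 2
  simp_rw [hui, norm_mul, mul_pow]
  rw [← Finset.mul_sum, u.sum_sq_norm_inner_right, zfGain]
  change (w k).re⁻¹ = _ * ‖x‖ ^ 2
  have hn0' : ‖x‖ ≠ 0 := norm_ne_zero_iff.2 hx0
  rw [norm_inv, hwk, Complex.ofReal_re, Complex.norm_real, Real.norm_of_nonneg (by positivity)]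
  field_simp

/-! ## Complex Gaussian vectors -/

instance : IsProbabilityMeasure stdComplexGaussian := by
  have : Measurable fun p : ℝ × ℝ => (⟨p.1, p.2⟩ : ℂ) := Complex.measurableEquivRealProd.symm.measurable
  exact Measure.isProbabilityMeasure_map this.aemeasurable

theorem integral_stdComplexGaussian (f : ℂ → ℂ) :
    ∫ z, f z ∂stdComplexGaussian =
      ∫ p : ℝ × ℝ, f ⟨p.1, p.2⟩ ∂(gaussianReal 0 (1 / 2)).prod (gaussianReal 0 (1 / 2)) :=
  integral_map_equiv Complex.measurableEquivRealProd.symm f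

theorem charFun_stdComplexGaussian (t : ℂ) :
    charFun stdComplexGaussian t = Complex.exp (-(‖t‖ ^ 2 / 4 : ℝ)) := by
  rw [charFun_apply, integral_stdComplexGaussian]
  have h : ∀ p : ℝ × ℝ, Complex.exp ((inner ℝ (⟨p.1, p.2⟩ : ℂ) t : ℝ) * Complex.I) =
      Complex.exp (t.re * p.1 * Complex.I) * Complex.exp (t.im * p.2 * Complex.I) := fun p => by
    rw [← Complex.exp_add, Complex.inner]
    simp; ring_nf
  simp_rw [h]
  rw [integral_prod_mul (fun x : ℝ => Complex.exp (t.re * x * Complex.I))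
    (fun x : ℝ => Complex.exp (t.im * x * Complex.I)), ← charFun_apply_real, ← charFun_apply_real,
    charFun_gaussianReal, charFun_gaussianReal, ← Complex.exp_add, ← Complex.normSq_eq_norm_sq,
    Complex.normSq_apply]
  congr 1
  push_cast; ring

theorem prod_charFun_stdComplexGaussian {ι : Type*} [Fintype ι] (t : EuclideanSpace ℂ ι) :
    ∏ i, charFun stdComplexGaussian (t i) = Complex.exp (-(‖t‖ ^ 2 / 4 : ℝ)) := by
  simp_rw [charFun_stdComplexGaussian]
  rw [← Complex.exp_sum, EuclideanSpace.norm_sq_eq, Finset.sum_div, Complex.ofReal_sum,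
    Finset.sum_neg_distrib]

theorem euclidean_norm_sq_eq_dotProduct {ι : Type*} [Fintype ι] (x : EuclideanSpace ℂ ι) :
    ((‖x‖ ^ 2 : ℝ) : ℂ) = star x.ofLp ⬝ᵥ x.ofLp := by
  rw [EuclideanSpace.norm_sq_eq, Complex.ofReal_sum, dotProduct]
  refine Finset.sum_congr rfl fun i _ => ?_
  rw [Pi.star_apply, RCLike.star_def, ← Complex.normSq_eq_conj_mul_self, Complex.normSq_eq_norm_sq]

theorem euclidean_real_inner_eq {ι : Type*} [Fintype ι] (x y : ι → ℂ) :
    inner ℝ (WithLp.toLp 2 x : EuclideanSpace ℂ ι) (WithLp.toLp 2 y) = (star x ⬝ᵥ y).re := by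
  rw [PiLp.inner_apply, dotProduct, Complex.re_sum]
  refine Finset.sum_congr rfl fun i _ => ?_
  simp [Complex.inner]; ring

/-- Co-isometries preserve standard complex Gaussian vectors. -/
theorem map_mulVec_pi_stdComplexGaussian {m n : Type*} [Fintype m] [Fintype n] [DecidableEq m]
    (A : Matrix m n ℂ) (hA : A * Aᴴ = 1) :
    (Measure.pi fun _ : n => stdComplexGaussian).map (fun x => A *ᵥ x) =
      Measure.pi fun _ : m => stdComplexGaussian := by
  have hmeas : Measurable fun x : n → ℂ => A *ᵥ x :=
    Continuous.measurable (by fun_prop)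
  have := Measure.isProbabilityMeasure_map (μ := Measure.pi fun _ : n => stdComplexGaussian)
    hmeas.aemeasurable
  refine charFun_eq_pi_iff.1 fun t => ?_
  -- The characteristic function of the Gaussian vector depends only on the norm of its argument,
  -- and `A†` is isometric because `A A† = 1`.
  have hnorm : ‖(WithLp.toLp 2 (Aᴴ *ᵥ t.ofLp) : EuclideanSpace ℂ n)‖ ^ 2 =
      ‖(t : EuclideanSpace ℂ m)‖ ^ 2 := by
    have h2 : star (Aᴴ *ᵥ t.ofLp) ⬝ᵥ (Aᴴ *ᵥ t.ofLp) = star t.ofLp ⬝ᵥ t.ofLp := by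
      rw [Matrix.star_mulVec, Matrix.conjTranspose_conjTranspose, ← Matrix.dotProduct_mulVec,
        Matrix.mulVec_mulVec, hA, Matrix.one_mulVec]
    have h3 := euclidean_norm_sq_eq_dotProduct (WithLp.toLp 2 (Aᴴ *ᵥ t.ofLp) : EuclideanSpace ℂ n)
    rw [h2, ← euclidean_norm_sq_eq_dotProduct t] at h3
    exact_mod_cast h3
  have key : charFun (((Measure.pi fun _ : n => stdComplexGaussian).map (fun x => A *ᵥ x)).map
      (WithLp.toLp 2)) t =
      charFun ((Measure.pi fun _ : n => stdComplexGaussian).map (WithLp.toLp 2))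
        (WithLp.toLp 2 (Aᴴ *ᵥ t.ofLp) : EuclideanSpace ℂ n) := by
    rw [charFun_apply, charFun_apply, ← MeasurableEquiv.coe_toLp, ← MeasurableEquiv.coe_toLp,
      integral_map_equiv, integral_map_equiv, integral_map hmeas.aemeasurable]
    · refine integral_congr_ae (ae_of_all _ fun x => ?_)
      simp only [MeasurableEquiv.coe_toLp]
      congr 3
      have h5 := euclidean_real_inner_eq (A *ᵥ x) t.ofLp
      have h6 := euclidean_real_inner_eq x (Aᴴ *ᵥ t.ofLp)
      rw [Matrix.star_mulVec, ← Matrix.dotProduct_mulVec] at h5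
      rw [h6, ← h5]
    · apply Measurable.aestronglyMeasurable
      have : Measurable fun x : m → ℂ => inner ℝ (MeasurableEquiv.toLp 2 (m → ℂ) x) t := by fun_prop
      fun_prop
  rw [key, charFun_pi, prod_charFun_stdComplexGaussian, prod_charFun_stdComplexGaussian t, hnorm]

/-! ## The squared norm of a complex Gaussian vector -/

/-- The Gamma law with shape `a + 1` and rate `1`. -/
noncomputable def gammaLaw (a : ℕ) : Measure ℝ :=
  (volume.restrict (Set.Ioi 0)).withDensity fun x =>
    ENNReal.ofReal ((a.factorial : ℝ)⁻¹ * gammaKernel a x)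

theorem hasMoments_gammaLaw (a : ℕ) : HasMoments (gammaLaw a) fun s =>
    ((a.factorial : ℝ)⁻¹ : ℝ) * Complex.Gamma (a + (s + 1)) := hasMoments_gammaKernel a

instance (a : ℕ) : IsProbabilityMeasure (gammaLaw a) := (hasMoments_gammaLaw a).prob

theorem integrableOn_pow_mul_cexp (a : ℕ) {b : ℂ} (hb : b.re = 1) :
    IntegrableOn (fun x : ℝ => (x : ℂ) ^ a * Complex.exp (-b * x)) (Set.Ioi 0) := by
  have h1 := integrableOn_of_hasMellin_one (hasMellin_gammaKernel a (s := 1) (by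
    simp only [Complex.one_re]; linarith [(Nat.cast_nonneg a : (0 : ℝ) ≤ a)]))
  refine Integrable.mono' h1 (Continuous.aestronglyMeasurable (by fun_prop)) ?_
  filter_upwards [ae_restrict_mem measurableSet_Ioi] with x (hx : 0 < x)
  rw [norm_mul, Complex.norm_exp, norm_pow, Complex.norm_real, Real.norm_of_nonneg hx.le]
  simp [hb, gammaKernel]

/-- Induction on `a` by integration by parts. The parameter is complex because it is used at `b = 1
- t * I`, for the characteristic function of the Gamma law. -/
theorem integral_pow_mul_cexp (a : ℕ) {b : ℂ} (hb : b.re = 1) :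
    ∫ x in Set.Ioi (0 : ℝ), (x : ℂ) ^ a * Complex.exp (-b * x) = a.factorial / b ^ (a + 1) := by
  have hb0 : b ≠ 0 := fun h => by simp [h] at hb
  have hexp : ∀ x : ℝ, HasDerivAt (fun x : ℝ => Complex.exp (-b * x)) (-b * Complex.exp (-b * x)) x := by
    intro x
    have h1 : HasDerivAt (fun x : ℝ => -b * (x : ℂ)) (-b) x := by
      simpa using (Complex.ofRealCLM.hasDerivAt (x := x)).const_mul (-b)
    simpa [mul_comm] using h1.cexp
  have hlim : ∀ k : ℕ, Tendsto (fun x : ℝ => (x : ℂ) ^ k * Complex.exp (-b * x)) atTop (𝓝 0) := by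
    intro k
    rw [tendsto_zero_iff_norm_tendsto_zero]
    refine (Real.tendsto_pow_mul_exp_neg_atTop_nhds_zero k).congr' ?_
    filter_upwards [eventually_ge_atTop 0] with x hx
    rw [norm_mul, Complex.norm_exp, norm_pow, Complex.norm_real, Real.norm_of_nonneg hx]
    simp [hb]
  induction a with
  | zero =>
    have h := integral_Ioi_of_hasDerivAt_of_tendsto' (a := 0)
      (f := fun x : ℝ => -b⁻¹ * Complex.exp (-b * x)) (f' := fun x : ℝ => Complex.exp (-b * x))
      (m := 0) (fun x _ => ((hexp x).const_mul (-b⁻¹)).congr_deriv (by field_simp))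
      (by simpa using integrableOn_pow_mul_cexp 0 hb)
      (by simpa using (hlim 0).const_mul (-b⁻¹))
    simpa using h
  | succ a ih =>
    have hd : ∀ x : ℝ, HasDerivAt (fun x : ℝ => -b⁻¹ * ((x : ℂ) ^ (a + 1) * Complex.exp (-b * x)))
        ((x : ℂ) ^ (a + 1) * Complex.exp (-b * x) -
          (a + 1) / b * ((x : ℂ) ^ a * Complex.exp (-b * x))) x := by
      intro x
      have h1 : HasDerivAt (fun x : ℝ => (x : ℂ) ^ (a + 1)) ((a + 1 : ℕ) * (x : ℂ) ^ a) x := by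
        refine ((Complex.ofRealCLM.hasDerivAt (x := x)).fun_pow (a + 1)).congr_deriv ?_
        simp
      refine ((h1.mul (hexp x)).const_mul (-b⁻¹)).congr_deriv ?_
      push_cast; field_simp; ring
    have h := integral_Ioi_of_hasDerivAt_of_tendsto' (a := 0) (m := 0) (fun x _ => hd x)
      ((integrableOn_pow_mul_cexp (a + 1) hb).sub
        ((integrableOn_pow_mul_cexp a hb).const_mul _))
      (by simpa using (hlim (a + 1)).const_mul (-b⁻¹))
    rw [integral_sub (integrableOn_pow_mul_cexp (a + 1) hb)
      ((integrableOn_pow_mul_cexp a hb).const_mul _), integral_const_mul, ih] at h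
    simp only [Complex.ofReal_zero, ne_eq, Nat.add_eq_zero_iff, one_ne_zero, and_false,
      not_false_eq_true, zero_pow, zero_mul, mul_zero, sub_self] at h
    rw [sub_eq_zero.1 h, Nat.factorial_succ]
    push_cast; field_simp; ring

theorem charFun_gammaLaw (a : ℕ) (t : ℝ) :
    charFun (gammaLaw a) t = (1 / (1 - t * Complex.I)) ^ (a + 1) := by
  have ha : (a.factorial : ℂ) ≠ 0 := by exact_mod_cast a.factorial_ne_zero
  rw [charFun_apply_real, gammaLaw, integral_withDensity_eq_integral_toReal_smul
    (by have := (continuous_gammaKernel a).measurable; fun_prop)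
    (ae_of_all _ fun _ => ENNReal.ofReal_lt_top)]
  have e : Set.EqOn (fun x : ℝ => (ENNReal.ofReal ((a.factorial : ℝ)⁻¹ * gammaKernel a x)).toReal •
      Complex.exp (t * x * Complex.I))
      (fun x : ℝ => (a.factorial : ℂ)⁻¹ * ((x : ℂ) ^ a * Complex.exp (-(1 - t * Complex.I) * x)))
      (Set.Ioi 0) := by
    intro x (hx : 0 < x)
    have := gammaKernel_nonneg a hx
    simp only
    rw [ENNReal.toReal_ofReal (by positivity), Complex.real_smul, gammaKernel]
    push_cast
    rw [mul_assoc, mul_assoc, ← Complex.exp_add]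
    ring_nf
  rw [setIntegral_congr_fun measurableSet_Ioi e, integral_const_mul,
    integral_pow_mul_cexp a (by simp), div_pow, one_pow]
  field_simp

/-- Real and imaginary part each contribute the same principal square root, so their product is a
square and no branch question arises. -/
theorem integral_cexp_norm_sq_stdComplexGaussian (t : ℝ) :
    ∫ z, Complex.exp (t * (‖z‖ ^ 2 : ℝ) * Complex.I) ∂stdComplexGaussian =
      1 / (1 - t * Complex.I) := by
  have hb : 0 < (1 - t * Complex.I).re := by simp
  have hb0 : (1 - t * Complex.I) ≠ 0 := fun h => by simp [h] at hb
  have hpi : (Real.pi : ℂ) ≠ 0 := by exact_mod_cast Real.pi_ne_zero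
  rw [integral_stdComplexGaussian]
  have h : ∀ p : ℝ × ℝ, Complex.exp (t * (‖(⟨p.1, p.2⟩ : ℂ)‖ ^ 2 : ℝ) * Complex.I) =
      Complex.exp (t * p.1 ^ 2 * Complex.I) * Complex.exp (t * p.2 ^ 2 * Complex.I) := fun p => by
    rw [← Complex.exp_add, Complex.sq_norm, Complex.normSq_apply]
    push_cast; ring_nf
  simp_rw [h]
  have h1 : ∫ x : ℝ, Complex.exp (t * x ^ 2 * Complex.I) ∂gaussianReal 0 (1 / 2) =
      ((√Real.pi)⁻¹ : ℝ) * (Real.pi / (1 - t * Complex.I)) ^ (1 / 2 : ℂ) := by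
    rw [integral_gaussianReal_eq_integral_smul (by norm_num), ← integral_gaussian_complex hb,
      ← integral_const_mul]
    congr 1; ext x
    rw [gaussianPDFReal, Complex.real_smul]
    push_cast
    rw [mul_assoc, ← Complex.exp_add]
    congr 2
    · congr 2; ring
    · simp; ring_nf
  rw [integral_prod_mul (fun x : ℝ => Complex.exp (t * x ^ 2 * Complex.I))
    (fun x : ℝ => Complex.exp (t * x ^ 2 * Complex.I)), h1, mul_mul_mul_comm, ← Complex.ofReal_mul,
    ← mul_inv, Real.mul_self_sqrt Real.pi_pos.le, ← sq, ← Complex.cpow_nat_mul]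
  simp only [Nat.cast_ofNat, one_div, ne_eq, OfNat.ofNat_ne_zero, not_false_eq_true, mul_inv_cancel₀,
    Complex.cpow_one]
  push_cast
  field_simp

theorem map_sum_norm_sq_pi_stdComplexGaussian {ι : Type*} [Fintype ι] {a : ℕ}
    (h : Fintype.card ι = a + 1) :
    (Measure.pi fun _ : ι => stdComplexGaussian).map (fun x => ∑ i, ‖x i‖ ^ 2) = gammaLaw a := by
  have hm : Measurable fun x : ι → ℂ => ∑ i, ‖x i‖ ^ 2 := by fun_prop
  have := Measure.isProbabilityMeasure_map (μ := Measure.pi fun _ : ι => stdComplexGaussian)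
    hm.aemeasurable
  refine Measure.ext_of_charFun (funext fun t => ?_)
  rw [charFun_gammaLaw, charFun_apply_real, integral_map hm.aemeasurable
    (Measurable.aestronglyMeasurable (by fun_prop))]
  have e : ∀ x : ι → ℂ, Complex.exp (t * (∑ i, ‖x i‖ ^ 2 : ℝ) * Complex.I) =
      ∏ i, Complex.exp (t * (‖x i‖ ^ 2 : ℝ) * Complex.I) := fun x => by
    rw [← Complex.exp_sum]; push_cast; rw [Finset.mul_sum, Finset.sum_mul]
  simp_rw [e]
  rw [integral_fintype_prod_eq_pow (fun z : ℂ => Complex.exp (t * (‖z‖ ^ 2 : ℝ) * Complex.I)),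
    integral_cexp_norm_sq_stdComplexGaussian, h]

/-- The squared norm of the projection of a Gaussian vector to a subspace. -/
theorem map_sum_inner_pi_stdComplexGaussian {m ι : Type*} [Fintype m] [Fintype ι] [DecidableEq ι]
    {u : ι → EuclideanSpace ℂ m} (hu : Orthonormal ℂ u) {a : ℕ} (h : Fintype.card ι = a + 1) :
    (Measure.pi fun _ : m => stdComplexGaussian).map
      (fun x => ∑ i, ‖inner ℂ (u i) (WithLp.toLp 2 x)‖ ^ 2) = gammaLaw a := by
  let A : Matrix ι m ℂ := Matrix.of fun i j => star (u i j)
  have hA : A * Aᴴ = 1 := by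
    ext i j
    have := orthonormal_iff_ite.1 hu i j
    rw [Matrix.one_apply, ← this, PiLp.inner_apply, Matrix.mul_apply]
    simp [A, mul_comm]
  have hAx : ∀ (x : m → ℂ) i, (A *ᵥ x) i = inner ℂ (u i) (WithLp.toLp 2 x) := fun x i => by
    rw [PiLp.inner_apply, Matrix.mulVec, dotProduct]
    simp [A, mul_comm]
  rw [← map_sum_norm_sq_pi_stdComplexGaussian h, ← map_mulVec_pi_stdComplexGaussian A hA,
    Measure.map_map (by fun_prop) (Continuous.measurable (by fun_prop))]
  congr 1; ext x
  simp [hAx]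

/-! ## Product measures -/

theorem map_comp_pi {ι ι' α : Type*} [Fintype ι] [Fintype ι'] [MeasurableSpace α] (γ : Measure α)
    [IsProbabilityMeasure γ] (e : ι' ↪ ι) :
    (Measure.pi fun _ : ι => γ).map (fun x => x ∘ e) = Measure.pi fun _ : ι' => γ := by
  classical
  have hm : Measurable fun x : ι → α => x ∘ e :=
    measurable_pi_lambda _ fun i => measurable_pi_apply (e i)
  refine (Measure.pi_eq fun s hs => ?_).symm
  rw [Measure.map_apply hm (MeasurableSet.univ_pi hs)]
  have h : (fun x : ι → α => x ∘ e) ⁻¹' Set.univ.pi s =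
      Set.univ.pi (Function.extend e s fun _ => Set.univ) := by
    ext x
    simp only [Set.mem_preimage, Set.mem_univ_pi, Function.comp_apply]
    constructor
    · intro hx i
      by_cases hi : ∃ j, e j = i
      · obtain ⟨j, rfl⟩ := hi
        rw [e.injective.extend_apply]; exact hx j
      · rw [Function.extend_apply' _ _ _ hi]; trivial
    · intro hx j
      have := hx (e j)
      rwa [e.injective.extend_apply] at this
  rw [h, Measure.pi_pi]
  symm
  refine Fintype.prod_of_injective e e.injective _ _ (fun i hi => ?_) fun i => ?_
  · rw [Function.extend_apply' _ _ _ (by simpa using hi), measure_univ]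
  · rw [e.injective.extend_apply]

theorem map_insertNth_pi {α : Type*} [MeasurableSpace α] {n : ℕ} (γ : Measure α)
    [IsProbabilityMeasure γ] (k : Fin (n + 1)) :
    ((Measure.pi fun _ : Fin n => γ).prod γ).map
      (fun q => (k.insertNth q.2 q.1 : Fin (n + 1) → α)) = Measure.pi fun _ : Fin (n + 1) => γ := by
  have h1 := ((measurePreserving_piFinSuccAbove (fun _ : Fin (n + 1) => γ) k).symm).comp
    (Measure.measurePreserving_swap (μ := Measure.pi fun _ : Fin n => γ) (ν := γ))
  exact h1.map_eq

/-- Conditioning: a conditional law that does not depend on the condition is the unconditional law.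
-/
theorem map_prod_eq_of_ae {α β δ : Type*} [MeasurableSpace α] [MeasurableSpace β]
    [MeasurableSpace δ] {μ : Measure α} [IsProbabilityMeasure μ] {ν : Measure β} [SFinite ν]
    {ρ : Measure δ} {f : α × β → δ} (hf : Measurable f)
    (h : ∀ᵐ a ∂μ, ν.map (fun b => f (a, b)) = ρ) : (μ.prod ν).map f = ρ := by
  ext s hs
  rw [Measure.map_apply hf hs, Measure.prod_apply (hf hs)]
  have : ∀ᵐ a ∂μ, ν (Prod.mk a ⁻¹' (f ⁻¹' s)) = ρ s := by
    filter_upwards [h] with a ha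
    rw [← ha]
    exact (Measure.map_apply (hf.comp measurable_prodMk_left) hs).symm
  rw [lintegral_congr_ae this]
  simp

/-! ## Ginibre matrices -/

theorem ginibreMeasure_eq_map (m n : ℕ) : ginibreMeasure m n =
    (Measure.pi fun _ : Fin m × Fin n => stdComplexGaussian).map
      (fun x => Matrix.of fun i j => x (i, j)) := by
  have h := Measure.infinitePi_map_curry (fun (_ : Fin m) (_ : Fin n) => stdComplexGaussian)
  simp only [Measure.infinitePi_eq_pi] at h
  exact h.symm

instance (m n : ℕ) : IsProbabilityMeasure (ginibreMeasure m n) :=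
  inferInstanceAs (IsProbabilityMeasure
    (Measure.pi fun _ : Fin m => Measure.pi fun _ : Fin n => stdComplexGaussian))

theorem map_ginibreMeasure_submatrix {m n m' n' : ℕ} (e : Fin m' ↪ Fin m) (f : Fin n' ↪ Fin n) :
    (ginibreMeasure m n).map (fun A => A.submatrix e f) = ginibreMeasure m' n' := by
  have hof : ∀ m n : ℕ, Measurable fun x : Fin m × Fin n → ℂ => Matrix.of fun i j => x (i, j) :=
    fun m n => measurable_matrix_iff.2 fun i j => measurable_pi_apply (i, j)
  rw [ginibreMeasure_eq_map, ginibreMeasure_eq_map, ← map_comp_pi stdComplexGaussian (e.prodMap f),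
    Measure.map_map (measurable_matrix_submatrix _ _) (hof _ _), Measure.map_map (hof _ _)
      (measurable_pi_lambda _ fun i => measurable_pi_apply _)]
  rfl

theorem map_ginibreMeasure_transpose (m n : ℕ) :
    (ginibreMeasure m n).map (fun A => Aᵀ) = ginibreMeasure n m := by
  have hof : ∀ m n : ℕ, Measurable fun x : Fin m × Fin n → ℂ => Matrix.of fun i j => x (i, j) :=
    fun m n => measurable_matrix_iff.2 fun i j => measurable_pi_apply (i, j)
  rw [ginibreMeasure_eq_map, ginibreMeasure_eq_map,
    ← map_comp_pi stdComplexGaussian (Equiv.prodComm (Fin n) (Fin m)).toEmbedding,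
    Measure.map_map measurable_matrix_transpose (hof _ _), Measure.map_map (hof _ _)
      (measurable_pi_lambda _ fun i => measurable_pi_apply _)]
  rfl

/-- The rows are independent standard Gaussian vectors, and right multiplication by `Q` acts on each
row as the unitary `Qᵀ`. -/
theorem map_ginibreMeasure_mul_right {m n : ℕ} {Q : Matrix (Fin n) (Fin n) ℂ}
    (hQ : Q ∈ Matrix.unitaryGroup (Fin n) ℂ) :
    (ginibreMeasure m n).map (fun A => A * Q) = ginibreMeasure m n := by
  have h1 : Qᵀ * Qᵀᴴ = 1 := by
    have := congrArg Matrix.transpose (Matrix.mem_unitaryGroup_iff'.1 hQ)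
    rw [Matrix.transpose_mul, Matrix.transpose_one] at this
    exact this
  have h2 := map_mulVec_pi_stdComplexGaussian Qᵀ h1
  have hm : Measurable fun x : Fin n → ℂ => Qᵀ *ᵥ x := Continuous.measurable (by fun_prop)
  have h3 := Measure.pi_map_pi (μ := fun _ : Fin m => Measure.pi fun _ : Fin n => stdComplexGaussian)
    (f := fun _ x => Qᵀ *ᵥ x) (hμ := fun _ => by rw [h2]; infer_instance) (fun _ => hm.aemeasurable)
  simp only [h2] at h3
  refine Eq.trans ?_ h3
  unfold ginibreMeasure
  congr 1
  ext A i j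
  simp only [Matrix.mul_apply, Matrix.mulVec, dotProduct, Matrix.transpose_apply]
  exact Finset.sum_congr rfl fun _ _ => mul_comm _ _

theorem map_ginibreMeasure_mul_left {m n : ℕ} {Q : Matrix (Fin m) (Fin m) ℂ}
    (hQ : Q ∈ Matrix.unitaryGroup (Fin m) ℂ) :
    (ginibreMeasure m n).map (fun A => Q * A) = ginibreMeasure m n := by
  have hQ' : Qᵀ ∈ Matrix.unitaryGroup (Fin m) ℂ := by
    rw [Matrix.mem_unitaryGroup_iff]
    have := congrArg Matrix.transpose (Matrix.mem_unitaryGroup_iff'.1 hQ)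
    rw [Matrix.transpose_mul, Matrix.transpose_one] at this
    exact this
  have hm : Measurable fun A : Matrix (Fin n) (Fin m) ℂ => A * Qᵀ :=
    measurable_id.matrix_mul measurable_const
  have hm' : Measurable fun A : Matrix (Fin m) (Fin n) ℂ => Q * A :=
    measurable_const.matrix_mul measurable_id
  rw [← map_ginibreMeasure_transpose n m, Measure.map_map hm' measurable_matrix_transpose]
  conv_rhs => rw [← map_ginibreMeasure_mul_right hQ', Measure.map_map measurable_matrix_transpose hm]
  congr 1; ext A : 1
  simp [Matrix.transpose_mul]

/-- The squared norm of the projection to `Vᗮ ≠ 0` has a Gamma law, so it is almost surely positive.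
-/
theorem ae_notMem_submodule {m : Type*} [Fintype m] {V : Submodule ℂ (EuclideanSpace ℂ m)}
    (hV : V ≠ ⊤) : ∀ᵐ x ∂Measure.pi fun _ : m => stdComplexGaussian, WithLp.toLp 2 x ∉ V := by
  have hd : Module.finrank ℂ Vᗮ ≠ 0 := by
    rw [Ne, Submodule.finrank_eq_zero, Submodule.orthogonal_eq_bot_iff]; exact hV
  obtain ⟨a, ha⟩ := Nat.exists_eq_succ_of_ne_zero hd
  have hu := (stdOrthonormalBasis ℂ Vᗮ).orthonormal.comp_linearIsometry Vᗮ.subtypeₗᵢ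
  have h := map_sum_inner_pi_stdComplexGaussian hu (a := a) (by simpa using ha)
  have hpos := (hasMoments_gammaLaw a).pos
  rw [← h] at hpos
  filter_upwards [ae_of_ae_map (Measurable.aemeasurable (Continuous.measurable (by fun_prop))) hpos]
    with x hx hxV
  refine hx.ne' (Finset.sum_eq_zero fun i _ => ?_)
  have : inner ℂ ((Vᗮ.subtypeₗᵢ ∘ stdOrthonormalBasis ℂ Vᗮ) i) (WithLp.toLp 2 x) = 0 :=
    (Submodule.mem_orthogonal' V _).1 (stdOrthonormalBasis ℂ Vᗮ i).2 _ hxV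
  rw [this]
  simp

theorem gram_det_ne_zero_iff {m n : Type*} [Fintype m] [Fintype n] [DecidableEq n]
    {A : Matrix m n ℂ} : (Aᴴ * A).det ≠ 0 ↔ LinearIndependent ℂ A.col := by
  rw [← Matrix.mulVec_injective_iff]
  constructor
  · intro h x y hxy
    have h1 : (Aᴴ * A) *ᵥ x = (Aᴴ * A) *ᵥ y := by
      rw [← Matrix.mulVec_mulVec, ← Matrix.mulVec_mulVec, hxy]
    exact Matrix.mulVec_injective_of_isUnit ((Matrix.isUnit_iff_isUnit_det _).2 h.isUnit) h1
  · intro h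
    exact (Matrix.PosDef.conjTranspose_mul_self A h).det_pos.ne'

/-- The matrix with `k`-th column `x` and the other columns those of `B`. -/
def insertCol {N n : ℕ} (k : Fin (n + 1)) (B : Matrix (Fin N) (Fin n) ℂ) (x : Fin N → ℂ) :
    Matrix (Fin N) (Fin (n + 1)) ℂ :=
  Matrix.of fun i => k.insertNth (x i) (B i)

theorem insertCol_col_same {N n : ℕ} (k : Fin (n + 1)) (B : Matrix (Fin N) (Fin n) ℂ)
    (x : Fin N → ℂ) : (insertCol k B x).col k = x := by
  ext i; simp [insertCol, Matrix.col]

theorem insertCol_col_succAbove {N n : ℕ} (k : Fin (n + 1)) (B : Matrix (Fin N) (Fin n) ℂ)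
    (x : Fin N → ℂ) (j : Fin n) : (insertCol k B x).col (k.succAbove j) = B.col j := by
  ext i; simp [insertCol, Matrix.col]

theorem measurable_insertCol {N n : ℕ} (k : Fin (n + 1)) :
    Measurable fun q : Matrix (Fin N) (Fin n) ℂ × (Fin N → ℂ) => insertCol k q.1 q.2 := by
  refine measurable_matrix_iff.2 fun i j => ?_
  induction j using k.succAboveCases with
  | x =>
    simp only [insertCol, Matrix.of_apply, Fin.insertNth_apply_same]
    exact (measurable_pi_apply i).comp measurable_snd
  | p j =>
    simp only [insertCol, Matrix.of_apply, Fin.insertNth_apply_succAbove]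
    exact (measurable_matrix_apply i j).comp measurable_fst

/-- The `k`-th column is split off as an independent Gaussian vector. As the product measure is
organised by rows, the argument passes through the transpose. -/
theorem ginibreMeasure_succ (N : ℕ) {n : ℕ} (k : Fin (n + 1)) :
    ginibreMeasure N (n + 1) = ((ginibreMeasure N n).prod
      (Measure.pi fun _ : Fin N => stdComplexGaussian)).map (fun q => insertCol k q.1 q.2) := by
  have h := map_insertNth_pi (Measure.pi fun _ : Fin N => stdComplexGaussian) k
  have hm : Measurable fun q : (Fin n → Fin N → ℂ) × (Fin N → ℂ) =>
      (k.insertNth q.2 q.1 : Fin (n + 1) → Fin N → ℂ) := by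
    exact (MeasurableEquiv.piFinSuccAbove (fun _ => Fin N → ℂ) k).symm.measurable.comp
      measurable_swap
  have h1 := Measure.map_prod_map (ginibreMeasure n N)
    (Measure.pi fun _ : Fin N => stdComplexGaussian) (measurable_matrix_transpose) measurable_id
  rw [map_ginibreMeasure_transpose, Measure.map_id] at h1
  rw [h1, Measure.map_map (measurable_insertCol k)
    (measurable_matrix_transpose.prodMap measurable_id), ← map_ginibreMeasure_transpose]
  have h2 : ginibreMeasure (n + 1) N = ((ginibreMeasure n N).prod
      (Measure.pi fun _ : Fin N => stdComplexGaussian)).map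
        (fun q => (k.insertNth q.2 q.1 : Fin (n + 1) → Fin N → ℂ)) := h.symm
  rw [h2]
  refine (Measure.map_map measurable_matrix_transpose hm).trans ?_
  congr 1
  ext q i j
  change (k.insertNth q.2 q.1 : Fin (n + 1) → Fin N → ℂ) j i =
    (k.insertNth (q.2 i) (fun l => q.1 l i) : Fin (n + 1) → ℂ) j
  induction j using k.succAboveCases <;> simp

/-- Add columns one at a time: the span of fewer than `N` columns is a proper subspace, which the
next column almost surely avoids. -/
theorem ae_ginibreMeasure_gram_det_ne_zero {N n : ℕ} (h : n ≤ N) :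
    ∀ᵐ A ∂ginibreMeasure N n, (Aᴴ * A).det ≠ 0 := by
  induction n with
  | zero => exact ae_of_all _ fun A => by simp
  | succ n ih =>
    have hs : MeasurableSet {A : Matrix (Fin N) (Fin (n + 1)) ℂ | (Aᴴ * A).det ≠ 0} :=
      measurable_gram_det (measurableSet_singleton 0).compl
    rw [ginibreMeasure_succ N 0, ae_map_iff (measurable_insertCol 0).aemeasurable hs]
    refine (Measure.ae_prod_iff_ae_ae (measurable_insertCol 0 hs)).2 ?_
    filter_upwards [ih (by omega)] with B hB
    rw [gram_det_ne_zero_iff] at hB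
    let φ := (WithLp.linearEquiv 2 ℂ (Fin N → ℂ)).symm
    have hV : (Submodule.span ℂ (Set.range B.col)).map φ.toLinearMap ≠ ⊤ := by
      intro hV
      have h1 := congrArg (fun W : Submodule ℂ (WithLp 2 (Fin N → ℂ)) => Module.finrank ℂ W) hV
      beta_reduce at h1
      rw [LinearEquiv.finrank_map_eq, finrank_span_eq_card hB, finrank_top] at h1
      simp at h1
      omega
    filter_upwards [ae_notMem_submodule hV] with x hx
    rw [gram_det_ne_zero_iff]
    have h2 : (insertCol 0 B x).col = Fin.cons x B.col := by
      ext j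
      induction j using Fin.cases with
      | zero => rw [insertCol_col_same]; rfl
      | succ j => rw [← Fin.zero_succAbove, insertCol_col_succAbove]; rfl
    rw [h2, linearIndependent_finCons]
    exact ⟨hB, fun hx' => hx ⟨x, hx', rfl⟩⟩

/-- The law of the zero-forcing gain of a Ginibre matrix. -/
theorem map_zfGain_ginibreMeasure {N n a : ℕ} (h : N = n + 1 + a) (k : Fin (n + 1)) :
    (ginibreMeasure N (n + 1)).map (fun A => zfGain A k) = gammaLaw a := by
  have hdet := ae_ginibreMeasure_gram_det_ne_zero (N := N) (n := n + 1) (by omega)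
  rw [ginibreMeasure_succ N k] at hdet
  have hdet := Measure.ae_ae_of_ae_prod (ae_of_ae_map (measurable_insertCol k).aemeasurable hdet)
  rw [ginibreMeasure_succ N k, Measure.map_map (measurable_zfGain k) (measurable_insertCol k)]
  -- Condition on the other `n` columns `B`. Their span has codimension `N - n = a + 1`, which is
  -- the shape of the Gamma law whatever `B` is.
  refine map_prod_eq_of_ae ((measurable_zfGain k).comp (measurable_insertCol k)) ?_
  filter_upwards [hdet, ae_ginibreMeasure_gram_det_ne_zero (N := N) (n := n) (by omega)]
    with B hB hB'
  let φ := (WithLp.linearEquiv 2 ℂ (Fin N → ℂ)).symm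
  let V := Submodule.span ℂ (Set.range fun j => φ (B.col j))
  have hli : LinearIndependent ℂ fun j => φ (B.col j) :=
    (gram_det_ne_zero_iff.1 hB').map' φ.toLinearMap φ.ker
  have hVn : Module.finrank ℂ V = n := by
    rw [finrank_span_eq_card hli, Fintype.card_fin]
  have hVo : Module.finrank ℂ Vᗮ = a + 1 := by
    have := Submodule.finrank_add_finrank_orthogonal V
    rw [hVn, finrank_euclideanSpace_fin] at this
    omega
  have hu := (stdOrthonormalBasis ℂ Vᗮ).orthonormal.comp_linearIsometry Vᗮ.subtypeₗᵢ
  rw [← map_sum_inner_pi_stdComplexGaussian hu (a := a) (by simpa using hVo)]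
  refine Measure.map_congr ?_
  filter_upwards [hB] with x hx
  change zfGain (insertCol k B x) k = _
  have hV : V = Submodule.span ℂ
      ((fun j => WithLp.toLp 2 ((insertCol k B x).col j)) '' {j | j ≠ k}) := by
    have : {j | j ≠ k} = Set.range k.succAbove := by
      rw [Fin.range_succAbove]; rfl
    rw [this, ← Set.range_comp]
    refine congrArg (fun f => Submodule.span ℂ (Set.range f)) (funext fun j => ?_)
    rw [Function.comp_apply, insertCol_col_succAbove]
    rfl
  rw [zfGain_eq_sum_inner hx k V hV (stdOrthonormalBasis ℂ Vᗮ), insertCol_col_same]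
  rfl

/-! ## Multiplication by a unitarily invariant random matrix -/

theorem map_prod_congr_of_ae {α β δ : Type*} [MeasurableSpace α] [MeasurableSpace β]
    [MeasurableSpace δ] {μ : Measure α} {ν : Measure β} [SFinite ν]
    {f g : α × β → δ} (hf : Measurable f) (hg : Measurable g)
    (h : ∀ᵐ a ∂μ, ν.map (fun b => f (a, b)) = ν.map (fun b => g (a, b))) :
    (μ.prod ν).map f = (μ.prod ν).map g := by
  ext s hs
  rw [Measure.map_apply hf hs, Measure.prod_apply (hf hs), Measure.map_apply hg hs,
    Measure.prod_apply (hg hs)]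
  refine lintegral_congr_ae ?_
  filter_upwards [h] with a ha
  have h1 := Measure.map_apply (μ := ν) (hf.comp (measurable_prodMk_left (x := a))) hs
  have h2 := Measure.map_apply (μ := ν) (hg.comp (measurable_prodMk_left (x := a))) hs
  exact h1.symm.trans ((congrArg (fun m => m s) ha).trans h2)

theorem map_zfGain_mul {a b n : ℕ} {ℓ : Measure (Matrix (Fin a) (Fin b) ℂ)}
    (hℓ : ∀ Q ∈ Matrix.unitaryGroup (Fin b) ℂ, ℓ.map (fun P => P * Q) = ℓ) (e : Fin n ↪ Fin b)
    {Z : Matrix (Fin b) (Fin n) ℂ} (hZ : (Zᴴ * Z).det ≠ 0) (k : Fin n) :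
    ℓ.map (fun P => zfGain (P * Z) k) =
      ℓ.map (fun P => zfGain Z k * zfGain (P.submatrix id e) k) := by
  obtain ⟨-, Q, hQ, h⟩ := exists_unitary_zfGain_mul (l := Fin a) e hZ k
  have hm : Measurable fun P : Matrix (Fin a) (Fin b) ℂ =>
      zfGain Z k * zfGain (P.submatrix id e) k :=
    ((measurable_zfGain k).comp (measurable_matrix_submatrix id e)).const_mul _
  have hm' : Measurable fun P : Matrix (Fin a) (Fin b) ℂ => P * Q :=
    measurable_id.matrix_mul measurable_const
  conv_rhs => rw [← hℓ Q hQ, Measure.map_map hm hm']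
  simp only [h]
  rfl

/-- The gain of a product with a right-unitarily invariant random matrix. -/
theorem map_prod_zfGain_mul {a b n : ℕ} {κ : Measure (Matrix (Fin b) (Fin n) ℂ)}
    {ℓ : Measure (Matrix (Fin a) (Fin b) ℂ)} [SFinite κ] [SFinite ℓ]
    (hκ : ∀ᵐ Z ∂κ, (Zᴴ * Z).det ≠ 0)
    (hℓ : ∀ Q ∈ Matrix.unitaryGroup (Fin b) ℂ, ℓ.map (fun P => P * Q) = ℓ) (e : Fin n ↪ Fin b)
    (k : Fin n) :
    (κ.prod ℓ).map (fun q => zfGain (q.2 * q.1) k) =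
      (κ.map fun Z => zfGain Z k).mconv (ℓ.map fun P => zfGain (P.submatrix id e) k) := by
  have hm : Measurable fun P : Matrix (Fin a) (Fin b) ℂ => zfGain (P.submatrix id e) k :=
    (measurable_zfGain k).comp (measurable_matrix_submatrix id e)
  rw [Measure.mconv, Measure.map_prod_map _ _ (measurable_zfGain k) hm,
    Measure.map_map measurable_mul ((measurable_zfGain k).prodMap hm)]
  refine map_prod_congr_of_ae
    ((measurable_zfGain k).comp (measurable_snd.matrix_mul measurable_fst))
    (measurable_mul.comp ((measurable_zfGain k).prodMap hm)) ?_
  filter_upwards [hκ] with Z hZ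
  exact map_zfGain_mul hℓ e hZ k

/-! ## Truncated Haar unitary matrices -/

/-- Haar measure is left invariant by definition. Its right translates are again Haar probability
measures, hence equal to it by uniqueness; closedness of the group supplies local compactness. -/
theorem unitaryGroup_map_mul_right {N : ℕ} (h : Measure (Matrix.unitaryGroup (Fin N) ℂ))
    [IsProbabilityMeasure h] [h.IsHaarMeasure] (W : Matrix.unitaryGroup (Fin N) ℂ) :
    h.map (fun U => U * W) = h := by
  have hlc : LocallyCompactSpace (Matrix (Fin N) (Fin N) ℂ) :=
    inferInstanceAs (LocallyCompactSpace (Fin N → Fin N → ℂ))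
  have hcl : IsClosed (Matrix.unitaryGroup (Fin N) ℂ : Set (Matrix (Fin N) (Fin N) ℂ)) := by
    have : (Matrix.unitaryGroup (Fin N) ℂ : Set (Matrix (Fin N) (Fin N) ℂ)) =
        {U | U * star U = 1} := by
      ext U; exact Matrix.mem_unitaryGroup_iff
    rw [this]
    exact isClosed_eq (by fun_prop) continuous_const
  have := hcl.isClosedEmbedding_subtypeVal.locallyCompactSpace
  have := Measure.isProbabilityMeasure_map (μ := h) (measurable_mul_const W).aemeasurable
  exact Measure.isHaarMeasure_eq_of_isProbabilityMeasure _ _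

theorem measurable_topLeftBlock {m k N : ℕ} (hm : m ≤ N) (hk : k ≤ N) :
    Measurable fun U : Matrix.unitaryGroup (Fin N) ℂ =>
      topLeftBlock hm hk (U : Matrix (Fin N) (Fin N) ℂ) :=
  (measurable_matrix_submatrix _ _).comp measurable_subtype_coe

/-- Extend `J Q`, with `J` the first `k` columns of the identity, to a unitary `W` of size `N`. Then
the block of `U W` is the block of `U` times `Q`, and right invariance of Haar measure applies. -/
theorem map_topLeftBlock_mul_right {m k N : ℕ} (hm : m ≤ N) (hk : k ≤ N)
    (h : Measure (Matrix.unitaryGroup (Fin N) ℂ)) [IsProbabilityMeasure h] [h.IsHaarMeasure]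
    {Q : Matrix (Fin k) (Fin k) ℂ} (hQ : Q ∈ Matrix.unitaryGroup (Fin k) ℂ) :
    (h.map fun U : Matrix.unitaryGroup (Fin N) ℂ =>
        topLeftBlock hm hk (U : Matrix (Fin N) (Fin N) ℂ)).map (fun P => P * Q) =
      h.map fun U : Matrix.unitaryGroup (Fin N) ℂ =>
        topLeftBlock hm hk (U : Matrix (Fin N) (Fin N) ℂ) := by
  set J : Matrix (Fin N) (Fin k) ℂ := (1 : Matrix (Fin N) (Fin N) ℂ).submatrix id (Fin.castLE hk)
    with hJ
  have hJJ : Jᴴ * J = 1 := by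
    rw [hJ, Matrix.conjTranspose_submatrix, Matrix.conjTranspose_one,
      ← Matrix.submatrix_mul _ _ (Fin.castLE hk) id (Fin.castLE hk) Function.bijective_id, one_mul,
      Matrix.submatrix_one _ (Fin.castLE_injective hk)]
  obtain ⟨W, hW, hWJ⟩ := exists_unitary_extend (Fin.castLEEmb hk) (J * Q) (by
    rw [Matrix.conjTranspose_mul, Matrix.mul_assoc, ← Matrix.mul_assoc Jᴴ, hJJ, Matrix.one_mul]
    exact Matrix.mem_unitaryGroup_iff'.1 hQ)
  have hm' : Measurable fun P : Matrix (Fin m) (Fin k) ℂ => P * Q :=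
    measurable_id.matrix_mul measurable_const
  rw [Measure.map_map hm' (measurable_topLeftBlock hm hk)]
  conv_rhs => rw [← unitaryGroup_map_mul_right h ⟨W, hW⟩, Measure.map_map
    (measurable_topLeftBlock hm hk) (measurable_mul_const _)]
  congr 1
  ext U : 1
  have h1 : topLeftBlock hm hk ((U : Matrix (Fin N) (Fin N) ℂ) * W) =
      (U : Matrix (Fin N) (Fin N) ℂ).submatrix (Fin.castLE hm) id *
        W.submatrix id (Fin.castLEEmb hk) := rfl
  have h2 : topLeftBlock hm hk (U : Matrix (Fin N) (Fin N) ℂ) =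
      (U : Matrix (Fin N) (Fin N) ℂ).submatrix (Fin.castLE hm) id * J := by
    rw [hJ]
    conv_lhs => rw [← Matrix.mul_one (U : Matrix (Fin N) (Fin N) ℂ)]
    rfl
  change topLeftBlock hm hk (U : Matrix (Fin N) (Fin N) ℂ) * Q =
    topLeftBlock hm hk ((U : Matrix (Fin N) (Fin N) ℂ) * W)
  rw [h1, h2, hWJ, Matrix.mul_assoc]

theorem zfGain_nonneg {m n : Type*} [Fintype m] [Fintype n] [DecidableEq n] (A : Matrix m n ℂ)
    (k : n) : 0 ≤ zfGain A k := by
  have h := (Matrix.posSemidef_conjTranspose_mul_self A).inv.diag_nonneg (i := k)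
  exact inv_nonneg.2 (Complex.nonneg_iff.1 h).1

/-- The moments of the gain of a truncated Haar unitary matrix. -/
theorem hasMoments_zfGain_topLeftBlock {N n r ν μ : ℕ} (hN : N = n + 1 + μ) (hr : r = n + 1 + ν)
    (hrN : r ≤ N) (hn : n + 1 ≤ N) (h : Measure (Matrix.unitaryGroup (Fin N) ℂ))
    [IsProbabilityMeasure h] [h.IsHaarMeasure] (k : Fin (n + 1)) :
    HasMoments (h.map fun U : Matrix.unitaryGroup (Fin N) ℂ =>
        zfGain (topLeftBlock hrN hn (U : Matrix (Fin N) (Fin N) ℂ)) k)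
      fun s => (((ν.factorial : ℝ)⁻¹ : ℝ) * Complex.Gamma (ν + (s + 1))) /
        (((μ.factorial : ℝ)⁻¹ : ℝ) * Complex.Gamma (μ + (s + 1))) := by
  have hNN : N ≤ N := le_rfl
  set R : Matrix.unitaryGroup (Fin N) ℂ → Matrix (Fin r) (Fin N) ℂ :=
    fun U => topLeftBlock hrN hNN (U : Matrix (Fin N) (Fin N) ℂ) with hR
  have hRm : Measurable R := measurable_topLeftBlock hrN hNN
  have := Measure.isProbabilityMeasure_map (μ := h) hRm.aemeasurable
  have hm : Measurable fun P : Matrix (Fin r) (Fin N) ℂ =>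
      zfGain (P.submatrix id (Fin.castLEEmb hn)) k :=
    (measurable_zfGain k).comp (measurable_matrix_submatrix id _)
  have h1 := map_prod_zfGain_mul (ae_ginibreMeasure_gram_det_ne_zero (N := N) (n := n + 1) hn)
    (ℓ := h.map R) (fun Q hQ => map_topLeftBlock_mul_right hrN hNN h hQ) (Fin.castLEEmb hn) k
  rw [map_zfGain_ginibreMeasure hN k, Measure.map_map hm hRm] at h1
  have hm1 : Measurable fun q : Matrix (Fin N) (Fin (n + 1)) ℂ × Matrix (Fin r) (Fin N) ℂ =>
      zfGain (q.2 * q.1) k :=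
    (measurable_zfGain k).comp (measurable_snd.matrix_mul measurable_fst)
  -- The other evaluation of the same gain: given `U`, the matrix `U A` is Ginibre, so its top `r`
  -- rows form an `r × (n + 1)` Ginibre matrix.
  have h2 : ((ginibreMeasure N (n + 1)).prod (h.map R)).map (fun q => zfGain (q.2 * q.1) k) =
      gammaLaw ν := by
    have h3 := Measure.map_prod_map (ginibreMeasure N (n + 1)) h measurable_id hRm
    rw [Measure.map_id] at h3
    rw [h3, Measure.map_map hm1 (measurable_id.prodMap hRm), ← Measure.prod_swap,
      Measure.map_map (hm1.comp (measurable_id.prodMap hRm)) measurable_swap]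
    refine map_prod_eq_of_ae ((hm1.comp (measurable_id.prodMap hRm)).comp measurable_swap)
      (ae_of_all _ fun U => ?_)
    have hU : Measurable fun A : Matrix (Fin N) (Fin (n + 1)) ℂ =>
        (U : Matrix (Fin N) (Fin N) ℂ) * A := measurable_const.matrix_mul measurable_id
    rw [← map_zfGain_ginibreMeasure hr k,
      ← map_ginibreMeasure_submatrix (Fin.castLEEmb hrN) (Function.Embedding.refl (Fin (n + 1))),
      Measure.map_map (measurable_zfGain k) (measurable_matrix_submatrix _ _)]
    conv_rhs => rw [← map_ginibreMeasure_mul_left (n := n + 1) U.2, Measure.map_map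
      ((measurable_zfGain k).comp (measurable_matrix_submatrix _ _)) hU]
    rfl
  have hβ : (fun U : Matrix.unitaryGroup (Fin N) ℂ =>
      zfGain (topLeftBlock hrN hn (U : Matrix (Fin N) (Fin N) ℂ)) k) =
      (fun P : Matrix (Fin r) (Fin N) ℂ => zfGain (P.submatrix id (Fin.castLEEmb hn)) k) ∘ R := rfl
  have := Measure.isProbabilityMeasure_map (μ := h) (hm.comp hRm).aemeasurable
  rw [hβ]
  refine HasMoments.of_mconv (hasMoments_gammaLaw μ) ?_ ?_ fun s hs => ?_
  · exact (ae_map_iff (hm.comp hRm).aemeasurable measurableSet_Ici).2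
      (ae_of_all _ fun U => zfGain_nonneg _ k)
  · rw [← h1, h2]
    exact hasMoments_gammaLaw ν
  · refine mul_ne_zero (by simp [Nat.factorial_ne_zero]) (Complex.Gamma_ne_zero_of_re_pos ?_)
    simp only [Complex.add_re, Complex.natCast_re, Complex.one_re]
    positivity

/-! ## The chain of products -/

theorem measurable_chainProd (M : ℕ) (d : Fin (M + 1) → ℕ) :
    Measurable fun P : (j : Fin M) → Matrix (Fin (d j.succ)) (Fin (d j.castSucc)) ℂ =>
      chainProd M d P := by
  induction M with
  | zero => exact measurable_const
  | succ M ih =>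
    have h1 := (ih fun i => d i.castSucc).comp (measurable_pi_lambda
      (fun (P : (j : Fin (M + 1)) → Matrix (Fin (d j.succ)) (Fin (d j.castSucc)) ℂ) (j : Fin M) =>
        P j.castSucc) fun j => measurable_pi_apply j.castSucc)
    exact (measurable_pi_apply (Fin.last M)).matrix_mul h1

/-- The moments of the gain of a product of independent right-unitarily invariant matrices. -/
theorem hasMoments_zfGain_chainProd {Ω : Type*} [MeasurableSpace Ω] {Pr : Measure Ω}
    [IsProbabilityMeasure Pr] {n : ℕ} (k : Fin n) (M : ℕ) (d : Fin (M + 1) → ℕ)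
    (e : (j : Fin M) → Fin n ↪ Fin (d j.castSucc))
    {P : (j : Fin M) → Ω → Matrix (Fin (d j.succ)) (Fin (d j.castSucc)) ℂ}
    (hP : iIndepFun P Pr) (hPm : ∀ j, AEMeasurable (P j) Pr)
    (hinv : ∀ j : Fin M, ∀ Q ∈ Matrix.unitaryGroup (Fin (d j.castSucc)) ℂ,
      (Pr.map (P j)).map (fun A => A * Q) = Pr.map (P j)) {ψ : Fin M → ℂ → ℂ}
    (hψ : ∀ j, HasMoments ((Pr.map (P j)).map fun A => zfGain (A.submatrix id (e j)) k) (ψ j))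
    {Z : Matrix (Fin (d 0)) (Fin n) ℂ} (hZ : 0 < zfGain Z k) :
    HasMoments (Pr.map fun ω => zfGain (chainProd M d (fun j => P j ω) * Z) k)
      fun s => (zfGain Z k : ℂ) ^ s * ∏ j, ψ j s := by
  induction M with
  | zero =>
    have h1 : (fun ω => zfGain (chainProd 0 d (fun j => P j ω) * Z) k) = fun _ => zfGain Z k := by
      funext ω
      congr 1
      exact Matrix.one_mul Z
    rw [h1, Measure.map_const, measure_univ, one_smul]
    simpa using hasMoments_dirac hZ
  | succ M ih =>
    have ih' := ih (fun i => d i.castSucc) (fun j => e j.castSucc)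
      (P := fun j => P j.castSucc) (hP.precomp (Fin.castSucc_injective M))
      (fun j => hPm j.castSucc) (fun j => hinv j.castSucc) (ψ := fun j => ψ j.castSucc)
      (fun j => hψ j.castSucc) (Z := Z) hZ
    -- The same matrix, with its row index type written as the shortened chain expects it.
    let Z' : Matrix (Fin (d (Fin.castSucc (0 : Fin (M + 1))))) (Fin n) ℂ := Z
    set Y : Ω → Matrix (Fin (d (Fin.last M).castSucc)) (Fin n) ℂ := fun ω =>
      (chainProd M (fun i => d i.castSucc) fun j => P j.castSucc ω) * Z' with hY
    have hF : Measurable fun p : (j : Fin M) →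
        Matrix (Fin (d j.castSucc.succ)) (Fin (d j.castSucc.castSucc)) ℂ =>
          (chainProd M (fun i => d i.castSucc) p) * Z' :=
      (measurable_chainProd M fun i => d i.castSucc).matrix_mul measurable_const
    have hYm : AEMeasurable Y Pr :=
      hF.comp_aemeasurable (aemeasurable_pi_lambda _ fun j => hPm j.castSucc)
    have hind : IndepFun Y (P (Fin.last M)) Pr := by
      have h1 := hP.indepFun_finset₀ (Finset.univ.map Fin.castSuccEmb) {Fin.last M} (by
        rw [Finset.disjoint_singleton_right]
        simp [Fin.castSucc_ne_last]) hPm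
      have h2 : Measurable fun (p : (i : (Finset.univ.map Fin.castSuccEmb : Finset (Fin (M + 1)))) →
          Matrix (Fin (d i.1.succ)) (Fin (d i.1.castSucc)) ℂ) (j : Fin M) =>
          p ⟨j.castSucc, by simp⟩ := measurable_pi_lambda _ fun j => measurable_pi_apply _
      exact h1.comp (hF.comp h2) (measurable_pi_apply (⟨Fin.last M, by simp⟩ :
        ({Fin.last M} : Finset (Fin (M + 1)))))
    have hlaw := hind.map_prod_eq_prod_map_map hYm (hPm (Fin.last M))
    have hdet : ∀ᵐ A ∂Pr.map Y, (Aᴴ * A).det ≠ 0 := by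
      have hs : MeasurableSet {A : Matrix (Fin (d (Fin.last M).castSucc)) (Fin n) ℂ |
          (Aᴴ * A).det ≠ 0} := measurable_gram_det (measurableSet_singleton 0).compl
      refine (ae_map_iff hYm hs).2 ?_
      -- Full column rank of the partial product comes for free: its gain is almost surely positive
      -- by induction, while a singular Gram matrix would make the gain `0`.
      filter_upwards [ae_of_ae_map ((measurable_zfGain k).comp_aemeasurable hYm) ih'.pos] with ω hω h0
      exact hω.ne' (zfGain_eq_zero h0 k)
    have hpm := Measure.isProbabilityMeasure_map hYm
    have hpm' := Measure.isProbabilityMeasure_map (hPm (Fin.last M))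
    have hstep := map_prod_zfGain_mul hdet (hinv (Fin.last M)) (e (Fin.last M)) k
    have hg : Measurable fun q : Matrix (Fin (d (Fin.last M).castSucc)) (Fin n) ℂ ×
        Matrix (Fin (d (Fin.last M).succ)) (Fin (d (Fin.last M).castSucc)) ℂ =>
          zfGain (q.2 * q.1) k :=
      (measurable_zfGain k).comp (measurable_snd.matrix_mul measurable_fst)
    rw [← hlaw, AEMeasurable.map_map_of_aemeasurable hg.aemeasurable
      (hYm.prodMk (hPm (Fin.last M))), AEMeasurable.map_map_of_aemeasurable
      (measurable_zfGain k).aemeasurable hYm] at hstep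
    have h3 : (fun ω => zfGain (chainProd (M + 1) d (fun j => P j ω) * Z) k) =
        (fun q : Matrix (Fin (d (Fin.last M).castSucc)) (Fin n) ℂ ×
          Matrix (Fin (d (Fin.last M).succ)) (Fin (d (Fin.last M).castSucc)) ℂ =>
            zfGain (q.2 * q.1) k) ∘ fun ω => (Y ω, P (Fin.last M) ω) := by
      funext ω
      change zfGain (P (Fin.last M) ω *
        (chainProd M (fun i => d i.castSucc) fun j => P j.castSucc ω) * Z') k = _
      rw [Matrix.mul_assoc]
      rfl
    rw [h3, hstep]
    have h4 := HasMoments.mconv ih' (hψ (Fin.last M))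
    simp only [Fin.prod_univ_castSucc, ← mul_assoc]
    exact h4

/-! ## The zero-forcing receiver -/

theorem invDiag_pos {n : ℕ} {S : Matrix (Fin n) (Fin n) ℂ} (hS : S.PosDef) (k : Fin n) :
    0 < invDiag S k := (Complex.pos_iff.1 hS.inv.diag_pos).1

theorem zfGain_sqrt {n : ℕ} {S : Matrix (Fin n) (Fin n) ℂ} (hS : S.PosDef) (k : Fin n) :
    zfGain (CFC.sqrt S) k = (invDiag S k)⁻¹ := by
  have h0 : (CFC.sqrt S)ᴴ = CFC.sqrt S := (CFC.sqrt_nonneg S).isSelfAdjoint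
  have h1 : (CFC.sqrt S)ᴴ * CFC.sqrt S = S := by
    rw [h0, CFC.sqrt_mul_sqrt_self S hS.posSemidef.nonneg]
  rw [zfGain, h1, invDiag]

section

variable {Ω : Type*} [MeasurableSpace Ω] {Pr : Measure Ω} {r n : ℕ}
  {H : Ω → Matrix (Fin r) (Fin n) ℂ} {σ δ κ : ℝ}

theorem zfSINR_eq_div_inv_mul (hσ : 0 < σ) (A : Matrix (Fin r) (Fin n) ℂ) (k : Fin n) :
    zfSINR δ A k = (σ / δ)⁻¹ * (σ * zfGain A k) := by
  rw [zfSINR_eq_mul_zfGain, inv_div]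
  field_simp

theorem hasPosDensity_zfSINR (hH : AEMeasurable H Pr) (k : Fin n) (hσ : 0 < σ) (hδ : 0 < δ)
    (hκ : 0 < κ) {Φ : ℂ → ℂ} {f : ℝ → ℝ}
    (h : HasMoments (Pr.map fun ω => σ * zfGain (H ω) k) fun s => κ * Φ (s + 1))
    (hf : Measurable f) (h0 : ∀ x, 0 < x → 0 ≤ f x)
    (hM : ∀ s : ℂ, 1 ≤ s.re → HasMellin (fun x => (f x : ℂ)) s (Φ s)) :
    HasPosDensity Pr (fun ω => zfSINR δ (H ω) k) fun y => σ / δ * κ * f (σ * y / δ) := by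
  have hX : AEMeasurable (fun ω => σ * zfGain (H ω) k) Pr :=
    ((measurable_zfGain k).comp_aemeasurable hH).const_mul σ
  have h1 := h.hasPosDensity hX hf h0 hM hκ.le (div_pos hσ hδ)
  simpa only [zfSINR_eq_div_inv_mul hσ, mul_div_right_comm] using h1

theorem log_one_add_zfSINR (hσ : 0 < σ) (A : Matrix (Fin r) (Fin n) ℂ) (k : Fin n) :
    Real.log (1 + zfSINR δ A k) = Real.log (1 + δ / σ * (σ * zfGain A k)) := by
  rw [zfSINR_eq_div_inv_mul hσ, inv_div]

theorem integrable_log_zfSINR (hH : AEMeasurable H Pr) (k : Fin n) (hσ : 0 < σ) (hδ : 0 < δ)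
    {φ : ℂ → ℂ} (h : HasMoments (Pr.map fun ω => σ * zfGain (H ω) k) φ) :
    Integrable (fun ω => Real.log (1 + zfSINR δ (H ω) k)) Pr := by
  have hX : AEMeasurable (fun ω => σ * zfGain (H ω) k) Pr :=
    ((measurable_zfGain k).comp_aemeasurable hH).const_mul σ
  simp only [log_one_add_zfSINR hσ]
  exact (h.integrable_log (div_pos hδ hσ)).comp_aemeasurable hX

/-- The argument of the G-function is `δ / σ k` because the SINR is `δ / σ k` times the normalised
gain `σ k * zfGain`, whose moments do not depend on `k`. -/
theorem exists_hasMeijerG_zfSumRate (hH : AEMeasurable H Pr) {σ : Fin n → ℝ} (hσ : ∀ k, 0 < σ k)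
    (hδ : 0 < δ) (hκ : κ ≠ 0) {A D : List ℝ} (hA : ∀ u ∈ A, u ≤ 0)
    (h : ∀ k, HasMoments (Pr.map fun ω => σ k * zfGain (H ω) k) fun s =>
      κ * ((A.map fun u : ℝ => Complex.Gamma (1 - u + s)).prod /
        (D.map fun u : ℝ => Complex.Gamma (1 - u + s)).prod)) :
    ∃ G : Fin n → ℝ, (∀ k, HasMeijerG (A ++ [1, 1]) [] [1] (D ++ [0]) (δ / σ k) (G k : ℂ)) ∧
      zfSumRate Pr δ H = κ * ∑ k, G k := by
  refine ⟨fun k => κ⁻¹ * ∫ y, Real.log (1 + δ / σ k * y) ∂Pr.map fun ω => σ k * zfGain (H ω) k,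
    fun k => (h k).hasMeijerG_log hκ hA (div_pos hδ (hσ k)), ?_⟩
  rw [← Finset.mul_sum, mul_inv_cancel_left₀ hκ, zfSumRate]
  refine Finset.sum_congr rfl fun k _ => ?_
  have hX : AEMeasurable (fun ω => σ k * zfGain (H ω) k) Pr :=
    ((measurable_zfGain k).comp_aemeasurable hH).const_mul (σ k)
  rw [integral_map hX (Measurable.aestronglyMeasurable (by fun_prop))]
  simp only [log_one_add_zfSINR (hσ k)]

end

theorem le_chainDim (n : ℕ) {M : ℕ} (ν : Fin M → ℕ) (i : Fin (M + 1)) : n ≤ chainDim n ν i := by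
  induction i using Fin.cases with
  | zero => exact le_rfl
  | succ i => exact Nat.le_add_right n (ν i)

section

variable {Ω : Type*} [MeasurableSpace Ω] {Pr : Measure Ω} {n M : ℕ}
  {ν : Fin M → ℕ} {S : Matrix (Fin n) (Fin n) ℂ}

theorem aemeasurable_channelMatrix
    {P : (j : Fin M) → Ω → Matrix (Fin (chainDim n ν j.succ)) (Fin (chainDim n ν j.castSucc)) ℂ}
    (hP : ∀ j, AEMeasurable (P j) Pr) :
    AEMeasurable (fun ω => channelMatrix ν (fun j => P j ω) S) Pr := by
  have h : Measurable fun p : (j : Fin M) →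
      Matrix (Fin (chainDim n ν j.succ)) (Fin (chainDim n ν j.castSucc)) ℂ =>
        channelMatrix ν p S :=
    Measurable.matrix_mul (m := Fin n) (measurable_chainProd M (chainDim n ν)) measurable_const
  exact h.comp_aemeasurable (aemeasurable_pi_lambda _ hP)

/-- Run the chain from `√Σ`, whose gain is `1 / σ_k`; the normalisation by `σ_k` cancels its
contribution to the moments. -/
theorem hasMoments_zfGain_channelMatrix [IsProbabilityMeasure Pr] (hS : S.PosDef) (k : Fin n)
    {P : (j : Fin M) → Ω → Matrix (Fin (chainDim n ν j.succ)) (Fin (chainDim n ν j.castSucc)) ℂ}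
    (hP : iIndepFun P Pr) (hPm : ∀ j, AEMeasurable (P j) Pr)
    (hinv : ∀ j : Fin M, ∀ Q ∈ Matrix.unitaryGroup (Fin (chainDim n ν j.castSucc)) ℂ,
      (Pr.map (P j)).map (fun A => A * Q) = Pr.map (P j)) {ψ : Fin M → ℂ → ℂ}
    (hψ : ∀ j : Fin M, HasMoments ((Pr.map (P j)).map fun A =>
      zfGain (A.submatrix id (Fin.castLEEmb (le_chainDim n ν j.castSucc))) k) (ψ j)) :
    HasMoments (Pr.map fun ω => invDiag S k * zfGain (channelMatrix ν (fun j => P j ω) S) k)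
      fun s => ∏ j, ψ j s := by
  have hσ := invDiag_pos hS k
  have hσ0 : (invDiag S k : ℂ) ≠ 0 := by exact_mod_cast hσ.ne'
  let Z : Matrix (Fin n) (Fin n) ℂ := CFC.sqrt S
  have h1 := hasMoments_zfGain_chainProd k M (chainDim n ν) _ hP hPm hinv hψ (Z := Z) (by
      change 0 < zfGain (CFC.sqrt S) k
      rw [zfGain_sqrt hS]; exact inv_pos.2 hσ)
  have h2 := (hasMoments_dirac hσ).mconv h1
  have hm : AEMeasurable (fun ω => zfGain (channelMatrix ν (fun j => P j ω) S) k) Pr :=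
    (measurable_zfGain k).comp_aemeasurable (aemeasurable_channelMatrix hPm)
  have h3 : (Pr.map fun ω => invDiag S k * zfGain (channelMatrix ν (fun j => P j ω) S) k) =
      (Measure.dirac (invDiag S k)).mconv
        (Pr.map fun ω => zfGain (channelMatrix ν (fun j => P j ω) S) k) := by
    have := Measure.isProbabilityMeasure_map hm
    rw [Measure.mconv, Measure.dirac_prod, Measure.map_map measurable_mul measurable_prodMk_left,
      AEMeasurable.map_map_of_aemeasurable
        (measurable_mul.comp measurable_prodMk_left).aemeasurable hm]
    rfl
  have h4 : (fun s => ∏ j, ψ j s) =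
      fun s => (invDiag S k : ℂ) ^ s * ((zfGain Z k : ℂ) ^ s * ∏ j, ψ j s) := by
    funext s
    rw [← mul_assoc, ← Complex.mul_cpow_ofReal_nonneg hσ.le (zfGain_nonneg _ _), zfGain_sqrt hS]
    push_cast
    rw [mul_inv_cancel₀ hσ0, Complex.one_cpow, one_mul]
  rw [h3, h4]
  exact h2

theorem hasMoments_zfGain_ginibre [IsProbabilityMeasure Pr] (hS : S.PosDef) (k : Fin n)
    {P : (j : Fin M) → Ω → Matrix (Fin (chainDim n ν j.succ)) (Fin (chainDim n ν j.castSucc)) ℂ}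
    (hP : iIndepFun P Pr) (hPl : ∀ j, HasLaw (P j)
      (ginibreMeasure (chainDim n ν j.succ) (chainDim n ν j.castSucc)) Pr) :
    HasMoments (Pr.map fun ω => invDiag S k * zfGain (channelMatrix ν (fun j => P j ω) S) k)
      fun s => ((∏ j, ((ν j).factorial : ℝ))⁻¹ : ℝ) * ∏ j, Complex.Gamma (ν j + (s + 1)) := by
  cases n with
  | zero => exact k.elim0
  | succ n =>
    have h := hasMoments_zfGain_channelMatrix hS k hP (fun j => (hPl j).aemeasurable)
      (fun j Q hQ => by rw [(hPl j).map_eq]; exact map_ginibreMeasure_mul_right hQ)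
      (ψ := fun j s => (((ν j).factorial : ℝ)⁻¹ : ℝ) * Complex.Gamma (ν j + (s + 1)))
      (fun j => by
        have h1 := map_ginibreMeasure_submatrix (Function.Embedding.refl (Fin (chainDim (n + 1) ν j.succ)))
          (Fin.castLEEmb (le_chainDim (n + 1) ν j.castSucc))
        -- Only `n + 1` columns of the `j`-th factor are kept, so `ν j` enters through the number of
        -- rows and the previous dimension plays no role.
        have h2 := map_zfGain_ginibreMeasure (N := chainDim (n + 1) ν j.succ) (a := ν j) rfl k
        rw [← h1, Measure.map_map (measurable_zfGain k) (measurable_matrix_submatrix _ _)] at h2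
        rw [(hPl j).map_eq]
        have h3 := hasMoments_gammaLaw (ν j)
        rw [← h2] at h3
        exact h3)
    simpa only [Finset.prod_mul_distrib, ← Complex.ofReal_prod, Finset.prod_inv_distrib] using h

theorem hasMoments_zfGain_haar [IsProbabilityMeasure Pr] (hS : S.PosDef) (k : Fin n) {μ : Fin M → ℕ}
    (hrow : ∀ j : Fin M, chainDim n ν j.succ ≤ n + μ j)
    (hcol : ∀ j : Fin M, chainDim n ν j.castSucc ≤ n + μ j)
    {U : (j : Fin M) → Ω → Matrix.unitaryGroup (Fin (n + μ j)) ℂ} (hU : iIndepFun U Pr)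
    (hUl : ∀ j, AEMeasurable (U j) Pr ∧ (Pr.map (U j)).IsHaarMeasure) :
    HasMoments (Pr.map fun ω => invDiag S k * zfGain (channelMatrix ν
        (fun j => topLeftBlock (hrow j) (hcol j) (U j ω : Matrix _ _ ℂ)) S) k)
      fun s => ((∏ j, ((μ j).factorial : ℝ) / ((ν j).factorial : ℝ) : ℝ) : ℂ) *
        ∏ j, Complex.Gamma (ν j + (s + 1)) / Complex.Gamma (μ j + (s + 1)) := by
  cases n with
  | zero => exact k.elim0
  | succ n =>
    have hm := fun j => measurable_topLeftBlock (hrow j) (hcol j)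
    have hmap : ∀ j, Pr.map (fun ω => topLeftBlock (hrow j) (hcol j) (U j ω : Matrix _ _ ℂ)) =
        (Pr.map (U j)).map fun V : Matrix.unitaryGroup (Fin (n + 1 + μ j)) ℂ =>
          topLeftBlock (hrow j) (hcol j) (V : Matrix _ _ ℂ) := fun j =>
      (AEMeasurable.map_map_of_aemeasurable (hm j).aemeasurable (hUl j).1).symm
    have hprob := fun j => Measure.isProbabilityMeasure_map (μ := Pr) (hUl j).1
    have hhaar := fun j => (hUl j).2
    let P : (j : Fin M) → Ω →
        Matrix (Fin (chainDim (n + 1) ν j.succ)) (Fin (chainDim (n + 1) ν j.castSucc)) ℂ :=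
      fun j ω => topLeftBlock (hrow j) (hcol j) (U j ω : Matrix _ _ ℂ)
    have hP : iIndepFun P Pr := hU.comp _ hm
    have hPm : ∀ j, AEMeasurable (P j) Pr := fun j => (hm j).comp_aemeasurable (hUl j).1
    have h := hasMoments_zfGain_channelMatrix hS k hP hPm
      (fun j Q hQ => by rw [hmap]; exact map_topLeftBlock_mul_right _ _ _ hQ)
      (ψ := fun j s => ((((ν j).factorial : ℝ)⁻¹ : ℝ) * Complex.Gamma (ν j + (s + 1))) /
        ((((μ j).factorial : ℝ)⁻¹ : ℝ) * Complex.Gamma (μ j + (s + 1))))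
      (fun j => by
        have h1 := hasMoments_zfGain_topLeftBlock (N := n + 1 + μ j) (ν := ν j) rfl
          (r := chainDim (n + 1) ν j.succ) rfl (hrow j) (Nat.le_add_right _ _) (Pr.map (U j)) k
        have hz : Measurable fun A : Matrix (Fin (chainDim (n + 1) ν j.succ))
            (Fin (chainDim (n + 1) ν j.castSucc)) ℂ =>
            zfGain (A.submatrix id (Fin.castLEEmb (le_chainDim (n + 1) ν j.castSucc))) k :=
          (measurable_zfGain k).comp (measurable_matrix_submatrix _ _)
        rw [hmap, Measure.map_map hz (hm j)]
        exact h1)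
    convert h using 1
    funext s
    rw [Complex.ofReal_prod, ← Finset.prod_mul_distrib]
    refine Finset.prod_congr rfl fun j _ => ?_
    push_cast
    field_simp

end

theorem paramList_Gamma_eq {M : ℕ} (ν : Fin M → ℕ) (s : ℂ) :
    ((negParamList ν).map fun u : ℝ => Complex.Gamma (1 - u + s)).prod =
      ∏ j, Complex.Gamma (ν j + (s + 1)) := by
  rw [prod_map_negParamList]
  refine Finset.prod_congr rfl fun j _ => ?_
  push_cast
  ring_nf

theorem nonpos_of_mem_negParamList {M : ℕ} (ν : Fin M → ℕ) : ∀ u ∈ negParamList ν, u ≤ 0 := by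
  simp [negParamList, List.mem_ofFn]

theorem mainTheorem4
    {Ω : Type*} [MeasurableSpace Ω] (Pr : Measure Ω) [IsProbabilityMeasure Pr]
    (n M : ℕ) (hM : 0 < M) (ν : Fin M → ℕ)
    (S : Matrix (Fin n) (Fin n) ℂ) (hS : S.PosDef) (δ : ℝ) (hδ : 0 < δ) :
    -- products of Ginibre matrices
    (∀ P : (j : Fin M) → Ω →
          Matrix (Fin (chainDim n ν j.succ)) (Fin (chainDim n ν j.castSucc)) ℂ,
      iIndepFun P Pr →
      (∀ j, HasLaw (P j) (ginibreMeasure (chainDim n ν j.succ) (chainDim n ν j.castSucc)) Pr) →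
      -- the density of the SINR
      (∃ G : ℝ → ℝ,
        (∀ x, 0 < x → 0 ≤ G x ∧ HasMeijerG [] [] (paramList ν) [] x (G x : ℂ)) ∧
        ∀ k : Fin n,
          HasPosDensity Pr (fun ω => zfSINR δ (channelMatrix ν (fun j => P j ω) S) k)
            (fun y => invDiag S k / ((∏ j, ((ν j).factorial : ℝ)) * δ) *
              G (invDiag S k * y / δ))) ∧
      -- the sum rate
      (∀ k : Fin n, Integrable
        (fun ω => Real.log (1 + zfSINR δ (channelMatrix ν (fun j => P j ω) S) k)) Pr) ∧
      (∃ G : Fin n → ℝ,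
        (∀ k, HasMeijerG (negParamList ν ++ [1, 1]) [] [1] [0] (δ / invDiag S k) (G k : ℂ)) ∧
        zfSumRate Pr δ (fun ω => channelMatrix ν (fun j => P j ω) S) =
          1 / (∏ j, ((ν j).factorial : ℝ)) * ∑ k, G k) ∧
      -- the Gamma law for a single factor
      (M = 1 → ∀ k : Fin n,
        HasPosDensity Pr (fun ω => zfSINR δ (channelMatrix ν (fun j => P j ω) S) k)
          (fun y => invDiag S k / (((ν ⟨0, hM⟩).factorial : ℝ) * δ) *
            (invDiag S k * y / δ) ^ (ν ⟨0, hM⟩) * Real.exp (-(invDiag S k * y / δ))))) ∧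
    -- products of truncated unitary matrices
    (∀ (μ : Fin M → ℕ)
        (hrow : ∀ j : Fin M, chainDim n ν j.succ ≤ n + μ j)
        (hcol : ∀ j : Fin M, chainDim n ν j.castSucc ≤ n + μ j)
        (U : (j : Fin M) → Ω → Matrix.unitaryGroup (Fin (n + μ j)) ℂ),
      iIndepFun U Pr →
      (∀ j, AEMeasurable (U j) Pr ∧ (Pr.map (U j)).IsHaarMeasure) →
      -- the density of the SINR, unless all the factors are isometries
      ((∃ j, ν j < μ j) → ∃ G : ℝ → ℝ,
        (∀ x, 0 < x → 0 ≤ G x ∧ HasMeijerG [] (paramList μ) (paramList ν) [] x (G x : ℂ)) ∧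
        ∀ k : Fin n,
          HasPosDensity Pr
            (fun ω => zfSINR δ (channelMatrix ν
              (fun j => topLeftBlock (hrow j) (hcol j) (U j ω : Matrix _ _ ℂ)) S) k)
            (fun y => invDiag S k / δ *
              (∏ j, ((μ j).factorial : ℝ) / ((ν j).factorial : ℝ)) *
              G (invDiag S k * y / δ))) ∧
      -- the sum rate
      (∀ k : Fin n, Integrable
        (fun ω => Real.log (1 + zfSINR δ (channelMatrix ν
          (fun j => topLeftBlock (hrow j) (hcol j) (U j ω : Matrix _ _ ℂ)) S) k)) Pr) ∧
      (∃ G : Fin n → ℝ,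
        (∀ k, HasMeijerG (negParamList ν ++ [1, 1]) [] [1] (negParamList μ ++ [0])
          (δ / invDiag S k) (G k : ℂ)) ∧
        zfSumRate Pr δ (fun ω => channelMatrix ν
            (fun j => topLeftBlock (hrow j) (hcol j) (U j ω : Matrix _ _ ℂ)) S) =
          (∏ j, ((μ j).factorial : ℝ) / ((ν j).factorial : ℝ)) * ∑ k, G k)) := by
  constructor
  · intro P hP hPl
    have hH : AEMeasurable (fun ω => channelMatrix ν (fun j => P j ω) S) Pr :=
      aemeasurable_channelMatrix fun j => (hPl j).aemeasurable
    have hmom := fun k => hasMoments_zfGain_ginibre hS k hP hPl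
    have hσ := invDiag_pos hS
    have hpos : 0 < ∏ j, ((ν j).factorial : ℝ) :=
      Finset.prod_pos fun j _ => by exact_mod_cast (ν j).factorial_pos
    refine ⟨?_, fun k => integrable_log_zfSINR hH k (hσ k) hδ (hmom k), ?_, ?_⟩
    · obtain ⟨G, hG, hGm, hGM⟩ := exists_meijer_prod_Gamma hM ν
      refine ⟨G, hG, fun k => ?_⟩
      convert hasPosDensity_zfSINR hH k (hσ k) hδ (inv_pos.2 hpos) (hmom k) hGm
        (fun x hx => (hG x hx).1) hGM using 2 with y
      field_simp
    · have h := exists_hasMeijerG_zfSumRate hH hσ hδ (inv_pos.2 hpos).ne'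
        (nonpos_of_mem_negParamList ν) (D := []) fun k => by
          simpa only [paramList_Gamma_eq, List.map_nil, List.prod_nil, div_one] using hmom k
      simpa only [one_div, List.nil_append] using h
    · rintro rfl k
      have h := hmom k
      simp only [Fin.prod_univ_one] at h
      convert hasPosDensity_zfSINR hH k (hσ k) hδ
        (inv_pos.2 (by exact_mod_cast (ν 0).factorial_pos)) h
        (Φ := fun s => Complex.Gamma (ν 0 + s)) (f := gammaKernel (ν 0))
        (continuous_gammaKernel (ν 0)).measurable (fun x hx => gammaKernel_nonneg _ hx)
        (fun s hs => ?_) using 2 with y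
      · rw [gammaKernel]
        change invDiag S k / (((ν 0).factorial : ℝ) * δ) * _ ^ ν 0 * _ = _
        field_simp
      · refine hasMellin_gammaKernel (ν 0) ?_
        have := (Nat.cast_nonneg (ν 0) : (0 : ℝ) ≤ _)
        linarith
  · intro μ hrow hcol U hU hUl
    -- By definition `chainDim n ν j.succ` is `n + ν j`, so the block fitting into `U j` already
    -- contains this inequality.
    have hνμ : ∀ j, ν j ≤ μ j := fun j => Nat.le_of_add_le_add_left (hrow j)
    have hH : AEMeasurable (fun ω => channelMatrix ν
        (fun j => topLeftBlock (hrow j) (hcol j) (U j ω : Matrix _ _ ℂ)) S) Pr :=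
      aemeasurable_channelMatrix fun j =>
        (measurable_topLeftBlock (hrow j) (hcol j)).comp_aemeasurable (hUl j).1
    have hmom := fun k => hasMoments_zfGain_haar hS k hrow hcol hU hUl
    have hσ := invDiag_pos hS
    have hpos : 0 < ∏ j, ((μ j).factorial : ℝ) / ((ν j).factorial : ℝ) :=
      Finset.prod_pos fun j _ => div_pos (by exact_mod_cast (μ j).factorial_pos)
        (by exact_mod_cast (ν j).factorial_pos)
    refine ⟨fun hlt => ?_, fun k => integrable_log_zfSINR hH k (hσ k) hδ (hmom k), ?_⟩
    · obtain ⟨G, hG, hGm, hGM⟩ := exists_meijer_prod_Gamma_div ν μ hνμ hlt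
      exact ⟨G, hG, fun k => hasPosDensity_zfSINR hH k (hσ k) hδ hpos (hmom k) hGm
        (fun x hx => (hG x hx).1) hGM⟩
    · refine exists_hasMeijerG_zfSumRate hH hσ hδ hpos.ne' (nonpos_of_mem_negParamList ν) fun k => ?_
      simpa only [paramList_Gamma_eq, ← Finset.prod_div_distrib] using hmom k
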